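/- **Setting.** Let $D\ge 2$, and let $f$ be a sample path of a centred Gaussian process on $[0,1]^D$ with covariance kernel $k$, where $k(x,x)\le\kappa$ for all $x$ (for example $\kappa=1$ for a normalized kernel). The sample paths are continuous and have partial derivatives, and for some constants $a,b>0$ and $\rho_1,\dots,\rho_D>0$ (the inverse squared length scales), for all $L>0$ and $i\in[D]$, $$P\Big(\sup_{x\in[0,1]^D}|\partial f/\partial x_i|<\sqrt{\rho_i}\,L\Big)\ge 1-ae^{-(L/b)^2}.$$ Evaluations at $x$ return $y=f(x)+\varepsilon$ with independent noise $\varepsilon\sim\mathcal N(0,\sigma^2)$, $\sigma>0$. Fix $\delta\in(0,1)$ and an integer $n>1$ with $n(D-1)>2$, put $M_t=\lceil t^{1/n}\rceil$, $\rho^*=\max_i\rho_i$, and $$\beta_t=2\log\frac{\pi^2t^2}{\delta}+2\tilde d_t\log\Big(4\sqrt{\rho^*}\,b\,\tilde d_t\sqrt{\log(12Da/\delta)}\;t^2\Big),\qquad d_t=|I_t|,\quad \tilde d_t=\max_{1\le s\le t}d_s .$$ **Algorithm.** Start from a non-empty initial dataset $\mathbb D_0$ of noisy evaluations at points chosen independently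 of $f$ and of the noise. In round $t=1,2,\dots$: (i) on the basis of the data of the earlier rounds (and of internal randomness of the algorithm, independent of $f$, the noise and the samples below) select a set $I_t$ of important variables, $\emptyset\ne I_t\ne[D]$ (LassoBO thresholds Lasso-penalized likelihood estimates of the $\rho_i$; any such rule is allowed); (ii) draw $M_t$ independent uniform values in $[0,1]^{[D]\setminus I_t}$ for the unimportant variables, and add to them the unimportant part of the data point with the best value observed so far; (iii) let $\mathcal X_t$ be the set of all $x\in[0,1]^D$ whose unimportant part is one of these $M_t+1$ values, and let $x^t$ maximize $\mu_{t-1}(x)+\sqrt{\beta_t}\,\sigma_{t-1}(x)$ over $x\in\mathcal X_t$, where $\mu_{t-1},\sigma_{t-1}^2$ are the Gaussian-process posterior mean and variance given all earlier data ($\sqrt{\beta_t}$ is read as $0$ if $\beta_t<0$, and $\sqrt{\log u}$ as $0$ if $u<1$); (iv) observe $y^t=f(x^t)+\varepsilon^t$. Let $R_T=\sum_{t=1}^T(\max f-f(x^t))$, let $\gamma_T$ be the maximum information gain (mutual information) about $f$ from $T$ noisy observations, and let $$C_1=\frac{8\kappa}{\log(1+\kappa\sigma^{-2})},\qquad C(d)=2b\sqrt{\log(2Da/\delta)}\,\big((D-d+1)!\big)^{\frac1{D-d}}\log(6/\delta),\qquad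 C=\max_{1\le t\le T}C(d_t).$$ **Result.** Let $c_0>\frac{n(D-1)}{n(D-1)-2}$. 1. For every $T\ge1$, with probability at least $1-\delta$, $$R_T\le\sqrt{\beta_TC_1T\gamma_T}+\frac{\pi^2}{6}+C\sqrt{c_0}\sqrt{\sum_{t=1}^T\sum_{i\in[D]\setminus I_t}\rho_i}\;\,T^{\frac12-\frac1{n(D-1)}} .$$ 2. The last term is always at most $\big(\max_{1\le d\le D-1}C(d)\big)\sqrt{c_0}\,\sqrt{\sum_{i}\rho_i}\;T^{1-\frac1{n(D-1)}}$; in particular it is $O(T^{1-\frac1{n(D-1)}})$ in the worst case. 3. With probability at least $1-\delta$, $\lim_{T\to\infty}R_T/T=0$. -/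

import Mathlib

open MeasureTheory ProbabilityTheory Filter Topology

namespace LassoBO

noncomputable section

/-- The search domain `[0,1]^D`. -/
abbrev Cube (D : ℕ) : Type := Fin D → unitInterval

/-! ### Gaussian-process posterior -/

/-- The kernel matrix of the points `X 0, …, X (m-1)`. -/
def gram {D : ℕ} (k : Cube D → Cube D → ℝ) (m : ℕ) (X : ℕ → Cube D) :
    Matrix (Fin m) (Fin m) ℝ :=
  Matrix.of fun i j => k (X i) (X j)

/-- The vector of kernel values between `x` and the points `X 0, …, X (m-1)`. -/
def crossVec {D : ℕ} (k : Cube D → Cube D → ℝ) (m : ℕ) (X : ℕ → Cube D) (x : Cube D) :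
    Fin m → ℝ :=
  fun i => k x (X i)

/-- Posterior mean at `x` after the first `m` observations `(X s, Y s)`, for a centred Gaussian
process with covariance `k` and noise variance `σ ^ 2`. -/
def postMean {D : ℕ} (k : Cube D → Cube D → ℝ) (σ : ℝ) (m : ℕ) (X : ℕ → Cube D) (Y : ℕ → ℝ)
    (x : Cube D) : ℝ :=
  crossVec k m X x ⬝ᵥ
    ((gram k m X + σ ^ 2 • (1 : Matrix (Fin m) (Fin m) ℝ))⁻¹.mulVec fun i => Y i)

/-- Posterior variance at `x` after observations at `X 0, …, X (m-1)`. -/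
def postVar {D : ℕ} (k : Cube D → Cube D → ℝ) (σ : ℝ) (m : ℕ) (X : ℕ → Cube D)
    (x : Cube D) : ℝ :=
  k x x - crossVec k m X x ⬝ᵥ
    ((gram k m X + σ ^ 2 • (1 : Matrix (Fin m) (Fin m) ℝ))⁻¹.mulVec (crossVec k m X x))

/-- The acquisition function (upper confidence bound): posterior mean plus `√β` times posterior
standard deviation. -/
def acquisition {D : ℕ} (k : Cube D → Cube D → ℝ) (σ β : ℝ) (m : ℕ) (X : ℕ → Cube D)
    (Y : ℕ → ℝ) (x : Cube D) : ℝ :=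
  postMean k σ m X Y x + √β * √(postVar k σ m X x)

/-! ### Objective function: a sample path of a Gaussian process -/

/-- The one-variable function obtained from `g` by letting the `i`-th coordinate of `x` vary in
`[0,1]`. -/
def alongCoord {D : ℕ} (g : Cube D → ℝ) (i : Fin D) (x : Cube D) : ℝ → ℝ :=
  fun s => g (Function.update x i (Set.projIcc 0 1 zero_le_one s))

/-- The partial derivative `∂g/∂x_i` at `x ∈ [0,1]^D` (one-sided on the boundary). -/
def partialD {D : ℕ} (g : Cube D → ℝ) (i : Fin D) (x : Cube D) : ℝ :=
  derivWithin (alongCoord g i x) (Set.Icc 0 1) (x i)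

/-- `sup_x |∂g/∂x_i| < c` (in particular the supremum is finite). -/
def SupPartialLT {D : ℕ} (g : Cube D → ℝ) (i : Fin D) (c : ℝ) : Prop :=
  ∃ m < c, ∀ x : Cube D, |partialD g i x| ≤ m

/-- `f` is a centred Gaussian process on `[0,1]^D` with covariance kernel `k`, whose sample paths
are continuous and have partial derivatives, with
`P (sup_x |∂f/∂x_i| < √(ρ_i) L) ≥ 1 - a exp (-(L/b)^2)` for all `i` and all `L > 0`. -/
structure IsGPSample {D : ℕ} {Ω : Type*} [MeasurableSpace Ω] (P : Measure Ω)
    (k : Cube D → Cube D → ℝ) (ρ : Fin D → ℝ) (a b : ℝ) (f : Cube D → Ω → ℝ) : Prop where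
  measurable : ∀ x, Measurable (f x)
  gaussian : IsGaussianProcess f P
  mean_zero : ∀ x, ∫ ω, f x ω ∂P = 0
  cov_eq : ∀ x x', cov[f x, f x'; P] = k x x'
  continuous : ∀ ω, Continuous fun x => f x ω
  differentiable : ∀ ω i x, DifferentiableWithinAt ℝ (alongCoord (fun x => f x ω) i x)
    (Set.Icc 0 1) (x i : ℝ)
  tail : ∀ i, ∀ L : ℝ, 0 < L →
    1 - a * Real.exp (-(L / b) ^ 2) ≤
      P.real {ω | SupPartialLT (fun x => f x ω) i (√(ρ i) * L)}

/-! ### Maximum information gain -/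

/-- The information gain (mutual information) `I(y_A ; f_A)`, where `f_A` is the vector of values
of `f` at the points `A 0, …, A (T-1)` and `y_A = f_A + ε` with `ε ∼ N(0, σ² I)` independent of
`f_A`: the Kullback–Leibler divergence of the joint law of `(f_A, y_A)` from the product of its
marginals. -/
def infoGain {D : ℕ} {Ω : Type*} [MeasurableSpace Ω] (P : Measure Ω) (f : Cube D → Ω → ℝ)
    (σ : ℝ) {T : ℕ} (A : Fin T → Cube D) : ENNReal :=
  let joint : Measure ((Fin T → ℝ) × (Fin T → ℝ)) :=
    ((P.map fun ω j => f (A j) ω).prod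
      (Measure.pi fun _ : Fin T => gaussianReal 0 (σ ^ 2).toNNReal)).map
        fun p => (p.1, p.1 + p.2)
  InformationTheory.klDiv joint (joint.fst.prod joint.snd)

/-- The maximum information gain `γ_T` about `f` from `T` observations. -/
def maxInfoGain {D : ℕ} {Ω : Type*} [MeasurableSpace Ω] (P : Measure Ω) (f : Cube D → Ω → ℝ)
    (σ : ℝ) (T : ℕ) : ℝ :=
  (⨆ A : Fin T → Cube D, infoGain P f σ A).toReal

/-! ### The algorithm

Data points are numbered from `0`: the points `0, …, N₀ - 1` form the initial dataset and the
point chosen in round `t ≥ 1` has number `N₀ + (t - 1)`.  Hence round `t` starts with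
`N₀ + (t - 1)` observations. -/

/-- The noisy observation at the `s`-th data point: `y_s = f(x_s) + ε_s`. -/
def obs {D : ℕ} {Ω : Type*} (f : Cube D → Ω → ℝ) (ε : ℕ → Ω → ℝ) (pt : ℕ → Ω → Cube D)
    (s : ℕ) (ω : Ω) : ℝ :=
  f (pt s ω) ω + ε s ω

/-- `M_t = ⌈t^{1/n}⌉`. -/
def numSub (n t : ℕ) : ℕ := ⌈(t : ℝ) ^ ((1 : ℝ) / n)⌉₊

/-- `d̃_t = max_{1 ≤ s ≤ t} |I_s|`. -/
def dMax {D : ℕ} {Ω : Type*} (I : ℕ → Ω → Finset (Fin D)) (t : ℕ) (ω : Ω) : ℕ :=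
  (Finset.Icc 1 t).sup fun s => (I s ω).card

/-- `β_t`, as a function of `d = d̃_t` and `t`, where `ρ^* = max_i ρ_i`. -/
def beta {D : ℕ} (ρ : Fin D → ℝ) (a b δ : ℝ) (d t : ℕ) : ℝ :=
  2 * Real.log (Real.pi ^ 2 * t ^ 2 / δ) +
    2 * d * Real.log (4 * √(⨆ i, ρ i) * b * d * √(Real.log (12 * D * a / δ)) * t ^ 2)

/-- The search space built from the important variables `J` and the values `W` for the
unimportant ones: important coordinates are free in `[0,1]`, and the unimportant coordinates are
copied from a member of `W`. -/
def searchSpace {D : ℕ} (J : Finset (Fin D)) (W : Set (Cube D)) : Set (Cube D) :=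
  {x | ∃ w ∈ W, ∀ i ∉ J, x i = w i}

/-- The information available at the beginning of round `t`: the internal randomness `U` of the
algorithm, the observations of the initial dataset and of rounds `1, …, t-1`, and the uniform
samples of rounds `1, …, t-1`. -/
abbrev pastInfo {D : ℕ} {Ω S : Type*} [MeasurableSpace S] (N₀ : ℕ) (U : Ω → S) (y : ℕ → Ω → ℝ)
    (z : ℕ → ℕ → Ω → Cube D) (t : ℕ) : MeasurableSpace Ω :=
  MeasurableSpace.comap U inferInstance ⊔
    (⨆ s ∈ Finset.range (N₀ + (t - 1)), MeasurableSpace.comap (y s) inferInstance) ⊔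
    (⨆ s ∈ Finset.Ico 1 t, ⨆ j, MeasurableSpace.comap (z s j) inferInstance)

/-- The probabilistic model: the noise variables `ε s` are i.i.d. `N(0, σ²)`, the vectors `z t j`
are i.i.d. uniform on `[0,1]^D`, and `f`, the noise, the uniform samples and the internal
randomness `U` of the algorithm are mutually independent. -/
structure IsModel {D : ℕ} {Ω S : Type*} [MeasurableSpace Ω] [MeasurableSpace S] (P : Measure Ω)
    (σ : ℝ) (f : Cube D → Ω → ℝ) (ε : ℕ → Ω → ℝ) (z : ℕ → ℕ → Ω → Cube D) (U : Ω → S) :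
    Prop where
  measurable_noise : ∀ s, Measurable (ε s)
  measurable_sample : ∀ t j, Measurable (z t j)
  measurable_seed : Measurable U
  noise_law : ∀ s, P.map (ε s) = gaussianReal 0 (σ ^ 2).toNNReal
  noise_indep : iIndepFun ε P
  sample_law : ∀ t j, P.map (z t j) = volume
  sample_indep : iIndepFun (fun p : ℕ × ℕ => z p.1 p.2) P
  indep_f : IndepFun (fun ω x => f x ω) (fun ω => (fun s => ε s ω, fun t j => z t j ω, U ω)) P
  indep_noise : IndepFun (fun ω s => ε s ω) (fun ω => (fun t j => z t j ω, U ω)) P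
  indep_sample : IndepFun (fun ω t j => z t j ω) U P

/-- A run of the algorithm, with data points `pt`, important variables `I t` and index `inc t` of
the best data point observed before round `t`.

In round `t`, on the basis of the information available so far, a set `I t` of important variables
is selected, neither empty nor everything.  The unimportant variables take `M_t + 1` values: those
of the `M_t` uniform samples `z t j`, `j < M_t`, and those of the best observed point.  The next
point maximizes the acquisition function over the resulting search space. -/
structure IsRun {D : ℕ} {Ω S : Type*} [MeasurableSpace Ω] [MeasurableSpace S]
    (k : Cube D → Cube D → ℝ) (σ : ℝ) (ρ : Fin D → ℝ) (a b δ : ℝ) (n N₀ : ℕ)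
    (f : Cube D → Ω → ℝ) (ε : ℕ → Ω → ℝ) (z : ℕ → ℕ → Ω → Cube D) (U : Ω → S)
    (pt : ℕ → Ω → Cube D) (I : ℕ → Ω → Finset (Fin D)) (inc : ℕ → Ω → ℕ) : Prop where
  /-- The initial design does not depend on the objective function or the noise. -/
  init_measurable : ∀ s < N₀, Measurable[MeasurableSpace.comap U inferInstance] (pt s)
  select_measurable : ∀ t ≥ 1, ∀ i,
    MeasurableSet[pastInfo N₀ U (obs f ε pt) z t] {ω | i ∈ I t ω}
  select_nonempty : ∀ t ≥ 1, ∀ ω, (I t ω).Nonempty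
  select_proper : ∀ t ≥ 1, ∀ ω, I t ω ≠ Finset.univ
  inc_measurable : ∀ t ≥ 1, Measurable[pastInfo N₀ U (obs f ε pt) z t] (inc t)
  inc_lt : ∀ t ≥ 1, ∀ ω, inc t ω < N₀ + (t - 1)
  inc_best : ∀ t ≥ 1, ∀ ω, ∀ s < N₀ + (t - 1), obs f ε pt s ω ≤ obs f ε pt (inc t ω) ω
  pt_measurable : ∀ t ≥ 1,
    Measurable[pastInfo N₀ U (obs f ε pt) z t ⊔
      ⨆ j, MeasurableSpace.comap (z t j) inferInstance] (pt (N₀ + (t - 1)))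
  pt_argmax : ∀ t ≥ 1, ∀ ω,
    let X := searchSpace (I t ω)
      ({w | ∃ j < numSub n t, w = z t j ω} ∪ {pt (inc t ω) ω})
    let acq := acquisition k σ (beta ρ a b δ (dMax I t ω) t) (N₀ + (t - 1))
      (fun s => pt s ω) (fun s => obs f ε pt s ω)
    pt (N₀ + (t - 1)) ω ∈ X ∧ ∀ x ∈ X, acq x ≤ acq (pt (N₀ + (t - 1)) ω)

/-! ### Quantities in the regret bound -/

/-- The cumulative regret `R_T = ∑_{t=1}^T (max f - f(x^t))`. -/
def regret {D : ℕ} {Ω : Type*} (f : Cube D → Ω → ℝ) (pt : ℕ → Ω → Cube D) (N₀ T : ℕ) (ω : Ω) :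
    ℝ :=
  ∑ t ∈ Finset.Icc 1 T, ((⨆ x, f x ω) - f (pt (N₀ + (t - 1)) ω) ω)

/-- The constant `C_1 = 8 κ / log (1 + κ σ⁻²)`, for a kernel bounded by `κ` on the diagonal;
for `κ = 1` this is `8 / log (1 + σ⁻²)`. -/
def C₁ (κ σ : ℝ) : ℝ := 8 * κ / Real.log (1 + κ / σ ^ 2)

/-- `2 b √(log (2Da/δ)) ((D-d+1)!)^{1/(D-d)} log (6/δ)`, used for `1 ≤ d < D`. -/
def coef (D : ℕ) (a b δ : ℝ) (d : ℕ) : ℝ :=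
  2 * b * √(Real.log (2 * D * a / δ)) *
    ((D - d + 1).factorial : ℝ) ^ ((1 : ℝ) / ((D : ℝ) - d)) * Real.log (6 / δ)

/-- `C = max_{1 ≤ t ≤ T} coef (d_t)` with `d_t = |I_t|`. -/
def constC {D : ℕ} {Ω : Type*} (a b δ : ℝ) (I : ℕ → Ω → Finset (Fin D)) (T : ℕ) (ω : Ω) : ℝ :=
  ⨆ t : Finset.Icc 1 T, coef D a b δ (I t ω).card

/-- The worst-case value `max_{1 ≤ d ≤ D-1} coef d` of the constant `C`. -/
def worstC (D : ℕ) (a b δ : ℝ) : ℝ :=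
  ⨆ d : Finset.Icc 1 (D - 1), coef D a b δ d

/-- The additional term
`C √c₀ √(∑_{t=1}^T ∑_{i ∉ I_t} ρ_i) T^{1/2 - 1/(n(D-1))}` of the regret bound. -/
def extraTerm {D : ℕ} {Ω : Type*} (ρ : Fin D → ℝ) (a b δ c₀ : ℝ) (n : ℕ)
    (I : ℕ → Ω → Finset (Fin D)) (T : ℕ) (ω : Ω) : ℝ :=
  constC a b δ I T ω * √c₀ * √(∑ t ∈ Finset.Icc 1 T, ∑ i ∈ (I t ω)ᶜ, ρ i) *
    (T : ℝ) ^ ((1 : ℝ) / 2 - 1 / (n * ((D : ℝ) - 1)))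

end

end LassoBO

namespace LassoBO

noncomputable section

open scoped ENNReal NNReal

/-! ### Independence of σ-algebras -/

theorem indep_sup_assoc {Ω : Type*} {m₁ m₂ m₃ mΩ : MeasurableSpace Ω} {P : Measure Ω}
    [IsProbabilityMeasure P] (h₁ : m₁ ≤ mΩ) (h₂ : m₂ ≤ mΩ) (h₃ : m₃ ≤ mΩ)
    (h12 : Indep m₁ m₂ P) (h : Indep (m₁ ⊔ m₂) m₃ P) : Indep m₁ (m₂ ⊔ m₃) P := by
  let π : Set (Set Ω) := {s | ∃ t u, MeasurableSet[m₂] t ∧ MeasurableSet[m₃] u ∧ s = t ∩ u}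
  have hπ : IsPiSystem π := by
    rintro _ ⟨t, u, ht, hu, rfl⟩ _ ⟨t', u', ht', hu', rfl⟩ -
    exact ⟨t ∩ t', u ∩ u', ht.inter ht', hu.inter hu', by ext; simp; tauto⟩
  have hgen : m₂ ⊔ m₃ = MeasurableSpace.generateFrom π := by
    apply le_antisymm
    · apply sup_le
      · intro t ht
        exact MeasurableSpace.measurableSet_generateFrom ⟨t, Set.univ, ht, MeasurableSet.univ, by simp⟩
      · intro t ht
        exact MeasurableSpace.measurableSet_generateFrom ⟨Set.univ, t, MeasurableSet.univ, ht, by simp⟩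
    · apply MeasurableSpace.generateFrom_le
      rintro _ ⟨t, u, ht, hu, rfl⟩
      exact MeasurableSet.inter ((le_sup_left : m₂ ≤ m₂ ⊔ m₃) _ ht)
        ((le_sup_right : m₃ ≤ m₂ ⊔ m₃) _ hu)
  refine IndepSets.indep h₁ (sup_le h₂ h₃) (@MeasurableSpace.isPiSystem_measurableSet _ m₁) hπ
    (@MeasurableSpace.generateFrom_measurableSet _ m₁).symm hgen ?_
  rw [IndepSets_iff]
  rintro s _ hs ⟨t, u, ht, hu, rfl⟩
  rw [Indep_iff] at h h12
  have e1 : P (t ∩ u) = P t * P u := h t u ((le_sup_right : m₂ ≤ m₁ ⊔ m₂) _ ht) hu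
  have e2 : P (s ∩ t ∩ u) = P (s ∩ t) * P u := h _ u
    (MeasurableSet.inter ((le_sup_left : m₁ ≤ m₁ ⊔ m₂) _ hs)
      ((le_sup_right : m₂ ≤ m₁ ⊔ m₂) _ ht)) hu
  rw [← Set.inter_assoc, e2, h12 s t hs ht, e1, mul_assoc]

/-! ### Finite prefixes of observation sequences -/

/-- The sequence `y` with all coordinates from `m` on replaced by `0`. -/
def trunc (m : ℕ) (y : ℕ → ℝ) : ℕ → ℝ := fun i => if i < m then y i else 0

theorem measurable_trunc (m : ℕ) : Measurable (trunc m) := by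
  refine measurable_pi_lambda _ fun i => ?_
  unfold trunc
  split_ifs
  · exact measurable_pi_apply i
  · exact measurable_const

theorem trunc_trunc_of_le {m n : ℕ} (h : m ≤ n) (y : ℕ → ℝ) : trunc m (trunc n y) = trunc m y := by
  ext i
  unfold trunc
  split_ifs with h1 h2
  · rfl
  · omega
  · rfl

theorem trunc_succ (m : ℕ) (y : ℕ → ℝ) :
    trunc (m + 1) y = Function.update (trunc m y) m (y m) := by
  ext i
  rcases eq_or_ne i m with rfl | h
  · simp [trunc]
  · simp only [trunc, Function.update_of_ne h]
    split_ifs <;> first | rfl | omega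

theorem trunc_update_of_le {s m : ℕ} (h : s ≤ m) (y : ℕ → ℝ) (u : ℝ) :
    trunc s (Function.update y m u) = trunc s y := by
  ext i
  unfold trunc
  split_ifs with h1
  · rw [Function.update_of_ne (by omega)]
  · rfl

theorem continuous_update_pair (m : ℕ) :
    Continuous fun q : (ℕ → ℝ) × ℝ => Function.update q.1 m q.2 :=
  continuous_fst.update m continuous_snd

theorem measurable_update_pair (m : ℕ) :
    Measurable fun q : (ℕ → ℝ) × ℝ => Function.update q.1 m q.2 :=
  (continuous_update_pair m).measurable

/-- Lebesgue measure on the first `m` coordinates, with all other coordinates equal to `0`. -/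
def prefixVolume : ℕ → Measure (ℕ → ℝ)
  | 0 => Measure.dirac 0
  | m + 1 => ((prefixVolume m).prod volume).map fun q => Function.update q.1 m q.2

instance sFinite_prefixVolume (m : ℕ) : SFinite (prefixVolume m) := by
  induction m with
  | zero => unfold prefixVolume; infer_instance
  | succ m ih => unfold prefixVolume; infer_instance

theorem lintegral_prefixVolume_succ (m : ℕ) {G : (ℕ → ℝ) → ℝ≥0∞} (hG : Measurable G) :
    ∫⁻ y, G y ∂prefixVolume (m + 1) =
      ∫⁻ y, (∫⁻ u : ℝ, G (Function.update y m u)) ∂prefixVolume m := by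
  rw [prefixVolume, lintegral_map hG (measurable_update_pair m),
    lintegral_prod (fun q : (ℕ → ℝ) × ℝ => G (Function.update q.1 m q.2))
      (hG.comp (measurable_update_pair m)).aemeasurable]

theorem prefixVolume_pos_of_isOpen (m : ℕ) {V : Set (ℕ → ℝ)} (hV : IsOpen V) {y : ℕ → ℝ}
    (hy : trunc m y ∈ V) : 0 < prefixVolume m V := by
  induction m generalizing V with
  | zero =>
    have : trunc 0 y = 0 := by ext i; simp [trunc]
    rw [this] at hy
    simp [prefixVolume, hV.measurableSet, hy]
  | succ m ih =>
    rw [prefixVolume, Measure.map_apply (measurable_update_pair m) hV.measurableSet,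
      Measure.prod_apply ((measurable_update_pair m) hV.measurableSet)]
    set W : Set ((ℕ → ℝ) × ℝ) := (fun q => Function.update q.1 m q.2) ⁻¹' V with hW
    have hWo : IsOpen W := hV.preimage (continuous_update_pair m)
    have hpos : 0 < prefixVolume m (Prod.fst '' W) := by
      refine ih (isOpenMap_fst _ hWo) ⟨(trunc m y, y m), ?_, rfl⟩
      simpa [hW, ← trunc_succ] using hy
    rw [lintegral_pos_iff_support (measurable_measure_prodMk_left hWo.measurableSet)]
    refine hpos.trans_le (measure_mono ?_)
    rintro _ ⟨⟨x, u⟩, hxu, rfl⟩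
    have ho : IsOpen (Prod.mk x ⁻¹' W) := hWo.preimage (by fun_prop)
    exact (ho.measure_pos volume ⟨u, hxu⟩).ne'

theorem eq_of_ae_eq_prefixVolume {m : ℕ} {F G : (ℕ → ℝ) → ℝ≥0∞} (hF : Continuous F)
    (hG : Continuous G) (h : F =ᵐ[prefixVolume m] G) (y : ℕ → ℝ) :
    F (trunc m y) = G (trunc m y) := by
  by_contra hne
  have ho : IsOpen {x | F x ≠ G x} := isOpen_ne_fun hF hG
  exact (prefixVolume_pos_of_isOpen m ho hne).ne' h

/-- The density of the observations `y 0, …, y (m-1)` at points with function values `a`. -/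
def likelihood (v : ℝ≥0) (m : ℕ) (a y : ℕ → ℝ) : ℝ≥0∞ :=
  ∏ s ∈ Finset.range m, gaussianPDF 0 v (y s - a s)

theorem measurable_likelihood {α : Type*} [MeasurableSpace α] (v : ℝ≥0) (m : ℕ)
    {a y : α → ℕ → ℝ} (ha : ∀ s < m, Measurable fun x => a x s) (hy : Measurable y) :
    Measurable fun x => likelihood v m (a x) (y x) := by
  unfold likelihood
  refine Finset.measurable_prod _ fun s hs => (measurable_gaussianPDF 0 v).comp ?_
  exact ((measurable_pi_apply s).comp hy).sub (ha s (Finset.mem_range.1 hs))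

section Density

variable {Ω E Θ 𝒳 : Type*} [MeasurableSpace Ω] [MeasurableSpace E] [MeasurableSpace Θ]
  [MeasurableSpace 𝒳] {P : Measure Ω} [IsProbabilityMeasure P]

/-- The joint law of objective, side information and the first `m` observations of an adaptive
design, as a density with respect to Lebesgue measure in the observations. -/
theorem lintegral_observations {Φ : Ω → E} {θ : Ω → Θ} (hΦ : Measurable Φ) (hθ : Measurable θ)
    {ev : E → 𝒳 → ℝ} (hev : Measurable (Function.uncurry ev))
    {X : ℕ → Θ × (ℕ → ℝ) → 𝒳} (hX : ∀ s, Measurable (X s)) {ε y : ℕ → Ω → ℝ} {v : ℝ≥0}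
    (hv : v ≠ 0) (hε : ∀ s, Measurable (ε s)) (hy : ∀ s, Measurable (y s))
    (hlaw : ∀ s, P.map (ε s) = gaussianReal 0 v)
    (hobs : ∀ s ω, y s ω = ev (Φ ω) (X s (θ ω, trunc s fun i => y i ω)) + ε s ω)
    (hind : ∀ s, IndepFun (fun ω => (Φ ω, θ ω, trunc s fun i => y i ω)) (ε s) P)
    (m : ℕ) {G : E × Θ × (ℕ → ℝ) → ℝ≥0∞} (hG : Measurable G) :
    ∫⁻ ω, G (Φ ω, θ ω, trunc m fun i => y i ω) ∂P =
      ∫⁻ ω, ∫⁻ y', G (Φ ω, θ ω, y') *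
        likelihood v m (fun s => ev (Φ ω) (X s (θ ω, trunc s y'))) y' ∂prefixVolume m ∂P := by
  induction m generalizing G with
  | zero =>
    have h0 : ∀ y : ℕ → ℝ, trunc 0 y = 0 := fun y => by ext i; simp [trunc]
    refine lintegral_congr fun ω => ?_
    rw [prefixVolume, lintegral_dirac']
    · simp [h0, likelihood]
    · refine (hG.comp (by fun_prop)).mul (measurable_likelihood v 0 ?_ measurable_id)
      intro s hs; omega
  | succ m ih =>
    have hyy : Measurable fun ω => (fun i => y i ω : ℕ → ℝ) := measurable_pi_lambda _ hy
    have hZ : Measurable fun ω => (Φ ω, θ ω, trunc m fun i => y i ω) :=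
      hΦ.prodMk (hθ.prodMk ((measurable_trunc m).comp hyy))
    let A : E × Θ × (ℕ → ℝ) → ℝ := fun q => ev q.1 (X m (q.2.1, trunc m q.2.2))
    have hA : Measurable A := hev.comp (measurable_fst.prodMk ((hX m).comp
      ((measurable_fst.comp measurable_snd).prodMk
        ((measurable_trunc m).comp (measurable_snd.comp measurable_snd)))))
    let H : (E × Θ × (ℕ → ℝ)) × ℝ → ℝ≥0∞ := fun q =>
      G (q.1.1, q.1.2.1, Function.update q.1.2.2 m q.2)
    have hH : Measurable H := hG.comp (by
      refine (measurable_fst.comp measurable_fst).prodMk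
        ((measurable_fst.comp (measurable_snd.comp measurable_fst)).prodMk ?_)
      exact (measurable_update_pair m).comp
        ((measurable_snd.comp (measurable_snd.comp measurable_fst)).prodMk measurable_snd))
    have hHA : Measurable fun q : (E × Θ × (ℕ → ℝ)) × ℝ => H (q.1, A q.1 + q.2) :=
      hH.comp (measurable_fst.prodMk ((hA.comp measurable_fst).add measurable_snd))
    let G' : E × Θ × (ℕ → ℝ) → ℝ≥0∞ := fun q => ∫⁻ u, H (q, u) * gaussianPDF 0 v (u - A q)
    have hG'm : Measurable G' := by
      refine Measurable.lintegral_prod_right'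
        (f := fun q : (E × Θ × (ℕ → ℝ)) × ℝ => H q * gaussianPDF 0 v (q.2 - A q.1)) ?_
      exact hH.mul ((measurable_gaussianPDF 0 v).comp
        (measurable_snd.sub (hA.comp measurable_fst)))
    have hG' : ∀ q, ∫⁻ e, H (q, A q + e) ∂gaussianReal 0 v = G' q := by
      intro q
      have hm : Measurable fun e => H (q, A q + e) := hHA.comp (measurable_const.prodMk measurable_id)
      rw [gaussianReal_of_var_ne_zero _ hv,
        lintegral_withDensity_eq_lintegral_mul _ (measurable_gaussianPDF 0 v) hm]
      change _ = ∫⁻ u, H (q, u) * gaussianPDF 0 v (u - A q)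
      rw [← lintegral_add_right_eq_self (fun u => H (q, u) * gaussianPDF 0 v (u - A q)) (A q)]
      refine lintegral_congr fun e => ?_
      simp [mul_comm, add_comm]
    have step : ∫⁻ ω, G (Φ ω, θ ω, trunc (m + 1) fun i => y i ω) ∂P =
        ∫⁻ ω, G' (Φ ω, θ ω, trunc m fun i => y i ω) ∂P := by
      have hprod := (indepFun_iff_map_prod_eq_prod_map_map hZ.aemeasurable
        (hε m).aemeasurable).1 (hind m)
      calc ∫⁻ ω, G (Φ ω, θ ω, trunc (m + 1) fun i => y i ω) ∂P
          = ∫⁻ ω, H ((Φ ω, θ ω, trunc m fun i => y i ω),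
              A (Φ ω, θ ω, trunc m fun i => y i ω) + ε m ω) ∂P := by
            refine lintegral_congr fun ω => ?_
            simp only [H, A, trunc_trunc_of_le le_rfl]
            rw [← hobs, trunc_succ]
        _ = ∫⁻ q, H (q.1, A q.1 + q.2) ∂(P.map fun ω =>
              ((Φ ω, θ ω, trunc m fun i => y i ω), ε m ω)) :=
            (lintegral_map hHA (hZ.prodMk (hε m))).symm
        _ = ∫⁻ q, ∫⁻ e, H (q, A q + e) ∂gaussianReal 0 v
              ∂(P.map fun ω => (Φ ω, θ ω, trunc m fun i => y i ω)) := by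
            rw [hprod, hlaw, lintegral_prod _ hHA.aemeasurable]
        _ = _ := by
            simp_rw [hG']
            rw [lintegral_map hG'm hZ]
    rw [step, ih hG'm]
    refine lintegral_congr fun ω => ?_
    have hint : Measurable fun y' => G (Φ ω, θ ω, y') *
        likelihood v (m + 1) (fun s => ev (Φ ω) (X s (θ ω, trunc s y'))) y' := by
      refine (hG.comp (by fun_prop)).mul (measurable_likelihood v _ (fun s _ => ?_) measurable_id)
      exact hev.comp (measurable_const.prodMk ((hX s).comp
        (measurable_const.prodMk (measurable_trunc s))))
    rw [lintegral_prefixVolume_succ m hint]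
    refine lintegral_congr fun y' => ?_
    rw [← lintegral_mul_const _ (by
      refine (hH.comp (measurable_const.prodMk measurable_id)).mul
        ((measurable_gaussianPDF 0 v).comp (measurable_id.sub measurable_const)))]
    refine lintegral_congr fun u => ?_
    simp only [H, A, likelihood, Finset.prod_range_succ, Function.update_self,
      trunc_update_of_le le_rfl]
    have : ∏ s ∈ Finset.range m, gaussianPDF 0 v (Function.update y' m u s -
        ev (Φ ω) (X s (θ ω, trunc s (Function.update y' m u)))) =
        ∏ s ∈ Finset.range m, gaussianPDF 0 v (y' s - ev (Φ ω) (X s (θ ω, trunc s y'))) := by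
      refine Finset.prod_congr rfl fun s hs => ?_
      have hs := Finset.mem_range.1 hs
      rw [trunc_update_of_le hs.le, Function.update_of_ne hs.ne]
    rw [this]
    ring

end Density

end

end LassoBO

namespace LassoBO

noncomputable section

open scoped ENNReal NNReal

set_option linter.unusedSectionVars false

/-! ### Sample paths as random continuous functions -/

instance : MeasurableSpace C(Cube D, ℝ) := borel _

instance : BorelSpace C(Cube D, ℝ) := ⟨rfl⟩

theorem measurable_path_eval {D : ℕ} :
    Measurable (Function.uncurry fun (g : C(Cube D, ℝ)) (x : Cube D) => g x) := by
  have h : Continuous fun q : C(Cube D, ℝ) × Cube D => q.1 q.2 := by fun_prop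
  exact h.measurable

theorem measurable_path_of_eval {D : ℕ} {α : Type*} [MeasurableSpace α] {Φ : α → C(Cube D, ℝ)}
    (h : ∀ x, Measurable fun a => Φ a x) : Measurable Φ := by
  have hbasis : TopologicalSpace.IsTopologicalBasis
      {U : Set C(Cube D, ℝ) | ∃ g r, U = Metric.ball g r} := by
    apply TopologicalSpace.isTopologicalBasis_of_isOpen_of_nhds
    · rintro _ ⟨g, r, rfl⟩
      exact Metric.isOpen_ball
    · intro g U hg hU
      obtain ⟨r, hr, hrU⟩ := Metric.isOpen_iff.1 hU g hg
      exact ⟨_, ⟨g, r, rfl⟩, Metric.mem_ball_self hr, hrU⟩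
  have hb := hbasis.borel_eq_generateFrom
  change @Measurable _ _ _ (borel _) Φ
  rw [hb]
  apply measurable_generateFrom
  rintro _ ⟨g, r, rfl⟩
  have hd : Measurable fun a => dist (Φ a) g := by
    refine measurable_of_Iic fun c => ?_
    rcases lt_or_ge c 0 with hc | hc
    · convert MeasurableSet.empty
      ext a
      simpa using lt_of_lt_of_le hc dist_nonneg
    · have : (fun a => dist (Φ a) g) ⁻¹' Set.Iic c =
          ⋂ n, {a | dist (Φ a (TopologicalSpace.denseSeq (Cube D) n))
            (g (TopologicalSpace.denseSeq (Cube D) n)) ≤ c} := by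
        ext a
        simp only [Set.mem_preimage, Set.mem_Iic, Set.mem_iInter, Set.mem_ofPred_eq]
        rw [ContinuousMap.dist_le hc]
        refine ⟨fun h n => h _, fun h x => ?_⟩
        have hcl : IsClosed {x | dist (Φ a x) (g x) ≤ c} :=
          isClosed_le (by fun_prop) continuous_const
        have := (TopologicalSpace.denseRange_denseSeq (Cube D)).closure_range
        have hsub : closure (Set.range (TopologicalSpace.denseSeq (Cube D))) ⊆
            {x | dist (Φ a x) (g x) ≤ c} := by
          refine closure_minimal ?_ hcl
          rintro _ ⟨n, rfl⟩
          exact h n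
        exact hsub (this ▸ Set.mem_univ x)
      rw [this]
      exact MeasurableSet.iInter fun n => measurableSet_le ((h _).dist measurable_const)
        measurable_const
  exact hd measurableSet_Iio

section Path

variable {D : ℕ} {Ω : Type*} [mΩ : MeasurableSpace Ω] {P : Measure Ω}
  {k : Cube D → Cube D → ℝ} {ρ : Fin D → ℝ} {a b : ℝ} {f : Cube D → Ω → ℝ}

/-- The sample path as a random continuous function. -/
def IsGPSample.path (hf : IsGPSample P k ρ a b f) (ω : Ω) : C(Cube D, ℝ) :=
  ⟨fun x => f x ω, hf.continuous ω⟩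

@[simp] theorem IsGPSample.path_apply (hf : IsGPSample P k ρ a b f) (ω : Ω) (x : Cube D) :
    hf.path ω x = f x ω := rfl

theorem IsGPSample.measurable_path (hf : IsGPSample P k ρ a b f) : Measurable hf.path :=
  measurable_path_of_eval fun x => hf.measurable x

theorem IsGPSample.comap_path_le (hf : IsGPSample P k ρ a b f) :
    MeasurableSpace.comap hf.path inferInstance ≤
      MeasurableSpace.comap (fun ω x => f x ω) inferInstance := by
  rw [← measurable_iff_comap_le]
  refine @measurable_path_of_eval D Ω (MeasurableSpace.comap (fun ω x => f x ω) inferInstance) _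
    fun x => ?_
  exact (measurable_pi_apply x).comp (comap_measurable fun ω x => f x ω)

theorem IsGPSample.hasGaussianLaw (hf : IsGPSample P k ρ a b f) {ι : Type*} [Fintype ι]
    (A : ι → Cube D) : HasGaussianLaw (fun ω i => f (A i) ω) P := by
  have h := (hf.gaussian.comp_right A).hasGaussianLaw Finset.univ
  let L : (↥(Finset.univ : Finset ι) → ℝ) →L[ℝ] (ι → ℝ) :=
    ContinuousLinearMap.pi fun i => ContinuousLinearMap.proj ⟨i, Finset.mem_univ i⟩
  exact h.map_fun L

theorem IsGPSample.memLp (hf : IsGPSample P k ρ a b f) (x : Cube D) : MemLp (f x) 2 P :=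
  (hf.gaussian.hasGaussianLaw_eval x).memLp_two

end Path

/-! ### Independence of the noise from the past -/

section Past

theorem measurable_triple {α β γ δ : Type*} {mα : MeasurableSpace α} [MeasurableSpace β]
    [MeasurableSpace γ] [MeasurableSpace δ] {u : α → β} {v : α → γ} {w : α → δ}
    (hu : Measurable u) (hv : Measurable v) (hw : Measurable w) :
    Measurable fun x => (u x, v x, w x) :=
  hu.prodMk (hv.prodMk hw)

theorem measurable_eval_design {α E Θ 𝒳 𝒴 : Type*} {mα : MeasurableSpace α} [MeasurableSpace E]
    [MeasurableSpace Θ] [MeasurableSpace 𝒳] [MeasurableSpace 𝒴] {ev : E → 𝒳 → ℝ}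
    (hev : Measurable (Function.uncurry ev)) {X : Θ × 𝒴 → 𝒳} (hX : Measurable X)
    {Φ : α → E} {θ : α → Θ} {t : α → 𝒴} (hΦ : Measurable Φ) (hθ : Measurable θ)
    (ht : Measurable t) : Measurable fun x => ev (Φ x) (X (θ x, t x)) :=
  hev.comp (hΦ.prodMk (hX.comp (hθ.prodMk ht)))

variable {Ω E Θ 𝒳 : Type*} [mΩ : MeasurableSpace Ω] [mE : MeasurableSpace E]
  [mΘ : MeasurableSpace Θ] [MeasurableSpace 𝒳] {P : Measure Ω} [IsProbabilityMeasure P]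

/-- If the noise `ε s` is independent of the objective, of the side information and of the earlier
noise, then it is independent of the objective, of the side information and of the earlier
observations of an adaptive design. -/
theorem indepFun_past {Φ : Ω → E} {θ : Ω → Θ}
    {ev : E → 𝒳 → ℝ} (hev : Measurable (Function.uncurry ev))
    {X : ℕ → Θ × (ℕ → ℝ) → 𝒳} (hX : ∀ s, Measurable (X s)) {ε y : ℕ → Ω → ℝ}
    (hobs : ∀ s ω, y s ω = ev (Φ ω) (X s (θ ω, trunc s fun i => y i ω)) + ε s ω)
    (hI : ∀ s, Indep (mE.comap Φ ⊔ mΘ.comap θ ⊔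
      ⨆ i ∈ Finset.range s, MeasurableSpace.comap (ε i) inferInstance)
      (MeasurableSpace.comap (ε s) inferInstance) P) (s : ℕ) :
    IndepFun (fun ω => (Φ ω, θ ω, trunc s fun i => y i ω)) (ε s) P := by
  let m : ℕ → MeasurableSpace Ω := fun s => mE.comap Φ ⊔ mΘ.comap θ ⊔
      ⨆ i ∈ Finset.range s, MeasurableSpace.comap (ε i) inferInstance
  have hmono : ∀ {s t}, s ≤ t → m s ≤ m t := by
    intro s t hst
    refine sup_le_sup le_rfl (biSup_mono fun i hi => ?_)
    simp only [Finset.mem_range] at hi ⊢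
    omega
  have hΦ : ∀ s, Measurable[m s] Φ := fun s =>
    (comap_measurable Φ).mono (le_sup_left.trans le_sup_left) le_rfl
  have hθ : ∀ s, Measurable[m s] θ := fun s =>
    (comap_measurable θ).mono (le_sup_right.trans le_sup_left) le_rfl
  have htr : ∀ s, (∀ i < s, Measurable[m s] (y i)) →
      Measurable[m s] (fun ω => trunc s fun i => y i ω) := by
    intro s h
    refine @measurable_pi_lambda _ _ _ (m s) _ _ fun i => ?_
    unfold trunc
    split_ifs with hi
    · exact h i hi
    · exact @measurable_const _ _ _ (m s) _
  have hy : ∀ s, Measurable[m (s + 1)] (y s) := by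
    intro s
    induction s using Nat.strong_induction_on with
    | _ s ih =>
      have h1 : Measurable[m s] (fun ω => trunc s fun i => y i ω) :=
        htr s fun i hi => (ih i hi).mono (hmono hi) le_rfl
      have h2 : Measurable[m s] (fun ω => ev (Φ ω) (X s (θ ω, trunc s fun i => y i ω))) :=
        measurable_eval_design (mα := m s) hev (hX s) (hΦ s) (hθ s) h1
      have h3 : Measurable[m (s + 1)] (ε s) := by
        refine (comap_measurable (ε s)).mono (le_trans ?_ le_sup_right) le_rfl
        exact le_biSup (fun i => MeasurableSpace.comap (ε i) inferInstance)
          (Finset.mem_range.2 (Nat.lt_succ_self s))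
      have h4 : y s = fun ω => ev (Φ ω) (X s (θ ω, trunc s fun i => y i ω)) + ε s ω :=
        funext (hobs s)
      rw [h4]
      exact (h2.mono (hmono (Nat.le_succ s)) le_rfl).add h3
  rw [IndepFun_iff_Indep]
  refine indep_of_indep_of_le_left (hI s) ?_
  rw [← measurable_iff_comap_le]
  exact measurable_triple (mα := m s) (hΦ s) (hθ s)
    (htr s fun i hi => (hy i).mono (hmono hi) le_rfl)

end Past

section Model

variable {D : ℕ} {Ω S : Type*} [mΩ : MeasurableSpace Ω] [mS : MeasurableSpace S] {P : Measure Ω}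
  [IsProbabilityMeasure P] {k : Cube D → Cube D → ℝ} {ρ : Fin D → ℝ} {a b σ : ℝ}
  {f : Cube D → Ω → ℝ} {ε : ℕ → Ω → ℝ} {z : ℕ → ℕ → Ω → Cube D} {U : Ω → S}

/-- The side information: uniform samples and internal randomness. -/
def sideInfo (z : ℕ → ℕ → Ω → Cube D) (U : Ω → S) (ω : Ω) : (ℕ → ℕ → Cube D) × S :=
  (fun t j => z t j ω, U ω)

omit [IsProbabilityMeasure P] in
theorem IsModel.measurable_sideInfo (h : IsModel P σ f ε z U) : Measurable (sideInfo z U) :=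
  (measurable_pi_lambda _ fun t => measurable_pi_lambda _ fun j => h.measurable_sample t j).prodMk
    h.measurable_seed

omit mΩ in
theorem biSup_comap_le {ι : Type*} (A : Set ι) {ε : ι → Ω → ℝ} :
    ⨆ i ∈ A, MeasurableSpace.comap (ε i) inferInstance ≤
      MeasurableSpace.comap (fun ω i => ε i ω) inferInstance :=
  iSup₂_le fun i _ => ((measurable_pi_apply i).comp (comap_measurable fun ω i => ε i ω)).comap_le

theorem IsModel.indep_noise_past (h : IsModel P σ f ε z U) (hf : IsGPSample P k ρ a b f) (s : ℕ) :
    Indep (MeasurableSpace.comap hf.path inferInstance ⊔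
      MeasurableSpace.comap (sideInfo z U) inferInstance ⊔
      ⨆ i ∈ Finset.range s, MeasurableSpace.comap (ε i) inferInstance)
      (MeasurableSpace.comap (ε s) inferInstance) P := by
  have hε : ∀ i, MeasurableSpace.comap (ε i) inferInstance ≤ mΩ := fun i =>
    (h.measurable_noise i).comap_le
  have hall : MeasurableSpace.comap (fun ω s => ε s ω) inferInstance ≤ mΩ :=
    (measurable_pi_lambda _ h.measurable_noise).comap_le
  have hθ := h.measurable_sideInfo.comap_le
  have hεs : MeasurableSpace.comap (ε s) inferInstance ≤
      MeasurableSpace.comap (fun ω s => ε s ω) inferInstance :=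
    ((measurable_pi_apply s).comp (comap_measurable fun ω s => ε s ω)).comap_le
  have hpast := biSup_comap_le (Finset.range s : Set ℕ) (ε := ε)
  simp only [Finset.mem_coe] at hpast
  have i1 : Indep (MeasurableSpace.comap (ε s) inferInstance)
      (⨆ i ∈ Finset.range s, MeasurableSpace.comap (ε i) inferInstance) P := by
    have := indep_iSup_of_disjoint hε h.noise_indep.iIndep (S := {s})
      (T := (Finset.range s : Set ℕ)) (by simp)
    simpa using this
  have i2 : Indep (MeasurableSpace.comap (ε s) inferInstance ⊔
      ⨆ i ∈ Finset.range s, MeasurableSpace.comap (ε i) inferInstance)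
      (MeasurableSpace.comap (sideInfo z U) inferInstance) P :=
    indep_of_indep_of_le_left h.indep_noise (sup_le hεs hpast)
  have i3 := indep_sup_assoc (hε s) (hpast.trans hall) hθ i1 i2
  have hcomb : MeasurableSpace.comap (fun ω => (fun s => ε s ω, fun t j => z t j ω, U ω))
      inferInstance = MeasurableSpace.comap (fun ω s => ε s ω) inferInstance ⊔
        MeasurableSpace.comap (sideInfo z U) inferInstance :=
    MeasurableSpace.comap_prodMk _ _
  have i4 : Indep (MeasurableSpace.comap (ε s) inferInstance ⊔
      ((⨆ i ∈ Finset.range s, MeasurableSpace.comap (ε i) inferInstance) ⊔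
        MeasurableSpace.comap (sideInfo z U) inferInstance))
      (MeasurableSpace.comap hf.path inferInstance) P := by
    refine indep_of_indep_of_le h.indep_f.symm ?_ hf.comap_path_le
    rw [hcomb]
    exact sup_le (hεs.trans le_sup_left) (sup_le (hpast.trans le_sup_left) le_sup_right)
  have i5 := indep_sup_assoc (hε s) (sup_le (hpast.trans hall) hθ) hf.measurable_path.comap_le i3 i4
  refine (indep_of_indep_of_le_right i5 ?_).symm
  refine sup_le (sup_le le_sup_right (le_sup_right.trans le_sup_left)) (le_sup_left.trans le_sup_left)

theorem IsModel.indepFun_path_sideInfo (h : IsModel P σ f ε z U) (hf : IsGPSample P k ρ a b f) :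
    IndepFun hf.path (sideInfo z U) P := by
  refine indep_of_indep_of_le h.indep_f hf.comap_path_le ?_
  exact (measurable_snd.comp (comap_measurable
    fun ω => (fun s => ε s ω, fun t j => z t j ω, U ω))).comap_le

end Model

end

end LassoBO

namespace LassoBO

noncomputable section

open scoped ENNReal NNReal

set_option linter.unusedSectionVars false

/-! ### Gaussian regression for a fixed design -/

/-- The weights of the observations in the posterior mean. -/
def postWeights {D : ℕ} (k : Cube D → Cube D → ℝ) (σ : ℝ) (m : ℕ) (X : ℕ → Cube D)
    (x : Cube D) : Fin m → ℝ :=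
  (gram k m X + σ ^ 2 • (1 : Matrix (Fin m) (Fin m) ℝ))⁻¹.mulVec (crossVec k m X x)

section Regression

variable {D : ℕ} {Ω S : Type*} [mΩ : MeasurableSpace Ω] [mS : MeasurableSpace S] {P : Measure Ω}
  [IsProbabilityMeasure P] {k : Cube D → Cube D → ℝ} {ρ : Fin D → ℝ} {a b σ : ℝ}
  {f : Cube D → Ω → ℝ} {ε : ℕ → Ω → ℝ} {z : ℕ → ℕ → Ω → Cube D} {U : Ω → S}

theorem IsGPSample.kernel_symm (hf : IsGPSample P k ρ a b f) (x x' : Cube D) :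
    k x x' = k x' x := by
  rw [← hf.cov_eq, ← hf.cov_eq, covariance_comm]

theorem IsGPSample.gram_posSemidef (hf : IsGPSample P k ρ a b f) (m : ℕ) (X : ℕ → Cube D) :
    (gram k m X).PosSemidef := by
  apply Matrix.PosSemidef.of_dotProduct_mulVec_nonneg
  · ext i j
    simp [gram, hf.kernel_symm (X j) (X i)]
  · intro w
    have h : cov[fun ω => ∑ i : Fin m, w i * f (X i) ω, fun ω => ∑ i : Fin m, w i * f (X i) ω; P] =
        star w ⬝ᵥ (gram k m X).mulVec w := by
      rw [covariance_fun_sum_fun_sum (fun i => (hf.memLp _).const_mul _)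
        (fun i => (hf.memLp _).const_mul _)]
      simp only [dotProduct, Matrix.mulVec, gram, Matrix.of_apply, star_trivial, Finset.mul_sum]
      refine Finset.sum_congr rfl fun i _ => Finset.sum_congr rfl fun j _ => ?_
      rw [covariance_const_mul_left, covariance_const_mul_right, hf.cov_eq]
      ring
    rw [← h, covariance_self]
    · exact variance_nonneg _ _
    · exact (Finset.measurable_sum _ fun i _ => (hf.measurable _).const_mul _).aemeasurable

theorem IsGPSample.regGram_posDef (hf : IsGPSample P k ρ a b f) (hσ : 0 < σ) (m : ℕ)
    (X : ℕ → Cube D) : (gram k m X + σ ^ 2 • (1 : Matrix (Fin m) (Fin m) ℝ)).PosDef :=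
  (Matrix.PosDef.one.smul (by positivity)).posSemidef_add (hf.gram_posSemidef m X)

theorem IsGPSample.sum_regGram_mul_postWeights (hf : IsGPSample P k ρ a b f) (hσ : 0 < σ) (m : ℕ)
    (X : ℕ → Cube D) (x : Cube D) (i : Fin m) :
    ∑ j : Fin m, k (X i) (X j) * postWeights k σ m X x j + σ ^ 2 * postWeights k σ m X x i =
      k x (X i) := by
  have hu : IsUnit (gram k m X + σ ^ 2 • (1 : Matrix (Fin m) (Fin m) ℝ)).det :=
    (Matrix.isUnit_iff_isUnit_det _).1 (hf.regGram_posDef hσ m X).isUnit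
  have h : (gram k m X + σ ^ 2 • (1 : Matrix (Fin m) (Fin m) ℝ)).mulVec
      (postWeights k σ m X x) = crossVec k m X x := by
    rw [postWeights, Matrix.mulVec_mulVec, Matrix.mul_nonsing_inv _ hu, Matrix.one_mulVec]
  have := congrFun h i
  simpa [Matrix.add_mulVec, Matrix.smul_mulVec, gram, crossVec, Matrix.mulVec, dotProduct, add_mul,
    Finset.sum_add_distrib, Matrix.one_apply] using this

theorem IsGPSample.postMean_eq_sum (hf : IsGPSample P k ρ a b f) (hσ : 0 < σ) (m : ℕ)
    (X : ℕ → Cube D) (Y : ℕ → ℝ) (x : Cube D) :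
    postMean k σ m X Y x = ∑ i : Fin m, postWeights k σ m X x i * Y i := by
  have hs := ((hf.regGram_posDef hσ m X).inv).isHermitian
  rw [Matrix.IsHermitian, Matrix.conjTranspose_eq_transpose_of_trivial] at hs
  rw [postMean, postWeights, Matrix.dotProduct_mulVec, ← Matrix.mulVec_transpose, hs]
  rfl

theorem postVar_eq_sum (m : ℕ) (X : ℕ → Cube D) (x : Cube D) :
    postVar k σ m X x = k x x - ∑ i : Fin m, k x (X i) * postWeights k σ m X x i := rfl

theorem IsGPSample.continuous_postMean (hf : IsGPSample P k ρ a b f) (hσ : 0 < σ) (m : ℕ)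
    (X : ℕ → Cube D) (x : Cube D) : Continuous fun Y => postMean k σ m X Y x := by
  simp_rw [hf.postMean_eq_sum hσ]
  fun_prop

theorem IsModel.hasGaussianLaw_noise (h : IsModel P σ f ε z U) (s : ℕ) :
    HasGaussianLaw (ε s) P :=
  ⟨by rw [h.noise_law]; infer_instance⟩

theorem IsModel.memLp_noise (h : IsModel P σ f ε z U) (s : ℕ) : MemLp (ε s) 2 P :=
  (h.hasGaussianLaw_noise s).memLp_two

theorem IsModel.integral_noise (h : IsModel P σ f ε z U) (s : ℕ) : ∫ ω, ε s ω ∂P = 0 := by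
  have h1 := integral_map (μ := P) (h.measurable_noise s).aemeasurable
    (aestronglyMeasurable_id (α := ℝ))
  simp only [id_eq] at h1
  rw [← h1, h.noise_law]
  exact integral_id_gaussianReal

theorem IsModel.variance_noise (h : IsModel P σ f ε z U) (s : ℕ) : Var[ε s; P] = σ ^ 2 := by
  have h1 := variance_id_map (μ := P) (X := ε s) (h.measurable_noise s).aemeasurable
  rw [← h1, h.noise_law, variance_id_gaussianReal, Real.coe_toNNReal _ (sq_nonneg σ)]

theorem IsModel.indepFun_path_noise (h : IsModel P σ f ε z U) (hf : IsGPSample P k ρ a b f) :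
    IndepFun hf.path (fun ω s => ε s ω) P := by
  refine indep_of_indep_of_le h.indep_f hf.comap_path_le ?_
  exact (measurable_fst.comp (comap_measurable
    fun ω => (fun s => ε s ω, fun t j => z t j ω, U ω))).comap_le

theorem IsModel.cov_noise (h : IsModel P σ f ε z U) (i j : ℕ) :
    cov[ε i, ε j; P] = if i = j then σ ^ 2 else 0 := by
  split_ifs with hij
  · subst hij
    rw [covariance_self (h.measurable_noise i).aemeasurable, h.variance_noise]
  · exact (h.noise_indep.indepFun hij).covariance_eq_zero (h.memLp_noise i) (h.memLp_noise j)

theorem IsModel.cov_path_noise (h : IsModel P σ f ε z U) (hf : IsGPSample P k ρ a b f)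
    (x : Cube D) (j : ℕ) : cov[f x, ε j; P] = 0 := by
  have := (h.indepFun_path_noise hf).comp (φ := fun g : C(Cube D, ℝ) => g x)
    (ψ := fun e : ℕ → ℝ => e j) (measurable_path_eval.comp (measurable_id.prodMk measurable_const))
    (measurable_pi_apply (X := fun _ : ℕ => ℝ) j)
  exact IndepFun.covariance_eq_zero this (hf.memLp x) (h.memLp_noise j)

/-- The noisy observations at the points of a fixed design. -/
def fixedObs (f : Cube D → Ω → ℝ) (ε : ℕ → Ω → ℝ) (X : ℕ → Cube D) (s : ℕ) (ω : Ω) : ℝ :=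
  f (X s) ω + ε s ω

theorem IsModel.measurable_fixedObs (h : IsModel P σ f ε z U) (hf : IsGPSample P k ρ a b f)
    (X : ℕ → Cube D) (s : ℕ) : Measurable (fixedObs f ε X s) :=
  (hf.measurable _).add (h.measurable_noise s)

theorem IsModel.memLp_fixedObs (h : IsModel P σ f ε z U) (hf : IsGPSample P k ρ a b f)
    (X : ℕ → Cube D) (s : ℕ) : MemLp (fixedObs f ε X s) 2 P :=
  (hf.memLp _).add (h.memLp_noise s)

theorem IsModel.memLp_mul_fixedObs (h : IsModel P σ f ε z U) (hf : IsGPSample P k ρ a b f)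
    (X : ℕ → Cube D) {m : ℕ} (w : Fin m → ℝ) (i : Fin m) :
    MemLp (fun ω => w i * fixedObs f ε X i ω) 2 P :=
  (h.memLp_fixedObs hf X i).const_mul _

theorem IsModel.memLp_sum_fixedObs (h : IsModel P σ f ε z U) (hf : IsGPSample P k ρ a b f)
    (X : ℕ → Cube D) {m : ℕ} (w : Fin m → ℝ) :
    MemLp (fun ω => ∑ i : Fin m, w i * fixedObs f ε X i ω) 2 P :=
  memLp_finsetSum _ fun i _ => h.memLp_mul_fixedObs hf X w i

theorem IsModel.cov_fixedObs_right (h : IsModel P σ f ε z U) (hf : IsGPSample P k ρ a b f)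
    (X : ℕ → Cube D) (x : Cube D) (s : ℕ) : cov[f x, fixedObs f ε X s; P] = k x (X s) := by
  have := covariance_add_right (μ := P) (hf.memLp x) (hf.memLp (X s)) (h.memLp_noise s)
  rw [h.cov_path_noise hf, hf.cov_eq, add_zero] at this
  exact this

theorem IsModel.cov_fixedObs (h : IsModel P σ f ε z U) (hf : IsGPSample P k ρ a b f)
    (X : ℕ → Cube D) (s t : ℕ) : cov[fixedObs f ε X s, fixedObs f ε X t; P] =
      k (X s) (X t) + if s = t then σ ^ 2 else 0 := by
  have h1 := covariance_add_left (μ := P) (hf.memLp (X s)) (h.memLp_noise s)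
    (h.memLp_fixedObs hf X t)
  have h2 := covariance_add_right (μ := P) (h.memLp_noise s) (hf.memLp (X t)) (h.memLp_noise t)
  rw [covariance_comm (ε s) (f (X t)), h.cov_path_noise hf, h.cov_noise, zero_add] at h2
  rw [h.cov_fixedObs_right hf] at h1
  exact h1.trans (congrArg (k (X s) (X t) + ·) h2)

/-- The posterior residual `f x - μ(x)` of a fixed design. -/
def residual (k : Cube D → Cube D → ℝ) (σ : ℝ) (f : Cube D → Ω → ℝ) (ε : ℕ → Ω → ℝ)
    (X : ℕ → Cube D) (m : ℕ) (x : Cube D) (ω : Ω) : ℝ :=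
  f x ω - postMean k σ m X (fun s => fixedObs f ε X s ω) x

theorem IsModel.residual_eq (hf : IsGPSample P k ρ a b f) (hσ : 0 < σ)
    (X : ℕ → Cube D) (m : ℕ) (x : Cube D) : residual k σ f ε X m x =
      fun ω => f x ω - ∑ i : Fin m, postWeights k σ m X x i * fixedObs f ε X i ω := by
  funext ω
  rw [residual, hf.postMean_eq_sum hσ]

theorem IsModel.measurable_residual (h : IsModel P σ f ε z U) (hf : IsGPSample P k ρ a b f)
    (hσ : 0 < σ) (X : ℕ → Cube D) (m : ℕ) (x : Cube D) : Measurable (residual k σ f ε X m x) := by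
  rw [IsModel.residual_eq hf hσ]
  exact (hf.measurable x).sub
    (Finset.measurable_sum _ fun i _ => (h.measurable_fixedObs hf X i).const_mul _)

theorem IsModel.memLp_residual (h : IsModel P σ f ε z U) (hf : IsGPSample P k ρ a b f)
    (hσ : 0 < σ) (X : ℕ → Cube D) (m : ℕ) (x : Cube D) : MemLp (residual k σ f ε X m x) 2 P := by
  rw [IsModel.residual_eq hf hσ]
  exact (hf.memLp x).sub
    (h.memLp_sum_fixedObs hf X _)

theorem IsModel.cov_residual_fixedObs (h : IsModel P σ f ε z U) (hf : IsGPSample P k ρ a b f)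
    (hσ : 0 < σ) (X : ℕ → Cube D) (m : ℕ) (x : Cube D) (j : Fin m) :
    cov[residual k σ f ε X m x, fixedObs f ε X j; P] = 0 := by
  rw [IsModel.residual_eq hf hσ, covariance_fun_sub_left (hf.memLp x)
    (h.memLp_sum_fixedObs hf X _)
    (h.memLp_fixedObs hf X j), h.cov_fixedObs_right hf,
    covariance_fun_sum_left (h.memLp_mul_fixedObs hf X _)
    (h.memLp_fixedObs hf X j), ← hf.sum_regGram_mul_postWeights hσ m X x j]
  simp_rw [covariance_const_mul_left, h.cov_fixedObs hf, mul_add, Finset.sum_add_distrib]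
  simp [Fin.val_inj, hf.kernel_symm (X j), mul_comm]

theorem IsModel.cov_residual_path (h : IsModel P σ f ε z U) (hf : IsGPSample P k ρ a b f)
    (hσ : 0 < σ) (X : ℕ → Cube D) (m : ℕ) (x : Cube D) :
    cov[residual k σ f ε X m x, f x; P] = postVar k σ m X x := by
  rw [IsModel.residual_eq hf hσ, covariance_fun_sub_left (hf.memLp x)
    (h.memLp_sum_fixedObs hf X _)
    (hf.memLp x), hf.cov_eq,
    covariance_fun_sum_left (h.memLp_mul_fixedObs hf X _)
    (hf.memLp x), postVar_eq_sum]
  simp_rw [covariance_const_mul_left, covariance_comm (fixedObs f ε X _) (f x),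
    h.cov_fixedObs_right hf, mul_comm]

theorem IsModel.variance_residual (h : IsModel P σ f ε z U) (hf : IsGPSample P k ρ a b f)
    (hσ : 0 < σ) (X : ℕ → Cube D) (m : ℕ) (x : Cube D) :
    Var[residual k σ f ε X m x; P] = postVar k σ m X x := by
  rw [← covariance_self (h.measurable_residual hf hσ X m x).aemeasurable]
  nth_rewrite 2 [IsModel.residual_eq hf hσ]
  rw [covariance_fun_sub_right (h.memLp_residual hf hσ X m x) (hf.memLp x)
    (h.memLp_sum_fixedObs hf X _),
    h.cov_residual_path hf hσ, covariance_fun_sum_right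
    (h.memLp_mul_fixedObs hf X _) (h.memLp_residual hf hσ X m x)]
  simp [covariance_const_mul_right, h.cov_residual_fixedObs hf hσ]

theorem IsModel.integral_residual (h : IsModel P σ f ε z U) (hf : IsGPSample P k ρ a b f)
    (hσ : 0 < σ) (X : ℕ → Cube D) (m : ℕ) (x : Cube D) :
    ∫ ω, residual k σ f ε X m x ω ∂P = 0 := by
  have hY : ∀ s, ∫ ω, fixedObs f ε X s ω ∂P = 0 := fun s => by
    have := integral_add (μ := P) ((hf.memLp (X s)).integrable one_le_two)
      ((h.memLp_noise s).integrable one_le_two)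
    rw [hf.mean_zero, h.integral_noise, add_zero] at this
    exact this
  rw [IsModel.residual_eq hf hσ, integral_sub ((hf.memLp x).integrable one_le_two)
    ((h.memLp_sum_fixedObs hf X _).integrable one_le_two), hf.mean_zero,
    integral_finsetSum _ fun i _ => (h.memLp_mul_fixedObs hf X _ i).integrable one_le_two]
  simp [integral_const_mul, hY]

theorem IsModel.hasGaussianLaw_fixedObs_residual (h : IsModel P σ f ε z U)
    (hf : IsGPSample P k ρ a b f) (hσ : 0 < σ) (X : ℕ → Cube D) (m : ℕ) (x : Cube D) :
    HasGaussianLaw (fun ω => (fun i : Fin m => fixedObs f ε X i ω,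
      fun _ : Fin 1 => residual k σ f ε X m x ω)) P := by
  have h1 : HasGaussianLaw (fun ω (i : Option (Fin m)) =>
      f (i.elim x fun i => X i) ω) P := hf.hasGaussianLaw _
  have h2 : HasGaussianLaw (fun ω (i : Fin m) => ε i ω) P :=
    (h.noise_indep.precomp (g := fun i : Fin m => (i : ℕ)) Fin.val_injective).hasGaussianLaw
      fun i => h.hasGaussianLaw_noise i
  have h3 : IndepFun (fun ω (i : Option (Fin m)) => f (i.elim x fun i => X i) ω)
      (fun ω (i : Fin m) => ε i ω) P :=
    (h.indepFun_path_noise hf).comp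
      (φ := fun (g : C(Cube D, ℝ)) (i : Option (Fin m)) => g (i.elim x fun i => X i))
      (ψ := fun (e : ℕ → ℝ) (i : Fin m) => e i)
      (measurable_pi_lambda _ fun i =>
        measurable_path_eval.comp (measurable_id.prodMk measurable_const))
      (measurable_pi_lambda _ fun i => measurable_pi_apply _)
  have h4 := h3.hasGaussianLaw h1 h2
  let pO : (Option (Fin m) → ℝ) × (Fin m → ℝ) →L[ℝ] (Option (Fin m) → ℝ) :=
    ContinuousLinearMap.fst ℝ _ _
  let pE : (Option (Fin m) → ℝ) × (Fin m → ℝ) →L[ℝ] (Fin m → ℝ) := ContinuousLinearMap.snd ℝ _ _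
  let LY : Fin m → ((Option (Fin m) → ℝ) × (Fin m → ℝ) →L[ℝ] ℝ) := fun i =>
    (ContinuousLinearMap.proj (some i)).comp pO + (ContinuousLinearMap.proj i).comp pE
  let LR : (Option (Fin m) → ℝ) × (Fin m → ℝ) →L[ℝ] ℝ :=
    (ContinuousLinearMap.proj none).comp pO - ∑ i, postWeights k σ m X x i • LY i
  have h5 := h4.map_fun ((ContinuousLinearMap.pi LY).prod (ContinuousLinearMap.pi fun _ : Fin 1 => LR))
  convert! h5 using 2 with ω
  refine Prod.ext ?_ ?_
  · funext i
    simp [LY, pO, pE, fixedObs]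
  · funext i
    rw [IsModel.residual_eq hf hσ]
    simp [LR, LY, pO, pE, fixedObs, mul_add]

theorem IsModel.indepFun_fixedObs_residual (h : IsModel P σ f ε z U)
    (hf : IsGPSample P k ρ a b f) (hσ : 0 < σ) (X : ℕ → Cube D) (m : ℕ) (x : Cube D) :
    IndepFun (fun ω => trunc m fun s => fixedObs f ε X s ω) (residual k σ f ε X m x) P := by
  have h1 := (h.hasGaussianLaw_fixedObs_residual hf hσ X m x).indepFun_of_covariance_eval
    (X := fun i : Fin m => fixedObs f ε X i) (Y := fun _ : Fin 1 => residual k σ f ε X m x)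
    (fun i _ => by rw [covariance_comm]; exact h.cov_residual_fixedObs hf hσ X m x i)
  have h2 := h1.comp (φ := fun (y : Fin m → ℝ) (i : ℕ) => if hi : i < m then y ⟨i, hi⟩ else 0)
    (ψ := fun r : Fin 1 → ℝ => r 0) (measurable_pi_lambda _ fun i => by
      split_ifs
      · exact measurable_pi_apply _
      · exact measurable_const) (measurable_pi_apply (X := fun _ : Fin 1 => ℝ) 0)
  convert! h2 using 1

theorem IsModel.map_residual (h : IsModel P σ f ε z U)
    (hf : IsGPSample P k ρ a b f) (hσ : 0 < σ) (X : ℕ → Cube D) (m : ℕ) (x : Cube D) :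
    P.map (residual k σ f ε X m x) = gaussianReal 0 (postVar k σ m X x).toNNReal := by
  have h1 : HasGaussianLaw (residual k σ f ε X m x) P :=
    (h.hasGaussianLaw_fixedObs_residual hf hσ X m x).snd.map_fun
      (ContinuousLinearMap.proj (R := ℝ) (φ := fun _ : Fin 1 => ℝ) 0)
  rw [h1.map_eq_gaussianReal, h.integral_residual hf hσ, h.variance_residual hf hσ]

end Regression

end

end LassoBO

namespace LassoBO

noncomputable section

open scoped ENNReal NNReal BoundedContinuousFunction

set_option linter.unusedSectionVars false

/-! ### The posterior of a fixed design -/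

theorem gaussianPDFReal_le (v : ℝ≥0) (x : ℝ) : gaussianPDFReal 0 v x ≤ (√(2 * Real.pi * v))⁻¹ := by
  rw [gaussianPDFReal]
  refine mul_le_of_le_one_right (by positivity) (Real.exp_le_one_iff.2 ?_)
  rw [neg_div]
  exact neg_nonpos.2 (by positivity)

theorem continuous_gaussianPDFReal (v : ℝ≥0) : Continuous (gaussianPDFReal 0 v) := by
  unfold gaussianPDFReal
  fun_prop

theorem likelihood_eq_ofReal (v : ℝ≥0) (m : ℕ) (a y : ℕ → ℝ) :
    likelihood v m a y =
      ENNReal.ofReal (∏ s ∈ Finset.range m, gaussianPDFReal 0 v (y s - a s)) := by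
  rw [ENNReal.ofReal_prod_of_nonneg fun i _ => gaussianPDFReal_nonneg _ _ _]
  rfl

theorem likelihood_trunc (v : ℝ≥0) (m : ℕ) (a y : ℕ → ℝ) :
    likelihood v m a (trunc m y) = likelihood v m a y :=
  Finset.prod_congr rfl fun s hs => by simp [trunc, Finset.mem_range.1 hs]

theorem postMean_trunc {D : ℕ} (k : Cube D → Cube D → ℝ) (σ : ℝ) (m : ℕ) (X : ℕ → Cube D)
    (Y : ℕ → ℝ) (x : Cube D) : postMean k σ m X (trunc m Y) x = postMean k σ m X Y x := by
  unfold postMean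
  congr 2
  funext i
  simp [trunc]

section Posterior

variable {D : ℕ} {Ω S : Type*} [mΩ : MeasurableSpace Ω] [mS : MeasurableSpace S] {P : Measure Ω}
  [IsProbabilityMeasure P] {k : Cube D → Cube D → ℝ} {ρ : Fin D → ℝ} {a b σ : ℝ}
  {f : Cube D → Ω → ℝ} {ε : ℕ → Ω → ℝ} {z : ℕ → ℕ → Ω → Cube D} {U : Ω → S}

theorem toNNReal_sq_ne_zero (hσ : 0 < σ) : (σ ^ 2).toNNReal ≠ 0 := by
  simpa using hσ.ne'

theorem IsModel.lintegral_fixedObs (h : IsModel P σ f ε z U) (hf : IsGPSample P k ρ a b f)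
    (hσ : 0 < σ) (X : ℕ → Cube D) (m : ℕ) {G : C(Cube D, ℝ) × (ℕ → ℝ) → ℝ≥0∞}
    (hG : Measurable G) :
    ∫⁻ ω, G (hf.path ω, trunc m fun s => fixedObs f ε X s ω) ∂P =
      ∫⁻ ω, ∫⁻ y, G (hf.path ω, y) * likelihood (σ ^ 2).toNNReal m (fun s => f (X s) ω) y
        ∂prefixVolume m ∂P := by
  have hobs : ∀ s ω, fixedObs f ε X s ω =
      (fun (g : C(Cube D, ℝ)) (x : Cube D) => g x) (hf.path ω)
        ((fun s (_ : Unit × (ℕ → ℝ)) => X s) s ((), trunc s fun i => fixedObs f ε X i ω)) +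
        ε s ω := fun s ω => rfl
  have hind := indepFun_past (P := P) (Φ := hf.path) (θ := fun _ => ()) measurable_path_eval
    (X := fun s (_ : Unit × (ℕ → ℝ)) => X s) (fun _ => measurable_const) hobs (fun s => by
      refine indep_of_indep_of_le_left (h.indep_noise_past hf s) (sup_le_sup_right ?_ _)
      refine sup_le_sup_left ?_ _
      rw [MeasurableSpace.comap_const]
      exact bot_le)
  exact lintegral_observations (P := P) (Φ := hf.path) (θ := fun _ => ()) hf.measurable_path
    measurable_const measurable_path_eval (X := fun s (_ : Unit × (ℕ → ℝ)) => X s)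
    (fun _ => measurable_const) (toNNReal_sq_ne_zero hσ) h.measurable_noise
    (h.measurable_fixedObs hf X) h.noise_law hobs hind m
    (G := fun q => G (q.1, q.2.2)) (hG.comp (by fun_prop))

theorem IsGPSample.measurable_likelihood_uncurry (hf : IsGPSample P k ρ a b f) (v : ℝ≥0) (m : ℕ)
    (X : ℕ → Cube D) :
    Measurable fun q : Ω × (ℕ → ℝ) => likelihood v m (fun s => f (X s) q.1) q.2 :=
  measurable_likelihood v m (fun _ _ => (hf.measurable _).comp measurable_fst) measurable_snd

theorem IsGPSample.measurable_likelihood_fixed (hf : IsGPSample P k ρ a b f) (v : ℝ≥0) (m : ℕ)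
    (X : ℕ → Cube D) (y : ℕ → ℝ) : Measurable fun ω => likelihood v m (fun s => f (X s) ω) y :=
  measurable_likelihood v m (a := fun ω s => f (X s) ω) (y := fun _ => y)
    (fun _ _ => hf.measurable _) measurable_const

theorem lintegral_map_withDensity {w : Ω → ℝ≥0∞} {r : Ω → ℝ} {B : ℝ → ℝ≥0∞} (hw : Measurable w)
    (hr : Measurable r) (hB : Measurable B) :
    ∫⁻ u, B u ∂((P.withDensity w).map r) = ∫⁻ ω, w ω * B (r ω) ∂P := by
  rw [lintegral_map hB hr]
  exact lintegral_withDensity_eq_lintegral_mul _ hw (hB.comp hr)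

theorem likelihood_le (v : ℝ≥0) (m : ℕ) (a y : ℕ → ℝ) :
    likelihood v m a y ≤ ENNReal.ofReal ((√(2 * Real.pi * v))⁻¹ ^ m) := by
  rw [likelihood_eq_ofReal]
  refine ENNReal.ofReal_le_ofReal ((Finset.prod_le_prod
    (fun i _ => gaussianPDFReal_nonneg _ _ _) fun i _ => gaussianPDFReal_le v _).trans ?_)
  simp

theorem IsGPSample.lintegral_likelihood_ne_top (v : ℝ≥0) (m : ℕ)
    (X : ℕ → Cube D) (y : ℕ → ℝ) : ∫⁻ ω, likelihood v m (fun s => f (X s) ω) y ∂P ≠ ∞ := by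
  refine ne_top_of_le_ne_top (b := ENNReal.ofReal ((√(2 * Real.pi * v))⁻¹ ^ m))
    ENNReal.ofReal_ne_top ?_
  calc ∫⁻ ω, likelihood v m (fun s => f (X s) ω) y ∂P
      ≤ ∫⁻ _, ENNReal.ofReal ((√(2 * Real.pi * v))⁻¹ ^ m) ∂P :=
        lintegral_mono fun ω => likelihood_le _ _ _ _
    _ = _ := by simp

theorem exists_bound_boundedContinuous (φ : ℝ →ᵇ ℝ≥0) : ∃ K : ℝ≥0, ∀ r, φ r ≤ K :=
  ⟨nndist φ 0, fun r => by
    have := BoundedContinuousFunction.nndist_coe_le_nndist (f := φ) (g := 0) r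
    simpa [NNReal.nndist_zero_eq_val'] using this⟩

theorem IsGPSample.continuous_lintegral_likelihood (hf : IsGPSample P k ρ a b f) (hσ : 0 < σ)
    (v : ℝ≥0) (X : ℕ → Cube D) (m : ℕ) (x : Cube D) (φ : ℝ →ᵇ ℝ≥0) :
    Continuous fun y => ∫⁻ ω, likelihood v m (fun s => f (X s) ω) y *
      φ (f x ω - postMean k σ m X y x) ∂P := by
  obtain ⟨K, hK⟩ := exists_bound_boundedContinuous φ
  have hnn : ∀ (y : ℕ → ℝ) ω,
      0 ≤ ∏ s ∈ Finset.range m, gaussianPDFReal 0 v (y s - f (X s) ω) := fun y ω =>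
    Finset.prod_nonneg fun i _ => gaussianPDFReal_nonneg _ _ _
  rw [continuous_iff_continuousAt]
  intro y₀
  refine tendsto_lintegral_filter_of_dominated_convergence
    (fun _ => ENNReal.ofReal ((√(2 * Real.pi * v))⁻¹ ^ m) * K)
    (Eventually.of_forall fun y => ?_) (Eventually.of_forall fun y => ae_of_all _ fun ω => ?_)
    ?_ (ae_of_all _ fun ω => ?_)
  · exact (hf.measurable_likelihood_fixed v m X y).mul (measurable_coe_nnreal_ennreal.comp
      (φ.continuous.measurable.comp ((hf.measurable x).sub measurable_const)))
  · exact mul_le_mul' (likelihood_le _ _ _ _) (ENNReal.coe_le_coe.2 (hK _))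
  · rw [lintegral_const]
    exact ENNReal.mul_ne_top (ENNReal.mul_ne_top ENNReal.ofReal_ne_top ENNReal.coe_ne_top)
      (measure_ne_top _ _)
  · have hrw : ∀ y : ℕ → ℝ,
        likelihood v m (fun s => f (X s) ω) y * φ (f x ω - postMean k σ m X y x) =
        ENNReal.ofReal ((∏ s ∈ Finset.range m, gaussianPDFReal 0 v (y s - f (X s) ω)) *
          φ (f x ω - postMean k σ m X y x)) := by
      intro y
      rw [likelihood_eq_ofReal, ENNReal.ofReal_mul (hnn y ω), ENNReal.ofReal_coe_nnreal]
    simp_rw [hrw]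
    have hc : Continuous fun y : ℕ → ℝ =>
        ENNReal.ofReal ((∏ s ∈ Finset.range m, gaussianPDFReal 0 v (y s - f (X s) ω)) *
          φ (f x ω - postMean k σ m X y x)) := by
      refine ENNReal.continuous_ofReal.comp (Continuous.mul ?_ ?_)
      · exact continuous_finsetProd _ fun s _ =>
          (continuous_gaussianPDFReal v).comp ((continuous_apply s).sub continuous_const)
      · exact NNReal.continuous_coe.comp (φ.continuous.comp
          (continuous_const.sub (hf.continuous_postMean hσ m X x)))
    exact hc.continuousAt

theorem IsModel.setLIntegral_likelihood (h : IsModel P σ f ε z U)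
    (hf : IsGPSample P k ρ a b f) (hσ : 0 < σ) (X : ℕ → Cube D) (m : ℕ)
    {g : C(Cube D, ℝ) × (ℕ → ℝ) → ℝ≥0∞} (hg : Measurable g) {s : Set (ℕ → ℝ)}
    (hs : MeasurableSet s) :
    ∫⁻ y in s, ∫⁻ ω, likelihood (σ ^ 2).toNNReal m (fun s => f (X s) ω) y * g (hf.path ω, y) ∂P
      ∂prefixVolume m =
    ∫⁻ ω, s.indicator 1 (trunc m fun s => fixedObs f ε X s ω) *
      g (hf.path ω, trunc m fun s => fixedObs f ε X s ω) ∂P := by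
  have hG : Measurable fun q : C(Cube D, ℝ) × (ℕ → ℝ) => s.indicator 1 q.2 * g q :=
    ((measurable_one.indicator hs).comp measurable_snd).mul hg
  rw [h.lintegral_fixedObs hf hσ X m hG, ← lintegral_indicator hs, lintegral_lintegral_swap]
  · refine lintegral_congr fun y => ?_
    by_cases hy : y ∈ s
    · simp [hy, mul_comm]
    · simp [hy]
  · refine Measurable.aemeasurable (Measurable.mul ?_ (hf.measurable_likelihood_uncurry _ m X))
    exact hG.comp ((hf.measurable_path.comp measurable_fst).prodMk measurable_snd)

theorem IsModel.lintegral_likelihood_boundedContinuous (h : IsModel P σ f ε z U)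
    (hf : IsGPSample P k ρ a b f) (hσ : 0 < σ) (X : ℕ → Cube D) (m : ℕ) (x : Cube D) (y : ℕ → ℝ)
    (φ : ℝ →ᵇ ℝ≥0) :
    ∫⁻ ω, likelihood (σ ^ 2).toNNReal m (fun s => f (X s) ω) y *
        φ (f x ω - postMean k σ m X y x) ∂P =
      (∫⁻ r, φ r ∂gaussianReal 0 (postVar k σ m X x).toNNReal) *
        ∫⁻ ω, likelihood (σ ^ 2).toNNReal m (fun s => f (X s) ω) y ∂P := by
  set v := (σ ^ 2).toNNReal with hv
  set N := gaussianReal 0 (postVar k σ m X x).toNNReal with hN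
  have hpm : Measurable fun y => postMean k σ m X y x := (hf.continuous_postMean hσ m X x).measurable
  have hφm : Measurable fun r => (φ r : ℝ≥0∞) :=
    measurable_coe_nnreal_ennreal.comp φ.continuous.measurable
  have hφfin : ∫⁻ r, φ r ∂N ≠ ∞ := by
    obtain ⟨K, hK⟩ := exists_bound_boundedContinuous φ
    refine ne_top_of_le_ne_top (b := (K : ℝ≥0∞)) ENNReal.coe_ne_top ?_
    calc ∫⁻ r, φ r ∂N ≤ ∫⁻ _, (K : ℝ≥0∞) ∂N := lintegral_mono fun r => ENNReal.coe_le_coe.2 (hK r)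
      _ = K := by simp
  have hcont := hf.continuous_lintegral_likelihood hσ v X m x
  have hone := hcont (BoundedContinuousFunction.const ℝ 1)
  simp only [BoundedContinuousFunction.const_apply, ENNReal.coe_one, mul_one] at hone
  have hgm : Measurable fun q : C(Cube D, ℝ) × (ℕ → ℝ) =>
      (φ (q.1 x - postMean k σ m X q.2 x) : ℝ≥0∞) :=
    hφm.comp ((measurable_path_eval.comp (measurable_fst.prodMk measurable_const)).sub
      (hpm.comp measurable_snd))
  have hYm : Measurable fun ω => trunc m fun s => fixedObs f ε X s ω :=
    (measurable_trunc m).comp (measurable_pi_lambda _ fun s => h.measurable_fixedObs hf X s)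
  have hset : ∀ ⦃s : Set (ℕ → ℝ)⦄, MeasurableSet s →
      ∫⁻ y in s, ∫⁻ ω, likelihood v m (fun s => f (X s) ω) y *
        φ (f x ω - postMean k σ m X y x) ∂P ∂prefixVolume m =
      P ((fun ω => trunc m fun s => fixedObs f ε X s ω) ⁻¹' s) * ∫⁻ r, φ r ∂N := by
    intro s hs
    refine (h.setLIntegral_likelihood hf hσ X m hgm hs).trans ?_
    have e1 : ∀ ω, (s.indicator 1 (trunc m fun s => fixedObs f ε X s ω) *
        φ (hf.path ω x - postMean k σ m X (trunc m fun s => fixedObs f ε X s ω) x) : ℝ≥0∞) =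
        s.indicator 1 (trunc m fun s => fixedObs f ε X s ω) *
          φ (residual k σ f ε X m x ω) := by
      intro ω
      rw [postMean_trunc]
      rfl
    simp_rw [e1]
    refine (lintegral_mul_eq_lintegral_mul_lintegral_of_indepFun''
      (f := fun ω => s.indicator (1 : (ℕ → ℝ) → ℝ≥0∞) (trunc m fun s => fixedObs f ε X s ω))
      (g := fun ω => (φ (residual k σ f ε X m x ω) : ℝ≥0∞))
      ((measurable_one.indicator hs).comp hYm).aemeasurable
      (hφm.comp (h.measurable_residual hf hσ X m x)).aemeasurable
      ((h.indepFun_fixedObs_residual hf hσ X m x).comp (measurable_one.indicator hs) hφm)).trans ?_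
    congr 1
    · rw [← lintegral_indicator_one (hYm hs)]
      rfl
    · rw [hN, ← h.map_residual hf hσ X m x,
        lintegral_map hφm (h.measurable_residual hf hσ X m x)]
  have hset1 : ∀ ⦃s : Set (ℕ → ℝ)⦄, MeasurableSet s →
      ∫⁻ y in s, ∫⁻ ω, likelihood v m (fun s => f (X s) ω) y ∂P ∂prefixVolume m =
      P ((fun ω => trunc m fun s => fixedObs f ε X s ω) ⁻¹' s) := by
    intro s hs
    have := h.setLIntegral_likelihood hf hσ X m (g := fun _ => 1) measurable_one hs
    simp only [mul_one] at this
    rw [this, ← lintegral_indicator_one (hYm hs)]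
    rfl
  have hm2 : Measurable fun y => ∫⁻ ω, likelihood v m (fun s => f (X s) ω) y ∂P :=
    (hf.measurable_likelihood_uncurry v m X).lintegral_prod_left'
  have hset2 : ∀ ⦃s : Set (ℕ → ℝ)⦄, MeasurableSet s →
      ∫⁻ y in s, (∫⁻ r, φ r ∂N) * ∫⁻ ω, likelihood v m (fun s => f (X s) ω) y ∂P
        ∂prefixVolume m =
      P ((fun ω => trunc m fun s => fixedObs f ε X s ω) ⁻¹' s) * ∫⁻ r, φ r ∂N := by
    intro s hs
    rw [lintegral_const_mul _ hm2, hset1 hs, mul_comm]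
  have hae : (fun y => ∫⁻ ω, likelihood v m (fun s => f (X s) ω) y *
      φ (f x ω - postMean k σ m X y x) ∂P) =ᵐ[prefixVolume m]
      fun y => (∫⁻ r, φ r ∂N) * ∫⁻ ω, likelihood v m (fun s => f (X s) ω) y ∂P := by
    refine AEMeasurable.ae_eq_of_forall_setLIntegral_eq (hcont φ).measurable.aemeasurable
      (hm2.const_mul _).aemeasurable ?_ ?_ fun s hs _ => (hset hs).trans (hset2 hs).symm
    · rw [← setLIntegral_univ, hset MeasurableSet.univ]
      exact ENNReal.mul_ne_top (measure_ne_top _ _) hφfin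
    · rw [← setLIntegral_univ, hset2 MeasurableSet.univ]
      exact ENNReal.mul_ne_top (measure_ne_top _ _) hφfin
  have := eq_of_ae_eq_prefixVolume (hcont φ)
    ((ENNReal.continuous_const_mul hφfin).comp hone) hae y
  simpa only [likelihood_trunc, postMean_trunc, Function.comp_apply] using this

/-- Given the observations at a fixed design, `f x` is normally distributed with the posterior mean
and variance: unnormalized version, valid for every value `y` of the observations. -/
theorem IsModel.lintegral_likelihood_posterior (h : IsModel P σ f ε z U)
    (hf : IsGPSample P k ρ a b f) (hσ : 0 < σ) (X : ℕ → Cube D) (m : ℕ) (x : Cube D) (y : ℕ → ℝ)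
    {B : ℝ → ℝ≥0∞} (hB : Measurable B) :
    ∫⁻ ω, likelihood (σ ^ 2).toNNReal m (fun s => f (X s) ω) y *
        B (f x ω - postMean k σ m X y x) ∂P =
      (∫⁻ r, B r ∂gaussianReal 0 (postVar k σ m X x).toNNReal) *
        ∫⁻ ω, likelihood (σ ^ 2).toNNReal m (fun s => f (X s) ω) y ∂P := by
  have hlm := hf.measurable_likelihood_fixed (σ ^ 2).toNNReal m X y
  have hmeas : Measurable fun ω => f x ω - postMean k σ m X y x :=
    (hf.measurable x).sub measurable_const
  have hext : (P.withDensity fun ω => likelihood (σ ^ 2).toNNReal m (fun s => f (X s) ω) y).map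
      (fun ω => f x ω - postMean k σ m X y x) =
      (∫⁻ ω, likelihood (σ ^ 2).toNNReal m (fun s => f (X s) ω) y ∂P) •
        gaussianReal 0 (postVar k σ m X x).toNNReal := by
    have : IsFiniteMeasure
        (P.withDensity fun ω => likelihood (σ ^ 2).toNNReal m (fun s => f (X s) ω) y) :=
      isFiniteMeasure_withDensity (IsGPSample.lintegral_likelihood_ne_top _ m X y)
    refine ext_of_forall_lintegral_eq_of_IsFiniteMeasure fun φ => ?_
    have hφm : Measurable fun r => (φ r : ℝ≥0∞) :=
      measurable_coe_nnreal_ennreal.comp φ.continuous.measurable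
    rw [lintegral_map_withDensity hlm hmeas hφm, lintegral_smul_measure, smul_eq_mul,
      mul_comm (∫⁻ ω, _ ∂P)]
    exact h.lintegral_likelihood_boundedContinuous hf hσ X m x y φ
  have := congrArg (fun μ => ∫⁻ r, B r ∂μ) hext
  rwa [lintegral_map_withDensity hlm hmeas hB, lintegral_smul_measure, smul_eq_mul,
    mul_comm (∫⁻ ω, _ ∂P)] at this

end Posterior

end

end LassoBO

namespace LassoBO

noncomputable section

open scoped ENNReal NNReal BoundedContinuousFunction

set_option linter.unusedSectionVars false

/-! ### Gaussian tails -/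

theorem gaussianReal_Ioi_zero_le (w : ℝ≥0) : gaussianReal 0 w (Set.Ioi 0) ≤ 1 / 2 := by
  have h1 : gaussianReal 0 w (Set.Iio 0) = gaussianReal 0 w (Set.Ioi 0) := by
    have h := gaussianReal_map_neg (μ := 0) (v := w)
    rw [neg_zero] at h
    conv_lhs => rw [← h]
    rw [Measure.map_apply measurable_neg measurableSet_Iio]
    congr 1
    ext x
    simp
  have h2 : gaussianReal 0 w (Set.Ioi 0) + gaussianReal 0 w (Set.Iio 0) ≤ 1 := by
    rw [← measure_union (by
      rw [Set.disjoint_left]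
      intro x hx hx'
      exact lt_asymm (Set.mem_Ioi.1 hx) (Set.mem_Iio.1 hx')) measurableSet_Iio]
    exact prob_le_one
  rw [h1, ← two_mul] at h2
  rw [ENNReal.le_div_iff_mul_le (by simp) (by simp), mul_comm]
  exact h2

theorem gaussianReal_Ioi_le (w : ℝ≥0) {c : ℝ} (hc : 0 ≤ c) :
    gaussianReal 0 w (Set.Ioi (c * √w)) ≤ ENNReal.ofReal (Real.exp (-c ^ 2 / 2) / 2) := by
  rcases eq_or_ne w 0 with rfl | hw
  · simp
  have hw' : (0 : ℝ) < w := by positivity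
  have hshift : ∀ u ∈ Set.Ioi (0 : ℝ), gaussianPDF 0 w (u + c * √w) ≤
      ENNReal.ofReal (Real.exp (-c ^ 2 / 2)) * gaussianPDF 0 w u := by
    intro u hu
    have hu : 0 < u := hu
    rw [gaussianPDF, gaussianPDF, ← ENNReal.ofReal_mul (Real.exp_nonneg _)]
    refine ENNReal.ofReal_le_ofReal ?_
    rw [gaussianPDFReal, gaussianPDFReal, mul_left_comm, ← Real.exp_add]
    refine mul_le_mul_of_nonneg_left (Real.exp_le_exp.2 ?_) (by positivity)
    have hs : √(w : ℝ) ^ 2 = w := Real.sq_sqrt hw'.le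
    rw [div_add_div _ _ (by norm_num) (by positivity), div_le_div_iff₀ (by positivity) (by positivity)]
    have : (u + c * √w - 0) ^ 2 ≥ u ^ 2 + c ^ 2 * w := by
      nlinarith [mul_nonneg (mul_nonneg hu.le hc) (Real.sqrt_nonneg (w : ℝ))]
    nlinarith [mul_pos hw' hw']
  calc gaussianReal 0 w (Set.Ioi (c * √w))
      = ∫⁻ x in Set.Ioi (c * √w), gaussianPDF 0 w x := gaussianReal_apply 0 hw _
    _ = ∫⁻ u in Set.Ioi 0, gaussianPDF 0 w (u + c * √w) := by
        rw [← lintegral_indicator measurableSet_Ioi, ← lintegral_indicator measurableSet_Ioi,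
          ← lintegral_add_right_eq_self _ (c * √w)]
        refine lintegral_congr fun u => ?_
        simp only [Set.indicator, Set.mem_Ioi, lt_add_iff_pos_left]
    _ ≤ ∫⁻ u in Set.Ioi 0, ENNReal.ofReal (Real.exp (-c ^ 2 / 2)) * gaussianPDF 0 w u :=
        setLIntegral_mono' measurableSet_Ioi hshift
    _ = ENNReal.ofReal (Real.exp (-c ^ 2 / 2)) * gaussianReal 0 w (Set.Ioi 0) := by
        rw [lintegral_const_mul _ (measurable_gaussianPDF 0 w), gaussianReal_apply 0 hw]
    _ ≤ ENNReal.ofReal (Real.exp (-c ^ 2 / 2)) * (1 / 2) := by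
        gcongr
        exact gaussianReal_Ioi_zero_le w
    _ = _ := by
        rw [div_eq_mul_inv (Real.exp _), ENNReal.ofReal_mul (Real.exp_nonneg _),
          ENNReal.ofReal_inv_of_pos (by norm_num)]
        simp

theorem gaussianReal_tail_le (w : ℝ≥0) {c : ℝ} (hc : 0 ≤ c) (s : ℤˣ) :
    gaussianReal 0 w {r | c * √w < ((s : ℤ) : ℝ) * r} ≤
      ENNReal.ofReal (Real.exp (-c ^ 2 / 2) / 2) := by
  rcases Int.units_eq_one_or s with rfl | rfl
  · simpa [Set.Ioi] using gaussianReal_Ioi_le w hc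
  · have h := gaussianReal_map_neg (μ := 0) (v := w)
    rw [neg_zero] at h
    rw [← h, Measure.map_apply measurable_neg (measurableSet_lt measurable_const (by fun_prop))]
    simpa [Set.Ioi] using gaussianReal_Ioi_le w hc

/-! ### Measurability of the posterior -/

theorem measurable_matrix_det {α : Type*} [MeasurableSpace α] {m : ℕ}
    {A : α → Matrix (Fin m) (Fin m) ℝ} (hA : ∀ i j, Measurable fun x => A x i j) :
    Measurable fun x => (A x).det := by
  simp_rw [Matrix.det_apply]
  refine Finset.measurable_sum _ fun τ _ => ?_
  exact (Finset.measurable_prod _ fun i _ => hA _ _).const_smul _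

theorem measurable_matrix_inv {α : Type*} [MeasurableSpace α] {m : ℕ}
    {A : α → Matrix (Fin m) (Fin m) ℝ} (hA : ∀ i j, Measurable fun x => A x i j) (i j : Fin m) :
    Measurable fun x => (A x)⁻¹ i j := by
  simp_rw [Matrix.inv_def, Ring.inverse_eq_inv', Matrix.smul_apply, Matrix.adjugate_apply]
  refine (measurable_matrix_det hA).inv.smul (measurable_matrix_det fun p q => ?_)
  simp only [Matrix.updateRow_apply]
  split_ifs
  · exact measurable_const
  · exact hA _ _

section

variable {D : ℕ} {α : Type*} [MeasurableSpace α] {k : Cube D → Cube D → ℝ}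

theorem measurable_regGram_inv (hk : Measurable (Function.uncurry k)) (σ : ℝ) {m : ℕ}
    {p : α → ℕ → Cube D} (hp : ∀ s < m, Measurable fun x => p x s) (i j : Fin m) :
    Measurable fun x => (gram k m (p x) + σ ^ 2 • (1 : Matrix (Fin m) (Fin m) ℝ))⁻¹ i j := by
  refine measurable_matrix_inv (fun i j => ?_) i j
  simp only [gram, Matrix.add_apply, Matrix.of_apply]
  exact (hk.comp ((hp i i.2).prodMk (hp j j.2))).add measurable_const

theorem measurable_crossVec (hk : Measurable (Function.uncurry k)) {m : ℕ}
    {p : α → ℕ → Cube D} (hp : ∀ s < m, Measurable fun x => p x s) {ξ : α → Cube D}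
    (hξ : Measurable ξ) (i : Fin m) : Measurable fun x => crossVec k m (p x) (ξ x) i :=
  hk.comp (hξ.prodMk (hp i i.2))

theorem measurable_postMean (hk : Measurable (Function.uncurry k)) (σ : ℝ) {m : ℕ}
    {p : α → ℕ → Cube D} (hp : ∀ s < m, Measurable fun x => p x s) {Y : α → ℕ → ℝ}
    (hY : ∀ s < m, Measurable fun x => Y x s) {ξ : α → Cube D}
    (hξ : Measurable ξ) : Measurable fun x => postMean k σ m (p x) (Y x) (ξ x) := by
  simp only [postMean, dotProduct, Matrix.mulVec]
  exact Finset.measurable_sum _ fun i _ => (measurable_crossVec hk hp hξ i).mul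
    (Finset.measurable_sum _ fun j _ => (measurable_regGram_inv hk σ hp i j).mul (hY j j.2))

theorem measurable_postVar (hk : Measurable (Function.uncurry k)) (σ : ℝ) {m : ℕ}
    {p : α → ℕ → Cube D} (hp : ∀ s < m, Measurable fun x => p x s) {ξ : α → Cube D}
    (hξ : Measurable ξ) : Measurable fun x => postVar k σ m (p x) (ξ x) := by
  simp only [postVar, dotProduct, Matrix.mulVec]
  exact (hk.comp (hξ.prodMk hξ)).sub (Finset.measurable_sum _ fun i _ =>
    (measurable_crossVec hk hp hξ i).mul (Finset.measurable_sum _ fun j _ =>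
      (measurable_regGram_inv hk σ hp i j).mul (measurable_crossVec hk hp hξ j)))

end

theorem postMean_congr {D : ℕ} (k : Cube D → Cube D → ℝ) (σ : ℝ) {m : ℕ} {X X' : ℕ → Cube D}
    {Y Y' : ℕ → ℝ} (hX : ∀ s < m, X s = X' s) (hY : ∀ s < m, Y s = Y' s) (x : Cube D) :
    postMean k σ m X Y x = postMean k σ m X' Y' x := by
  have h1 : gram k m X = gram k m X' := by
    ext i j
    simp [gram, hX i i.2, hX j j.2]
  have h2 : crossVec k m X x = crossVec k m X' x := by
    ext i
    simp [crossVec, hX i i.2]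
  have h3 : (fun i : Fin m => Y i) = fun i : Fin m => Y' i := funext fun i => hY i i.2
  rw [postMean, postMean, h1, h2, h3]

theorem postVar_congr {D : ℕ} (k : Cube D → Cube D → ℝ) (σ : ℝ) {m : ℕ} {X X' : ℕ → Cube D}
    (hX : ∀ s < m, X s = X' s) (x : Cube D) :
    postVar k σ m X x = postVar k σ m X' x := by
  have h1 : gram k m X = gram k m X' := by
    ext i j
    simp [gram, hX i i.2, hX j j.2]
  have h2 : crossVec k m X x = crossVec k m X' x := by
    ext i
    simp [crossVec, hX i i.2]
  rw [postVar, postVar, h1, h2]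

/-! ### Confidence bounds for adaptive designs -/

section Adaptive

variable {D : ℕ} {Ω S : Type*} [mΩ : MeasurableSpace Ω] [mS : MeasurableSpace S] {P : Measure Ω}
  [IsProbabilityMeasure P] {k : Cube D → Cube D → ℝ} {ρ : Fin D → ℝ} {a b σ : ℝ}
  {f : Cube D → Ω → ℝ} {ε : ℕ → Ω → ℝ} {z : ℕ → ℕ → Ω → Cube D} {U : Ω → S}

theorem IsGPSample.measurable_uncurry (hf : IsGPSample P k ρ a b f) :
    Measurable fun q : Cube D × Ω => f q.1 q.2 :=
  measurable_path_eval.comp ((hf.measurable_path.comp measurable_snd).prodMk measurable_fst)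

theorem IsGPSample.measurable_kernel (hf : IsGPSample P k ρ a b f) :
    Measurable (Function.uncurry k) := by
  have h : Function.uncurry k = fun q : Cube D × Cube D => ∫ ω, f q.1 ω * f q.2 ω ∂P := by
    funext q
    rw [Function.uncurry, ← hf.cov_eq, covariance]
    simp [hf.mean_zero]
  rw [h]
  have hm : Measurable fun q : (Cube D × Cube D) × Ω => f q.1.1 q.2 * f q.1.2 q.2 :=
    (hf.measurable_uncurry.comp ((measurable_fst.comp measurable_fst).prodMk measurable_snd)).mul
      (hf.measurable_uncurry.comp ((measurable_snd.comp measurable_fst).prodMk measurable_snd))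
  exact (hm.stronglyMeasurable.integral_prod_right').measurable

/-- Side information together with the first `m` observations. -/
def history (f : Cube D → Ω → ℝ) (ε : ℕ → Ω → ℝ) (z : ℕ → ℕ → Ω → Cube D) (U : Ω → S)
    (pt : ℕ → Ω → Cube D) (m : ℕ) (ω : Ω) : ((ℕ → ℕ → Cube D) × S) × (ℕ → ℝ) :=
  (sideInfo z U ω, trunc m fun i => obs f ε pt i ω)

/-- The design `pt` is adaptive: each point is a function of the side information and of the
earlier observations. -/
def IsAdaptive (f : Cube D → Ω → ℝ) (ε : ℕ → Ω → ℝ) (z : ℕ → ℕ → Ω → Cube D) (U : Ω → S)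
    (pt : ℕ → Ω → Cube D) : Prop :=
  ∀ s, Measurable[MeasurableSpace.comap (history f ε z U pt s) inferInstance] (pt s)

theorem IsAdaptive.measurable_obs_history (h : IsModel P σ f ε z U) (hf : IsGPSample P k ρ a b f)
    {pt : ℕ → Ω → Cube D} (hpt : IsAdaptive f ε z U pt) (s : ℕ) :
    Measurable (obs f ε pt s) ∧ Measurable (history f ε z U pt s) := by
  induction s using Nat.strong_induction_on with
  | _ s ih =>
    have h1 : Measurable (history f ε z U pt s) := by
      refine h.measurable_sideInfo.prodMk (measurable_pi_lambda _ fun i => ?_)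
      unfold trunc
      split_ifs with hi
      · exact (ih i hi).1
      · exact measurable_const
    refine ⟨?_, h1⟩
    exact (hf.measurable_uncurry.comp (((hpt s).mono h1.comap_le le_rfl).prodMk
      measurable_id)).add (h.measurable_noise s)

theorem lintegral_indep_pair {E Θ : Type*} [MeasurableSpace E] [MeasurableSpace Θ] {Φ : Ω → E}
    {θ : Ω → Θ} (hΦ : Measurable Φ) (hθ : Measurable θ) (hind : IndepFun Φ θ P)
    {F : E × Θ → ℝ≥0∞} (hF : Measurable F) :
    ∫⁻ ω, F (Φ ω, θ ω) ∂P = ∫⁻ ω, ∫⁻ ω', F (Φ ω', θ ω) ∂P ∂P := by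
  have h1 := (indepFun_iff_map_prod_eq_prod_map_map hΦ.aemeasurable hθ.aemeasurable).1 hind
  have : IsProbabilityMeasure (P.map Φ) := Measure.isProbabilityMeasure_map hΦ.aemeasurable
  have : IsProbabilityMeasure (P.map θ) := Measure.isProbabilityMeasure_map hθ.aemeasurable
  rw [← lintegral_map hF (hΦ.prodMk hθ), h1, lintegral_prod_symm _ hF.aemeasurable,
    lintegral_map hF.lintegral_prod_left' hθ]
  refine lintegral_congr fun ω => ?_
  exact lintegral_map (f := fun x => F (x, θ ω)) (hF.comp (by fun_prop)) hΦ

/-- Confidence bound: the value at a point `ξ` chosen on the basis of the past deviates from the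
posterior mean in a given direction by more than `c` posterior standard deviations with
conditional probability at most `exp (-c² / 2) / 2`. -/
theorem IsAdaptive.measure_deviation_le (h : IsModel P σ f ε z U) (hf : IsGPSample P k ρ a b f)
    (hσ : 0 < σ) {pt : ℕ → Ω → Cube D} (hpt : IsAdaptive f ε z U pt) (m : ℕ) {ξ : Ω → Cube D}
    (hξ : Measurable[MeasurableSpace.comap (history f ε z U pt m) inferInstance] ξ)
    {A : Set Ω} (hA : MeasurableSet[MeasurableSpace.comap (history f ε z U pt m) inferInstance] A)
    {c : ℝ} (hc : 0 ≤ c) (s : ℤˣ) :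
    P (A ∩ {ω | c * √(postVar k σ m (fun i => pt i ω) (ξ ω)) < ((s : ℤ) : ℝ) *
      (f (ξ ω) ω - postMean k σ m (fun i => pt i ω) (fun i => obs f ε pt i ω) (ξ ω))}) ≤
      ENNReal.ofReal (Real.exp (-c ^ 2 / 2) / 2) * P A := by
  have hobsm := fun s => (IsAdaptive.measurable_obs_history h hf hpt s).1
  have hH := (IsAdaptive.measurable_obs_history h hf hpt m).2
  choose X hX hXe using fun s => (hpt s).exists_eq_measurable_comp
  obtain ⟨Ξ, hΞ, rfl⟩ := hξ.exists_eq_measurable_comp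
  obtain ⟨A', hA', rfl⟩ := hA
  have hk := hf.measurable_kernel
  let p : ((ℕ → ℕ → Cube D) × S) × (ℕ → ℝ) → ℕ → Cube D := fun q s => X s (q.1, trunc s q.2)
  have hp : ∀ s, Measurable fun q => p q s := fun s =>
    (hX s).comp (measurable_fst.prodMk ((measurable_trunc s).comp measurable_snd))
  let T : C(Cube D, ℝ) × ((ℕ → ℕ → Cube D) × S) × (ℕ → ℝ) → ℝ := fun q =>
    q.1 (Ξ q.2) - postMean k σ m (p q.2) q.2.2 (Ξ q.2)
  let V : ((ℕ → ℕ → Cube D) × S) × (ℕ → ℝ) → ℝ := fun q => postVar k σ m (p q) (Ξ q)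
  have hV : Measurable V := measurable_postVar hk σ (fun s _ => hp s) hΞ
  have hT : Measurable T := (measurable_path_eval.comp (measurable_fst.prodMk
    (hΞ.comp measurable_snd))).sub ((measurable_postMean hk σ (fun s _ => hp s)
      (fun s _ => (measurable_pi_apply s).comp measurable_snd) hΞ).comp measurable_snd)
  let Bset : Set (C(Cube D, ℝ) × ((ℕ → ℕ → Cube D) × S) × (ℕ → ℝ)) := {q | c * √(V q.2) < ((s : ℤ) : ℝ) * T q}
  have hB : MeasurableSet Bset := measurableSet_lt
    (((hV.comp measurable_snd).sqrt).const_mul _) (hT.const_mul _)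
  have hA'' : MeasurableSet (Prod.snd ⁻¹' A' : Set (C(Cube D, ℝ) × ((ℕ → ℕ → Cube D) × S) × (ℕ → ℝ))) :=
    measurable_snd hA'
  have hobs : ∀ s ω, obs f ε pt s ω = (fun (g : C(Cube D, ℝ)) (x : Cube D) => g x) (hf.path ω)
      (X s (sideInfo z U ω, trunc s fun i => obs f ε pt i ω)) + ε s ω := by
    intro s ω
    have := congrFun (hXe s) ω
    simp only [Function.comp_apply, history] at this
    rw [← this]
    rfl
  have hind := indepFun_past (P := P) (Φ := hf.path) (θ := sideInfo z U) measurable_path_eval hX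
    hobs (h.indep_noise_past hf)
  have dens : ∀ {G : C(Cube D, ℝ) × ((ℕ → ℕ → Cube D) × S) × (ℕ → ℝ) → ℝ≥0∞}, Measurable G →
      ∫⁻ ω, G (hf.path ω, history f ε z U pt m ω) ∂P = ∫⁻ ω, ∫⁻ y, ∫⁻ ω',
        G (hf.path ω', sideInfo z U ω, y) * likelihood (σ ^ 2).toNNReal m
          (fun s => f (p (sideInfo z U ω, y) s) ω') y ∂P ∂prefixVolume m ∂P := by
    intro G hG
    refine (lintegral_observations (P := P) hf.measurable_path h.measurable_sideInfo
      measurable_path_eval hX (toNNReal_sq_ne_zero hσ) h.measurable_noise hobsm h.noise_law hobs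
      hind m hG).trans ?_
    have hFm : Measurable fun q : (C(Cube D, ℝ) × ((ℕ → ℕ → Cube D) × S)) × (ℕ → ℝ) => G (q.1.1, q.1.2, q.2) *
        likelihood (σ ^ 2).toNNReal m (fun s => q.1.1 (p (q.1.2, q.2) s)) q.2 := by
      refine (hG.comp (by fun_prop)).mul (measurable_likelihood _ m (fun s _ => ?_) measurable_snd)
      exact measurable_path_eval.comp ((measurable_fst.comp measurable_fst).prodMk
        ((hp s).comp ((measurable_snd.comp measurable_fst).prodMk measurable_snd)))
    refine (lintegral_indep_pair hf.measurable_path h.measurable_sideInfo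
      (h.indepFun_path_sideInfo hf) (F := fun q => ∫⁻ y, G (q.1, q.2, y) *
        likelihood (σ ^ 2).toNNReal m (fun s => q.1 (p (q.2, y) s)) y ∂prefixVolume m)
      hFm.lintegral_prod_right').trans ?_
    refine lintegral_congr fun ω => ?_
    rw [lintegral_lintegral_swap]
    · rfl
    · exact (hFm.comp (((hf.measurable_path.comp measurable_fst).prodMk measurable_const).prodMk
        measurable_snd)).aemeasurable
  have hset : history f ε z U pt m ⁻¹' A' ∩
      {ω | c * √(postVar k σ m (fun i => pt i ω) ((Ξ ∘ history f ε z U pt m) ω)) <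
        ((s : ℤ) : ℝ) * (f ((Ξ ∘ history f ε z U pt m) ω) ω - postMean k σ m (fun i => pt i ω)
          (fun i => obs f ε pt i ω) ((Ξ ∘ history f ε z U pt m) ω))} =
      (fun ω => (hf.path ω, history f ε z U pt m ω)) ⁻¹' (Prod.snd ⁻¹' A' ∩ Bset) := by
    ext ω
    have hpω : ∀ i < m, pt i ω = p (history f ε z U pt m ω) i := by
      intro i hi
      rw [hXe i]
      simp only [p, history, Function.comp_apply, trunc_trunc_of_le hi.le]
    simp only [Set.mem_inter_iff, Set.mem_preimage, Set.mem_ofPred_eq, Function.comp_apply, Bset, V, T]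
    rw [postVar_congr k σ hpω, postMean_congr k σ hpω (Y' := (history f ε z U pt m ω).2)
      (fun i hi => by simp [history, trunc, hi])]
    rfl
  rw [hset, ← lintegral_indicator_one ((hf.measurable_path.prodMk hH) (hA''.inter hB)),
    ← lintegral_indicator_one (hH hA')]
  have d1 := dens (G := fun q => A'.indicator 1 q.2 * Bset.indicator 1 q)
    (((measurable_one.indicator hA').comp measurable_snd).mul (measurable_one.indicator hB))
  have d2 := dens (G := fun q => A'.indicator 1 q.2)
    ((measurable_one.indicator hA').comp measurable_snd)
  have e1 : ∀ ω, ((fun ω => (hf.path ω, history f ε z U pt m ω)) ⁻¹'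
      (Prod.snd ⁻¹' A' ∩ Bset)).indicator (1 : Ω → ℝ≥0∞) ω =
      A'.indicator 1 (history f ε z U pt m ω) *
        Bset.indicator 1 (hf.path ω, history f ε z U pt m ω) := by
    intro ω
    by_cases h1 : history f ε z U pt m ω ∈ A' <;>
      by_cases h2 : (hf.path ω, history f ε z U pt m ω) ∈ Bset <;> simp [h1, h2]
  have e2 : ∀ ω, (history f ε z U pt m ⁻¹' A').indicator (1 : Ω → ℝ≥0∞) ω =
      A'.indicator 1 (history f ε z U pt m ω) := fun ω => rfl
  refine (lintegral_congr e1).trans_le ?_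
  refine le_of_le_of_eq ?_ (congrArg _ (lintegral_congr e2).symm)
  rw [d1, d2]
  have hcm : Measurable fun q : ((ℕ → ℕ → Cube D) × S) × (ℕ → ℝ) => ∫⁻ ω', A'.indicator (1 : ((ℕ → ℕ → Cube D) × S) × (ℕ → ℝ) → ℝ≥0∞) q *
      likelihood (σ ^ 2).toNNReal m (fun s => f (p q s) ω') q.2 ∂P := by
    refine Measurable.lintegral_prod_right' (f := fun r : (((ℕ → ℕ → Cube D) × S) × (ℕ → ℝ)) × Ω =>
      A'.indicator (1 : ((ℕ → ℕ → Cube D) × S) × (ℕ → ℝ) → ℝ≥0∞) r.1 *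
        likelihood (σ ^ 2).toNNReal m (fun s => f (p r.1 s) r.2) r.1.2) ?_
    refine ((measurable_one.indicator hA').comp measurable_fst).mul
      (measurable_likelihood _ m (fun s _ => ?_) (measurable_snd.comp measurable_fst))
    exact hf.measurable_uncurry.comp (((hp s).comp measurable_fst).prodMk measurable_snd)
  rw [← lintegral_const_mul _ (by
    refine Measurable.lintegral_prod_right' (f := fun r : Ω × (ℕ → ℝ) =>
      ∫⁻ ω', A'.indicator (1 : ((ℕ → ℕ → Cube D) × S) × (ℕ → ℝ) → ℝ≥0∞) (sideInfo z U r.1, r.2) *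
      likelihood (σ ^ 2).toNNReal m (fun s => f (p (sideInfo z U r.1, r.2) s) ω') r.2 ∂P) ?_
    exact hcm.comp ((h.measurable_sideInfo.comp measurable_fst).prodMk measurable_snd))]
  refine lintegral_mono fun ω => ?_
  have hcm' : Measurable fun y : ℕ → ℝ =>
      ∫⁻ ω', A'.indicator (1 : ((ℕ → ℕ → Cube D) × S) × (ℕ → ℝ) → ℝ≥0∞) (sideInfo z U ω, y) *
      likelihood (σ ^ 2).toNNReal m (fun s => f (p (sideInfo z U ω, y) s) ω') y ∂P :=
    hcm.comp (measurable_const.prodMk measurable_id)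
  refine le_of_le_of_eq (lintegral_mono fun y => ?_) (lintegral_const_mul _ hcm')
  set q : ((ℕ → ℕ → Cube D) × S) × (ℕ → ℝ) := (sideInfo z U ω, y) with hq
  have hBB : ∀ ω', Bset.indicator (1 : C(Cube D, ℝ) × ((ℕ → ℕ → Cube D) × S) × (ℕ → ℝ) → ℝ≥0∞) (hf.path ω', q) =
      {r : ℝ | c * √(V q) < ((s : ℤ) : ℝ) * r}.indicator 1
        (f (Ξ q) ω' - postMean k σ m (p q) y (Ξ q)) := fun ω' => rfl
  have hset' : MeasurableSet {r : ℝ | c * √(V q) < ((s : ℤ) : ℝ) * r} :=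
    measurableSet_lt measurable_const (by fun_prop)
  have fd := h.lintegral_likelihood_posterior hf hσ (p q) m (Ξ q) y
    (B := {r : ℝ | c * √(V q) < ((s : ℤ) : ℝ) * r}.indicator 1) (measurable_one.indicator hset')
  rw [lintegral_indicator_one hset'] at fd
  change ∫⁻ ω', A'.indicator (1 : ((ℕ → ℕ → Cube D) × S) × (ℕ → ℝ) → ℝ≥0∞) q *
      Bset.indicator (1 : C(Cube D, ℝ) × ((ℕ → ℕ → Cube D) × S) × (ℕ → ℝ) → ℝ≥0∞) (hf.path ω', q) *
      likelihood (σ ^ 2).toNNReal m (fun s => f (p q s) ω') y ∂P ≤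
    ENNReal.ofReal (Real.exp (-c ^ 2 / 2) / 2) *
      ∫⁻ ω', A'.indicator (1 : ((ℕ → ℕ → Cube D) × S) × (ℕ → ℝ) → ℝ≥0∞) q *
        likelihood (σ ^ 2).toNNReal m (fun s => f (p q s) ω') y ∂P
  by_cases hqA : q ∈ A'
  · simp_rw [hBB, Set.indicator_of_mem hqA, Pi.one_apply, one_mul]
    rw [lintegral_congr fun ω' => mul_comm _ _, fd]
    refine mul_le_mul_left ?_ _
    have hVq : √(V q) = √((V q).toNNReal : ℝ) := by
      rcases le_total 0 (V q) with h0 | h0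
      · rw [Real.coe_toNNReal _ h0]
      · rw [Real.sqrt_eq_zero_of_nonpos h0, Real.toNNReal_of_nonpos h0]
        simp
    rw [hVq]
    exact gaussianReal_tail_le _ hc s
  · simp_rw [Set.indicator_of_notMem hqA]
    simp

end Adaptive

end

end LassoBO

namespace LassoBO

noncomputable section

open scoped ENNReal NNReal

set_option linter.unusedSectionVars false

/-! ### Information gain -/

theorem lintegral_gaussianPDF_sub (w : ℝ≥0) {v : ℝ≥0} (hv : v ≠ 0) (u : ℝ) :
    ∫⁻ r, gaussianPDF 0 v (u - r) ∂gaussianReal 0 w = gaussianPDF 0 (w + v) u := by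
  have hcont : Continuous fun u => ∫⁻ r, gaussianPDF 0 v (u - r) ∂gaussianReal 0 w := by
    rw [continuous_iff_continuousAt]
    intro u₀
    refine tendsto_lintegral_filter_of_dominated_convergence
      (fun _ => ENNReal.ofReal (√(2 * Real.pi * v))⁻¹)
      (Eventually.of_forall fun y => ?_) (Eventually.of_forall fun y => ae_of_all _ fun r => ?_)
      ?_ (ae_of_all _ fun r => ?_)
    · exact (measurable_gaussianPDF 0 v).comp (measurable_const.sub measurable_id)
    · exact ENNReal.ofReal_le_ofReal (gaussianPDFReal_le v _)
    · rw [lintegral_const]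
      exact ENNReal.mul_ne_top ENNReal.ofReal_ne_top (measure_ne_top _ _)
    · have hc : Continuous fun y : ℝ => gaussianPDF 0 v (y - r) := ENNReal.continuous_ofReal.comp
        ((continuous_gaussianPDFReal v).comp (continuous_id.sub continuous_const))
      exact hc.continuousAt
  have hcont' : Continuous (gaussianPDF 0 (w + v)) :=
    ENNReal.continuous_ofReal.comp (continuous_gaussianPDFReal _)
  have hwv : w + v ≠ 0 := by
    intro h0
    exact hv (by simpa using (add_eq_zero.1 h0).2)
  have hm : Measurable fun q : ℝ × ℝ => gaussianPDF 0 v (q.1 - q.2) :=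
    (measurable_gaussianPDF 0 v).comp (measurable_fst.sub measurable_snd)
  have hset : ∀ ⦃s : Set ℝ⦄, MeasurableSet s →
      ∫⁻ u in s, ∫⁻ r, gaussianPDF 0 v (u - r) ∂gaussianReal 0 w = gaussianReal 0 (w + v) s := by
    intro s hs
    have hconv := gaussianReal_conv_gaussianReal (m₁ := 0) (m₂ := 0) (v₁ := w) (v₂ := v)
    rw [add_zero] at hconv
    rw [← hconv, ← lintegral_indicator_one hs,
      Measure.lintegral_conv (measurable_one.indicator hs), ← lintegral_indicator hs]
    have e1 : ∀ u : ℝ, s.indicator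
        (fun u => ∫⁻ r, gaussianPDF 0 v (u - r) ∂gaussianReal 0 w) u =
        ∫⁻ r, s.indicator 1 u * gaussianPDF 0 v (u - r) ∂gaussianReal 0 w := by
      intro u
      by_cases hu : u ∈ s <;> simp [hu]
    simp_rw [e1]
    rw [lintegral_lintegral_swap ((((measurable_one.indicator hs).comp measurable_fst).mul
      hm).aemeasurable)]
    refine lintegral_congr fun r => ?_
    have hind : Measurable fun u : ℝ => s.indicator (1 : ℝ → ℝ≥0∞) (r + u) :=
      (measurable_one.indicator hs).comp (measurable_const_add r)
    rw [gaussianReal_of_var_ne_zero _ hv, lintegral_withDensity_eq_lintegral_mul _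
      (measurable_gaussianPDF 0 v) hind, ← lintegral_add_left_eq_self _ r]
    refine lintegral_congr fun u => ?_
    simp [mul_comm]
  have hae : (fun u => ∫⁻ r, gaussianPDF 0 v (u - r) ∂gaussianReal 0 w) =ᵐ[volume]
      gaussianPDF 0 (w + v) := by
    refine AEMeasurable.ae_eq_of_forall_setLIntegral_eq hcont.measurable.aemeasurable
      hcont'.measurable.aemeasurable ?_ ?_ fun s hs _ => ?_
    · rw [← setLIntegral_univ, hset MeasurableSet.univ]
      exact measure_ne_top _ _
    · rw [lintegral_gaussianPDF_eq_one _ hwv]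
      exact ENNReal.one_ne_top
    · rw [hset hs, gaussianReal_apply _ hwv]
  exact congrFun ((Continuous.ae_eq_iff_eq _ hcont hcont').1 hae) u

theorem log_gaussianPDFReal {v : ℝ≥0} (hv : v ≠ 0) (x : ℝ) :
    Real.log (gaussianPDFReal 0 v x) = -(Real.log (2 * Real.pi * v) / 2) - x ^ 2 / (2 * v) := by
  have hv' : (0 : ℝ) < v := by positivity
  rw [gaussianPDFReal, Real.log_mul (by positivity) (Real.exp_ne_zero _), Real.log_exp,
    Real.log_inv, Real.log_sqrt (by positivity)]
  ring

section Gain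

variable {D : ℕ} {Ω S : Type*} [mΩ : MeasurableSpace Ω] [mS : MeasurableSpace S] {P : Measure Ω}
  [IsProbabilityMeasure P] {k : Cube D → Cube D → ℝ} {ρ : Fin D → ℝ} {a b σ : ℝ}
  {f : Cube D → Ω → ℝ} {ε : ℕ → Ω → ℝ} {z : ℕ → ℕ → Ω → Cube D} {U : Ω → S}

/-- The predictive variance of the observation `s` given the earlier ones. -/
def predVar (k : Cube D → Cube D → ℝ) (σ : ℝ) (X : ℕ → Cube D) (s : ℕ) : ℝ≥0 :=
  (postVar k σ s X (X s)).toNNReal + (σ ^ 2).toNNReal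

theorem predVar_ne_zero (hσ : 0 < σ) (X : ℕ → Cube D) (s : ℕ) : predVar k σ X s ≠ 0 := by
  intro h0
  exact toNNReal_sq_ne_zero hσ (add_eq_zero.1 h0).2

theorem IsModel.postVar_nonneg (h : IsModel P σ f ε z U) (hf : IsGPSample P k ρ a b f)
    (hσ : 0 < σ) (X : ℕ → Cube D) (m : ℕ) (x : Cube D) : 0 ≤ postVar k σ m X x := by
  rw [← h.variance_residual hf hσ]
  exact variance_nonneg _ _

theorem IsModel.coe_predVar (h : IsModel P σ f ε z U) (hf : IsGPSample P k ρ a b f)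
    (hσ : 0 < σ) (X : ℕ → Cube D) (s : ℕ) :
    (predVar k σ X s : ℝ) = postVar k σ s X (X s) + σ ^ 2 := by
  rw [predVar, NNReal.coe_add, Real.coe_toNNReal _ (h.postVar_nonneg hf hσ X s _),
    Real.coe_toNNReal _ (sq_nonneg σ)]

/-- The density of the observations at a fixed design factorizes into predictive densities. -/
theorem IsModel.lintegral_likelihood (h : IsModel P σ f ε z U) (hf : IsGPSample P k ρ a b f)
    (hσ : 0 < σ) (X : ℕ → Cube D) (m : ℕ) (y : ℕ → ℝ) :
    ∫⁻ ω, likelihood (σ ^ 2).toNNReal m (fun s => f (X s) ω) y ∂P =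
      ∏ s ∈ Finset.range m, gaussianPDF 0 (predVar k σ X s)
        (y s - postMean k σ s X y (X s)) := by
  induction m with
  | zero => simp [likelihood]
  | succ m ih =>
    have fd := h.lintegral_likelihood_posterior hf hσ X m (X m) y
      (B := fun r => gaussianPDF 0 (σ ^ 2).toNNReal (y m - postMean k σ m X y (X m) - r))
      ((measurable_gaussianPDF _ _).comp (measurable_const.sub measurable_id))
    rw [lintegral_gaussianPDF_sub _ (toNNReal_sq_ne_zero hσ), ih] at fd
    rw [Finset.prod_range_succ, mul_comm, predVar, ← fd]
    refine lintegral_congr fun ω => ?_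
    rw [likelihood, Finset.prod_range_succ, likelihood]
    congr 2
    ring

theorem gaussianPDF_ne_zero {v : ℝ≥0} (hv : v ≠ 0) (x : ℝ) : gaussianPDF 0 v x ≠ 0 :=
  (gaussianPDF_pos 0 hv x).ne'

theorem IsModel.cov_residual_noise (h : IsModel P σ f ε z U) (hf : IsGPSample P k ρ a b f)
    (hσ : 0 < σ) (X : ℕ → Cube D) (m : ℕ) (x : Cube D) :
    cov[residual k σ f ε X m x, ε m; P] = 0 := by
  have h1 : ∀ i < m, cov[fixedObs f ε X i, ε m; P] = 0 := by
    intro i hi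
    have h2 := covariance_add_left (μ := P) (hf.memLp (X i)) (h.memLp_noise i) (h.memLp_noise m)
    rw [h.cov_path_noise hf, h.cov_noise, if_neg hi.ne, add_zero] at h2
    exact h2
  rw [IsModel.residual_eq hf hσ, covariance_fun_sub_left (hf.memLp x)
    (h.memLp_sum_fixedObs hf X _) (h.memLp_noise m), h.cov_path_noise hf,
    covariance_fun_sum_left (h.memLp_mul_fixedObs hf X _) (h.memLp_noise m)]
  simp [covariance_const_mul_left, h1]

theorem IsModel.integral_innovation_sq (h : IsModel P σ f ε z U) (hf : IsGPSample P k ρ a b f)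
    (hσ : 0 < σ) (X : ℕ → Cube D) (m : ℕ) :
    ∫ ω, (residual k σ f ε X m (X m) ω + ε m ω) ^ 2 ∂P = predVar k σ X m := by
  have h1 := h.memLp_residual hf hσ X m (X m)
  have h2 := h.memLp_noise m
  have h3 := variance_add (μ := P) h1 h2
  rw [h.cov_residual_noise hf hσ, h.variance_residual hf hσ, h.variance_noise,
    variance_of_integral_eq_zero (h1.add h2).aemeasurable (by
      have := integral_add (μ := P) (h1.integrable one_le_two) (h2.integrable one_le_two)
      rw [h.integral_residual hf hσ, h.integral_noise, add_zero] at this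
      exact this)] at h3
  rw [h.coe_predVar hf hσ]
  simpa using h3

theorem IsModel.integral_noise_sq (h : IsModel P σ f ε z U) (m : ℕ) :
    ∫ ω, ε m ω ^ 2 ∂P = σ ^ 2 := by
  rw [← h.variance_noise m, variance_of_integral_eq_zero (h.measurable_noise m).aemeasurable
    (h.integral_noise m)]

/-- Extension by zero of a finite sequence. -/
def extendZero {T : ℕ} (y : Fin T → ℝ) : ℕ → ℝ := fun i => if hi : i < T then y ⟨i, hi⟩ else 0

theorem extendZero_restrict (T : ℕ) (y : ℕ → ℝ) :
    extendZero (fun j : Fin T => y j) = trunc T y := by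
  funext i
  simp only [extendZero, trunc]
  split_ifs <;> rfl

theorem measurable_extendZero {T : ℕ} : Measurable (extendZero (T := T)) :=
  measurable_pi_lambda _ fun i => by
    unfold extendZero
    split_ifs
    · exact measurable_pi_apply _
    · exact measurable_const

/-- The density of the joint law of function values and observations with respect to the product
of its marginals. -/
def gainDensity (k : Cube D → Cube D → ℝ) (σ : ℝ) (X : ℕ → Cube D) (T : ℕ)
    (q : (Fin T → ℝ) × (Fin T → ℝ)) : ℝ≥0∞ :=
  likelihood (σ ^ 2).toNNReal T (extendZero q.1) (extendZero q.2) /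
    ∏ s ∈ Finset.range T, gaussianPDF 0 (predVar k σ X s)
      (extendZero q.2 s - postMean k σ s X (extendZero q.2) (X s))

theorem IsGPSample.measurable_gainDensity (hf : IsGPSample P k ρ a b f) (hσ : 0 < σ)
    (X : ℕ → Cube D) (T : ℕ) : Measurable (gainDensity k σ X T) := by
  have h1 : Measurable fun q : (Fin T → ℝ) × (Fin T → ℝ) => extendZero q.1 :=
    measurable_extendZero.comp measurable_fst
  have h2 : Measurable fun q : (Fin T → ℝ) × (Fin T → ℝ) => extendZero q.2 :=
    measurable_extendZero.comp measurable_snd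
  refine (measurable_likelihood _ T (fun s _ => (measurable_pi_apply s).comp h1) h2).div ?_
  refine Finset.measurable_prod _ fun s _ => (measurable_gaussianPDF _ _).comp ?_
  exact ((measurable_pi_apply s).comp h2).sub ((hf.continuous_postMean hσ s X _).measurable.comp h2)

theorem prod_predictive_trunc (k : Cube D → Cube D → ℝ) (σ : ℝ) (X : ℕ → Cube D) (T : ℕ)
    (y : ℕ → ℝ) :
    ∏ s ∈ Finset.range T, gaussianPDF 0 (predVar k σ X s)
        (trunc T y s - postMean k σ s X (trunc T y) (X s)) =
      ∏ s ∈ Finset.range T, gaussianPDF 0 (predVar k σ X s) (y s - postMean k σ s X y (X s)) := by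
  refine Finset.prod_congr rfl fun s hs => ?_
  have hs' := Finset.mem_range.1 hs
  rw [← postMean_trunc k σ s X (trunc T y), trunc_trunc_of_le hs'.le, postMean_trunc]
  simp [trunc, hs']

theorem likelihood_congr (v : ℝ≥0) {m : ℕ} {a a' y y' : ℕ → ℝ} (ha : ∀ s < m, a s = a' s)
    (hy : ∀ s < m, y s = y' s) : likelihood v m a y = likelihood v m a' y' :=
  Finset.prod_congr rfl fun s hs => by
    rw [ha s (Finset.mem_range.1 hs), hy s (Finset.mem_range.1 hs)]

theorem IsModel.map_joint_eq_withDensity (h : IsModel P σ f ε z U) (hf : IsGPSample P k ρ a b f)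
    (hσ : 0 < σ) (X : ℕ → Cube D) (T : ℕ) :
    P.map (fun ω => (fun j : Fin T => f (X j) ω, fun j : Fin T => fixedObs f ε X j ω)) =
      ((P.map fun ω (j : Fin T) => f (X j) ω).prod
        (P.map fun ω (j : Fin T) => fixedObs f ε X j ω)).withDensity (gainDensity k σ X T) := by
  have hV : Measurable fun ω (j : Fin T) => f (X j) ω :=
    measurable_pi_lambda _ fun j => hf.measurable _
  have hY : Measurable fun ω (j : Fin T) => fixedObs f ε X j ω :=
    measurable_pi_lambda _ fun j => h.measurable_fixedObs hf X j
  have hr := hf.measurable_gainDensity hσ X T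
  have hres : Measurable fun (y : ℕ → ℝ) (j : Fin T) => y j :=
    measurable_pi_lambda _ fun j => measurable_pi_apply _
  have hev : Measurable fun (g : C(Cube D, ℝ)) (j : Fin T) => g (X j) :=
    measurable_pi_lambda _ fun j => measurable_path_eval.comp (measurable_id.prodMk measurable_const)
  have htr : ∀ y : ℕ → ℝ, (fun j : Fin T => trunc T y j) = fun j : Fin T => y j := by
    intro y
    funext j
    simp [trunc]
  ext s hs
  have h1 : Measurable (s.indicator (1 : (Fin T → ℝ) × (Fin T → ℝ) → ℝ≥0∞)) :=
    measurable_one.indicator hs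
  rw [withDensity_apply _ hs, ← lintegral_indicator_one hs, lintegral_map h1 (hV.prodMk hY),
    ← lintegral_indicator hs, lintegral_prod _ (hr.indicator hs).aemeasurable,
    lintegral_map (hr.indicator hs).lintegral_prod_right' hV]
  have eL := h.lintegral_fixedObs hf hσ X T
    (G := fun q => s.indicator 1 (fun j : Fin T => q.1 (X j), fun j : Fin T => q.2 j))
    (h1.comp ((hev.comp measurable_fst).prodMk (hres.comp measurable_snd)))
  simp only [htr] at eL
  refine eL.trans (lintegral_congr fun ω => ?_)
  have hGm : Measurable fun y : Fin T → ℝ => s.indicator (gainDensity k σ X T)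
      (fun j : Fin T => f (X j) ω, y) := (hr.indicator hs).comp (measurable_const.prodMk measurable_id)
  have eR := h.lintegral_fixedObs hf hσ X T
    (G := fun q => s.indicator (gainDensity k σ X T)
      (fun j : Fin T => f (X j) ω, fun j : Fin T => q.2 j)) (hGm.comp (hres.comp measurable_snd))
  simp only [htr] at eR
  rw [lintegral_map hGm hY]
  refine Eq.trans ?_ eR.symm
  rw [lintegral_lintegral_swap (((hGm.comp (hres.comp measurable_snd)).mul
    (hf.measurable_likelihood_uncurry _ T X)).aemeasurable)]
  refine lintegral_congr fun y => ?_
  rw [lintegral_const_mul _ (hf.measurable_likelihood_fixed _ T X y),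
    h.lintegral_likelihood hf hσ X T y]
  by_cases hy : ((fun j : Fin T => f (X j) ω, fun j : Fin T => y j) :
      (Fin T → ℝ) × (Fin T → ℝ)) ∈ s
  · have hy' : ((fun j : Fin T => hf.path ω (X j), fun j : Fin T => y j) :
      (Fin T → ℝ) × (Fin T → ℝ)) ∈ s := hy
    rw [Set.indicator_of_mem hy, Set.indicator_of_mem hy', Pi.one_apply, one_mul, gainDensity]
    simp only [extendZero_restrict T y]
    rw [prod_predictive_trunc, ENNReal.div_mul_cancel]
    · refine likelihood_congr _ (fun s hs => ?_) (fun s hs => ?_)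
      · simp [extendZero, hs]
      · simp [trunc, hs]
    · exact Finset.prod_ne_zero_iff.2 fun s _ => gaussianPDF_ne_zero (predVar_ne_zero hσ X s) _
    · exact ENNReal.prod_ne_top fun s _ => ENNReal.ofReal_ne_top
  · have hy' : ((fun j : Fin T => hf.path ω (X j), fun j : Fin T => y j) :
      (Fin T → ℝ) × (Fin T → ℝ)) ∉ s := hy
    rw [Set.indicator_of_notMem hy, Set.indicator_of_notMem hy', zero_mul, zero_mul]

theorem log_gainDensity (hσ : 0 < σ) (X : ℕ → Cube D) (T : ℕ) (ω : Ω) :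
    Real.log (gainDensity k σ X T
      (fun j : Fin T => f (X j) ω, fun j : Fin T => fixedObs f ε X j ω)).toReal =
    ∑ s ∈ Finset.range T, ((Real.log (2 * Real.pi * predVar k σ X s) / 2 -
      Real.log (2 * Real.pi * (σ ^ 2)) / 2) + ((residual k σ f ε X s (X s) ω + ε s ω) ^ 2 /
        (2 * predVar k σ X s) - ε s ω ^ 2 / (2 * σ ^ 2))) := by
  have e1 : likelihood (σ ^ 2).toNNReal T (extendZero fun j : Fin T => f (X j) ω)
      (trunc T fun i => fixedObs f ε X i ω) =
      ∏ s ∈ Finset.range T, gaussianPDF 0 (σ ^ 2).toNNReal (ε s ω) := by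
    refine Finset.prod_congr rfl fun s hs => ?_
    have hs' := Finset.mem_range.1 hs
    simp [trunc, extendZero, hs', fixedObs]
  rw [gainDensity]
  simp only [extendZero_restrict T (fun i => fixedObs f ε X i ω)]
  rw [prod_predictive_trunc, e1, ENNReal.toReal_div, ENNReal.toReal_prod, ENNReal.toReal_prod]
  simp only [gaussianPDF, ENNReal.toReal_ofReal (gaussianPDFReal_nonneg _ _ _)]
  rw [Real.log_div (Finset.prod_ne_zero_iff.2 fun s _ =>
      (gaussianPDFReal_pos _ _ _ (toNNReal_sq_ne_zero hσ)).ne')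
    (Finset.prod_ne_zero_iff.2 fun s _ => (gaussianPDFReal_pos _ _ _ (predVar_ne_zero hσ X s)).ne'),
    Real.log_prod (fun s _ => (gaussianPDFReal_pos _ _ _ (toNNReal_sq_ne_zero hσ)).ne'),
    Real.log_prod (fun s _ => (gaussianPDFReal_pos _ _ _ (predVar_ne_zero hσ X s)).ne'),
    ← Finset.sum_sub_distrib]
  refine Finset.sum_congr rfl fun s _ => ?_
  have e2 : fixedObs f ε X s ω - postMean k σ s X (fun i => fixedObs f ε X i ω) (X s) =
      residual k σ f ε X s (X s) ω + ε s ω := by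
    rw [residual, fixedObs]
    ring
  rw [e2, log_gaussianPDFReal (toNNReal_sq_ne_zero hσ), log_gaussianPDFReal (predVar_ne_zero hσ X s),
    Real.coe_toNNReal _ (sq_nonneg σ)]
  ring

/-- The information gain of a design as a sum of logarithms of posterior variances. -/
theorem IsModel.infoGain_eq (h : IsModel P σ f ε z U) (hf : IsGPSample P k ρ a b f)
    (hσ : 0 < σ) (X : ℕ → Cube D) (T : ℕ) :
    infoGain P f σ (fun j : Fin T => X j) = ENNReal.ofReal
      (∑ s ∈ Finset.range T, Real.log (1 + postVar k σ s X (X s) / σ ^ 2) / 2) := by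
  have hV : Measurable fun ω (j : Fin T) => f (X j) ω :=
    measurable_pi_lambda _ fun j => hf.measurable _
  have hE : Measurable fun ω (j : Fin T) => ε j ω :=
    measurable_pi_lambda _ fun j => h.measurable_noise j
  have hY : Measurable fun ω (j : Fin T) => fixedObs f ε X j ω :=
    measurable_pi_lambda _ fun j => h.measurable_fixedObs hf X j
  have hr := hf.measurable_gainDensity hσ X T
  have hlawE : P.map (fun ω (j : Fin T) => ε j ω) =
      Measure.pi fun _ : Fin T => gaussianReal 0 (σ ^ 2).toNNReal := by
    rw [(iIndepFun_iff_map_fun_eq_pi_map fun j => (h.measurable_noise _).aemeasurable).1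
      (h.noise_indep.precomp (g := fun i : Fin T => (i : ℕ)) Fin.val_injective)]
    simp_rw [h.noise_law]
  have hind : IndepFun (fun ω (j : Fin T) => f (X j) ω) (fun ω (j : Fin T) => ε j ω) P :=
    (h.indepFun_path_noise hf).comp (φ := fun (g : C(Cube D, ℝ)) (j : Fin T) => g (X j))
      (ψ := fun (e : ℕ → ℝ) (j : Fin T) => e j)
      (measurable_pi_lambda _ fun i =>
        measurable_path_eval.comp (measurable_id.prodMk measurable_const))
      (measurable_pi_lambda _ fun i => measurable_pi_apply _)
  have hjoint : ((P.map fun ω (j : Fin T) => f (X j) ω).prod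
      (Measure.pi fun _ : Fin T => gaussianReal 0 (σ ^ 2).toNNReal)).map
        (fun p => (p.1, p.1 + p.2)) =
      P.map (fun ω => (fun j : Fin T => f (X j) ω, fun j : Fin T => fixedObs f ε X j ω)) := by
    rw [← hlawE, ← (indepFun_iff_map_prod_eq_prod_map_map hV.aemeasurable hE.aemeasurable).1 hind,
      Measure.map_map (by fun_prop) (hV.prodMk hE)]
    rfl
  set J := P.map (fun ω => (fun j : Fin T => f (X j) ω, fun j : Fin T => fixedObs f ε X j ω))
    with hJ
  have hJP : IsProbabilityMeasure J := Measure.isProbabilityMeasure_map (hV.prodMk hY).aemeasurable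
  have hfst : J.fst = P.map fun ω (j : Fin T) => f (X j) ω := by
    rw [hJ, Measure.fst_map_prodMk hY]
  have hsnd : J.snd = P.map fun ω (j : Fin T) => fixedObs f ε X j ω := by
    rw [hJ, Measure.snd_map_prodMk hV]
  have hdens : J = (J.fst.prod J.snd).withDensity (gainDensity k σ X T) := by
    rw [hfst, hsnd]
    exact h.map_joint_eq_withDensity hf hσ X T
  have hac : J ≪ J.fst.prod J.snd := by
    nth_rewrite 1 [hdens]
    exact withDensity_absolutelyContinuous _ _
  have hllr : llr J (J.fst.prod J.snd) =ᵐ[J] fun q => Real.log (gainDensity k σ X T q).toReal := by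
    have h1 := Measure.rnDeriv_withDensity (J.fst.prod J.snd) hr
    rw [← hdens] at h1
    filter_upwards [hac.ae_le h1] with q hq
    rw [llr, hq]
  have hintR : ∀ s, Integrable (fun ω => (residual k σ f ε X s (X s) ω + ε s ω) ^ 2) P := fun s =>
    ((h.memLp_residual hf hσ X s (X s)).add (h.memLp_noise s)).integrable_sq
  have hintE : ∀ s, Integrable (fun ω => ε s ω ^ 2) P := fun s => (h.memLp_noise s).integrable_sq
  have hlm : Measurable fun q => Real.log (gainDensity k σ X T q).toReal :=
    Real.measurable_log.comp hr.ennreal_toReal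
  have hint1 : ∀ s, Integrable (fun ω => ((Real.log (2 * Real.pi * predVar k σ X s) / 2 -
      Real.log (2 * Real.pi * (σ ^ 2)) / 2) + ((residual k σ f ε X s (X s) ω + ε s ω) ^ 2 /
        (2 * predVar k σ X s) - ε s ω ^ 2 / (2 * σ ^ 2)))) P := fun s =>
    (integrable_const _).add (((hintR s).div_const _).sub ((hintE s).div_const _))
  have hint : Integrable (llr J (J.fst.prod J.snd)) J := by
    rw [integrable_congr hllr, hJ, integrable_map_measure hlm.aestronglyMeasurable
      (hV.prodMk hY).aemeasurable]
    refine (integrable_finsetSum (Finset.range T) fun s _ => hint1 s).congr (ae_of_all _ fun ω => ?_)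
    exact (log_gainDensity hσ X T ω).symm
  have hgain : infoGain P f σ (fun j : Fin T => X j) =
      InformationTheory.klDiv J (J.fst.prod J.snd) := by
    rw [infoGain]
    rw [hjoint]
  rw [hgain, InformationTheory.klDiv_of_ac_of_integrable hac hint]
  congr 1
  rw [integral_congr_ae hllr, hJ, integral_map (hV.prodMk hY).aemeasurable
    hlm.aestronglyMeasurable, ← hJ, probReal_univ, probReal_univ, add_sub_cancel_right]
  simp_rw [log_gainDensity hσ X T]
  rw [integral_finsetSum _ fun s _ => hint1 s]
  refine Finset.sum_congr rfl fun s _ => ?_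
  have hpv : (0 : ℝ) < predVar k σ X s := NNReal.coe_pos.2 (pos_iff_ne_zero.2 (predVar_ne_zero hσ X s))
  have hsub : Integrable (fun ω => (residual k σ f ε X s (X s) ω + ε s ω) ^ 2 /
      (2 * predVar k σ X s) - ε s ω ^ 2 / (2 * σ ^ 2)) P :=
    ((hintR s).div_const _).sub ((hintE s).div_const _)
  rw [integral_add (integrable_const _) hsub, integral_sub ((hintR s).div_const _) ((hintE s).div_const _), integral_div, integral_div,
    h.integral_innovation_sq hf hσ, h.integral_noise_sq]
  have e3 : 1 + postVar k σ s X (X s) / σ ^ 2 =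
      (2 * Real.pi * predVar k σ X s) / (2 * Real.pi * (σ ^ 2)) := by
    rw [h.coe_predVar hf hσ]
    have := Real.pi_pos
    field_simp
    ring
  rw [e3, Real.log_div (by positivity) (by positivity)]
  simp only [integral_const, probReal_univ, one_smul]
  field_simp
  ring

end Gain

end

end LassoBO

namespace LassoBO

noncomputable section

open scoped ENNReal NNReal

set_option linter.unusedSectionVars false

/-! ### Posterior variance as a minimal prediction error -/

/-- The mean square error of the prediction of `f x` by the combination with weights `w` of the
observations. -/
def predError {D : ℕ} (k : Cube D → Cube D → ℝ) (σ : ℝ) {m : ℕ} (X : Fin m → Cube D)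
    (w : Fin m → ℝ) (x : Cube D) : ℝ :=
  k x x - 2 * ∑ i, w i * k x (X i) + ∑ i, ∑ j, w i * (w j * k (X i) (X j)) + σ ^ 2 * ∑ i, w i ^ 2

theorem predError_append {D : ℕ} (k : Cube D → Cube D → ℝ) (σ : ℝ) {m n : ℕ} (X : ℕ → Cube D)
    (w : Fin n → ℝ) (x : Cube D) :
    predError k σ (fun i : Fin (m + n) => X i) (Fin.append (fun _ : Fin m => (0 : ℝ)) w) x =
      predError k σ (fun i : Fin n => X (m + i)) w x := by
  simp [predError, Fin.sum_univ_add]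

section Variance

variable {D : ℕ} {Ω S : Type*} [mΩ : MeasurableSpace Ω] [mS : MeasurableSpace S] {P : Measure Ω}
  [IsProbabilityMeasure P] {k : Cube D → Cube D → ℝ} {ρ : Fin D → ℝ} {a b σ κ : ℝ}
  {f : Cube D → Ω → ℝ} {ε : ℕ → Ω → ℝ} {z : ℕ → ℕ → Ω → Cube D} {U : Ω → S}

theorem IsModel.variance_sub_sum_fixedObs (h : IsModel P σ f ε z U) (hf : IsGPSample P k ρ a b f)
    {m : ℕ} (X : ℕ → Cube D) (w : Fin m → ℝ) (x : Cube D) :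
    Var[fun ω => f x ω - ∑ i : Fin m, w i * fixedObs f ε X i ω; P] =
      predError k σ (fun i : Fin m => X i) w x := by
  have hs := h.memLp_sum_fixedObs hf X w
  rw [variance_fun_sub (hf.memLp x) hs, ← covariance_self (hf.measurable x).aemeasurable,
    ← covariance_self hs.aemeasurable, covariance_fun_sum_right (h.memLp_mul_fixedObs hf X w)
      (hf.memLp x), covariance_fun_sum_left (h.memLp_mul_fixedObs hf X w) hs, hf.cov_eq]
  simp_rw [covariance_fun_sum_right (h.memLp_mul_fixedObs hf X w) (h.memLp_mul_fixedObs hf X w _),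
    covariance_const_mul_right, covariance_const_mul_left, h.cov_fixedObs_right hf,
    h.cov_fixedObs hf]
  simp only [predError, mul_add, Finset.sum_add_distrib, Fin.val_inj, mul_ite, mul_zero,
    Finset.sum_ite_eq, Finset.mem_univ, if_true, Finset.mul_sum]
  rw [← add_assoc]
  congr 1
  · congr 1
    exact Finset.sum_congr rfl fun i _ => Finset.sum_congr rfl fun j _ => by ring
  · exact Finset.sum_congr rfl fun i _ => by ring

theorem IsModel.postVar_eq_predError (h : IsModel P σ f ε z U) (hf : IsGPSample P k ρ a b f)
    (hσ : 0 < σ) (X : ℕ → Cube D) (m : ℕ) (x : Cube D) :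
    postVar k σ m X x = predError k σ (fun i : Fin m => X i) (postWeights k σ m X x) x := by
  rw [← h.variance_sub_sum_fixedObs hf, ← IsModel.residual_eq hf hσ, h.variance_residual hf hσ]

theorem IsModel.postVar_le_predError (h : IsModel P σ f ε z U) (hf : IsGPSample P k ρ a b f)
    (hσ : 0 < σ) (X : ℕ → Cube D) (m : ℕ) (w : Fin m → ℝ) (x : Cube D) :
    postVar k σ m X x ≤ predError k σ (fun i : Fin m => X i) w x := by
  have hr := h.memLp_residual hf hσ X m x
  have hs := h.memLp_sum_fixedObs hf X fun i => postWeights k σ m X x i - w i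
  have e : (fun ω => f x ω - ∑ i : Fin m, w i * fixedObs f ε X i ω) = fun ω =>
      residual k σ f ε X m x ω +
        ∑ i : Fin m, (postWeights k σ m X x i - w i) * fixedObs f ε X i ω := by
    rw [IsModel.residual_eq hf hσ]
    funext ω
    simp only [sub_mul, Finset.sum_sub_distrib]
    ring
  rw [← h.variance_sub_sum_fixedObs hf, e, variance_fun_add hr hs, h.variance_residual hf hσ,
    covariance_fun_sum_right (h.memLp_mul_fixedObs hf X _) hr]
  simp only [covariance_const_mul_right, h.cov_residual_fixedObs hf hσ, mul_zero,
    Finset.sum_const_zero, add_zero]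
  have := variance_nonneg
    (fun ω => ∑ i : Fin m, (postWeights k σ m X x i - w i) * fixedObs f ε X i ω) P
  linarith

theorem IsModel.postVar_le_kernel (h : IsModel P σ f ε z U) (hf : IsGPSample P k ρ a b f)
    (hσ : 0 < σ) (X : ℕ → Cube D) (m : ℕ) (x : Cube D) : postVar k σ m X x ≤ k x x := by
  have := h.postVar_le_predError hf hσ X m 0 x
  simpa [predError] using this

/-- Additional data do not increase the posterior variance. -/
theorem IsModel.postVar_add_le (h : IsModel P σ f ε z U) (hf : IsGPSample P k ρ a b f)
    (hσ : 0 < σ) (X : ℕ → Cube D) (m n : ℕ) (x : Cube D) :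
    postVar k σ (m + n) X x ≤ postVar k σ n (fun i => X (m + i)) x := by
  rw [h.postVar_eq_predError hf hσ (fun i => X (m + i)), ← predError_append]
  exact h.postVar_le_predError hf hσ X (m + n) _ x

theorem IsModel.infoGain_le (h : IsModel P σ f ε z U) (hf : IsGPSample P k ρ a b f)
    (hσ : 0 < σ) (hk : ∀ x, k x x ≤ κ) {T : ℕ} (A : Fin T → Cube D) :
    infoGain P f σ A ≤ ENNReal.ofReal (∑ _s ∈ Finset.range T, Real.log (1 + κ / σ ^ 2) / 2) := by
  let X : ℕ → Cube D := fun i => if hi : i < T then A ⟨i, hi⟩ else fun _ => 0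
  have hA : A = fun j : Fin T => X j := by
    funext j
    simp [X]
  rw [hA, h.infoGain_eq hf hσ]
  refine ENNReal.ofReal_le_ofReal (Finset.sum_le_sum fun s _ => ?_)
  have h0 := h.postVar_nonneg hf hσ X s (X s)
  have h1 := (h.postVar_le_kernel hf hσ X s (X s)).trans (hk _)
  gcongr

/-- The information gain of any design is at most the maximum information gain. -/
theorem IsModel.sum_log_le_maxInfoGain (h : IsModel P σ f ε z U) (hf : IsGPSample P k ρ a b f)
    (hσ : 0 < σ) (hk : ∀ x, k x x ≤ κ) (X : ℕ → Cube D) (T : ℕ) :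
    ∑ s ∈ Finset.range T, Real.log (1 + postVar k σ s X (X s) / σ ^ 2) / 2 ≤
      maxInfoGain P f σ T := by
  have h1 : infoGain P f σ (fun j : Fin T => X j) ≤ ⨆ A : Fin T → Cube D, infoGain P f σ A :=
    le_iSup (fun A : Fin T → Cube D => infoGain P f σ A) _
  have h2 : ⨆ A : Fin T → Cube D, infoGain P f σ A ≠ ∞ :=
    ne_top_of_le_ne_top ENNReal.ofReal_ne_top (iSup_le fun A => h.infoGain_le hf hσ hk A)
  have h3 := ENNReal.toReal_mono h2 h1
  rw [h.infoGain_eq hf hσ] at h3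
  exact (ENNReal.toReal_ofReal_eq_iff.2 (Finset.sum_nonneg fun s _ => by
    have := h.postVar_nonneg hf hσ X s (X s)
    have : 0 ≤ Real.log (1 + postVar k σ s X (X s) / σ ^ 2) :=
      Real.log_nonneg (by linarith [show 0 ≤ postVar k σ s X (X s) / σ ^ 2 by positivity])
    positivity)).symm.trans_le h3

theorem mul_log_one_add_le {v κ s : ℝ} (hv : 0 ≤ v) (hvκ : v ≤ κ) (hκ : 0 < κ) (hs : 0 < s) :
    v * Real.log (1 + κ / s) ≤ κ * Real.log (1 + v / s) := by
  have h1 : (1 : ℝ) ∈ Set.Ioi (0 : ℝ) := Set.mem_Ioi.2 one_pos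
  have h2 : 1 + κ / s ∈ Set.Ioi (0 : ℝ) := Set.mem_Ioi.2 (by positivity)
  have h3 : 0 ≤ 1 - v / κ := by rw [sub_nonneg, div_le_one hκ]; exact hvκ
  have h4 : 0 ≤ v / κ := by positivity
  have hc := strictConcaveOn_log_Ioi.concaveOn.2 h1 h2 h3 h4 (by ring)
  have e : (1 - v / κ) • (1 : ℝ) + (v / κ) • (1 + κ / s) = 1 + v / s := by
    simp only [smul_eq_mul]
    field_simp
    ring
  rw [e, Real.log_one, smul_zero, zero_add, smul_eq_mul, div_mul_eq_mul_div, div_le_iff₀ hκ] at hc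
  linarith

/-- The posterior variances along any sequence of points are controlled by the maximum information
gain of the last `T` of them. -/
theorem IsModel.sum_postVar_le (h : IsModel P σ f ε z U) (hf : IsGPSample P k ρ a b f)
    (hσ : 0 < σ) (hκ : 0 < κ) (hk : ∀ x, k x x ≤ κ) (X : ℕ → Cube D) (N₀ T : ℕ) :
    4 * ∑ s ∈ Finset.range T, postVar k σ (N₀ + s) X (X (N₀ + s)) ≤
      C₁ κ σ * maxInfoGain P f σ T := by
  have hσ2 : 0 < σ ^ 2 := by positivity
  have hlog : 0 < Real.log (1 + κ / σ ^ 2) := Real.log_pos (by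
    linarith [show 0 < κ / σ ^ 2 by positivity])
  have hC : 0 ≤ C₁ κ σ := by
    unfold C₁
    positivity
  refine le_trans ?_ (mul_le_mul_of_nonneg_left
    (h.sum_log_le_maxInfoGain hf hσ hk (fun i => X (N₀ + i)) T) hC)
  rw [Finset.mul_sum, Finset.mul_sum]
  refine Finset.sum_le_sum fun s _ => ?_
  have h1 := h.postVar_add_le hf hσ X N₀ s (X (N₀ + s))
  have h2 := h.postVar_nonneg hf hσ (fun i => X (N₀ + i)) s (X (N₀ + s))
  have h3 := (h.postVar_le_kernel hf hσ (fun i => X (N₀ + i)) s (X (N₀ + s))).trans (hk _)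
  have h4 := mul_log_one_add_le h2 h3 hκ hσ2
  set v := postVar k σ s (fun i => X (N₀ + i)) (X (N₀ + s))
  have h5 : v ≤ κ / Real.log (1 + κ / σ ^ 2) * Real.log (1 + v / σ ^ 2) := by
    rw [div_mul_eq_mul_div, le_div_iff₀ hlog]
    exact h4
  have h6 : C₁ κ σ * (Real.log (1 + v / σ ^ 2) / 2) =
      4 * (κ / Real.log (1 + κ / σ ^ 2) * Real.log (1 + v / σ ^ 2)) := by
    unfold C₁
    ring
  rw [h6]
  linarith

end Variance

end

end LassoBO

namespace LassoBO

noncomputable section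

open scoped ENNReal NNReal

set_option linter.unusedSectionVars false

/-! ### Lipschitz continuity of sample paths -/

/-- `g` is Lipschitz in each coordinate, with constant `ℓ √(ρ i)` in the coordinate `i`. -/
def CoordLip {D : ℕ} (ρ : Fin D → ℝ) (ℓ : ℝ) (g : Cube D → ℝ) : Prop :=
  ∀ x y : Cube D, |g x - g y| ≤ ℓ * ∑ i, √(ρ i) * |(x i : ℝ) - y i|

/-- `g` is Lipschitz in the coordinate `i` with constant `c`. -/
def LipAlong {D : ℕ} (i : Fin D) (c : ℝ) (g : Cube D → ℝ) : Prop :=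
  ∀ (x : Cube D) (s : unitInterval), |g (Function.update x i s) - g x| ≤ c * |(s : ℝ) - x i|

theorem coordLip_of_lipAlong {D : ℕ} {ρ : Fin D → ℝ} {ℓ : ℝ} {g : Cube D → ℝ}
    (h : ∀ i, LipAlong i (√(ρ i) * ℓ) g) : CoordLip ρ ℓ g := by
  intro x y
  have key : ∀ s : Finset (Fin D), |g (s.piecewise x y) - g y| ≤
      ℓ * ∑ i ∈ s, √(ρ i) * |(x i : ℝ) - y i| := by
    intro s
    induction s using Finset.induction_on with
    | empty => simp
    | insert j s hj ih =>
      rw [Finset.piecewise_insert, Finset.sum_insert hj]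
      have h1 := h j (s.piecewise x y) (x j)
      rw [Finset.piecewise_eq_of_notMem _ _ _ hj] at h1
      have h2 := abs_sub_le (g (Function.update (s.piecewise x y) j (x j))) (g (s.piecewise x y))
        (g y)
      linarith
  simpa using key Finset.univ

theorem lipAlong_of_supPartialLT {D : ℕ} {g : Cube D → ℝ} {i : Fin D} {c : ℝ}
    (hd : ∀ x : Cube D, DifferentiableWithinAt ℝ (alongCoord g i x) (Set.Icc 0 1) (x i : ℝ))
    (h : SupPartialLT g i c) : LipAlong i c g := by
  obtain ⟨m, hm, hb⟩ := h
  intro x s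
  have hal : ∀ r : unitInterval, alongCoord g i (Function.update x i r) = alongCoord g i x := by
    intro r
    funext u
    simp [alongCoord]
  have hdo : DifferentiableOn ℝ (alongCoord g i x) (Set.Icc 0 1) := by
    intro r hr
    have := hd (Function.update x i ⟨r, hr⟩)
    rw [hal] at this
    simpa using this
  have hbd : ∀ r ∈ Set.Icc (0 : ℝ) 1, ‖derivWithin (alongCoord g i x) (Set.Icc 0 1) r‖ ≤ c := by
    intro r hr
    have := hb (Function.update x i ⟨r, hr⟩)
    rw [partialD, hal] at this
    simpa using this.trans hm.le
  have := (convex_Icc (0 : ℝ) 1).norm_image_sub_le_of_norm_derivWithin_le hdo hbd (x i).2 s.2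
  simpa [alongCoord, Real.norm_eq_abs] using this

section Paths

variable {D : ℕ} {Ω : Type*} [mΩ : MeasurableSpace Ω] {P : Measure Ω}
  [IsProbabilityMeasure P] {k : Cube D → Cube D → ℝ} {ρ : Fin D → ℝ} {a b : ℝ}
  {f : Cube D → Ω → ℝ}

theorem IsGPSample.measurableSet_lipAlong (hf : IsGPSample P k ρ a b f) (i : Fin D) (c : ℝ) :
    MeasurableSet {ω | LipAlong i c fun x => f x ω} := by
  have hcl : IsClosed {g : C(Cube D, ℝ) | LipAlong i c g} := by
    simp only [LipAlong, Set.ofPred_forall]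
    refine isClosed_iInter fun x => isClosed_iInter fun s => ?_
    exact isClosed_le (((continuous_eval_const _).sub
      (continuous_eval_const _)).abs) continuous_const
  exact hf.measurable_path hcl.measurableSet

theorem IsGPSample.le_measureReal_lipAlong (hf : IsGPSample P k ρ a b f) (ha : 0 < a) (i : Fin D)
    {L : ℝ} (hL : 0 ≤ L) : 1 - a * Real.exp (-(L / b) ^ 2) ≤
      P.real {ω | LipAlong i (√(ρ i) * L) fun x => f x ω} := by
  have hpos : ∀ L : ℝ, 0 < L → 1 - a * Real.exp (-(L / b) ^ 2) ≤
      P.real {ω | LipAlong i (√(ρ i) * L) fun x => f x ω} := fun L hL =>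
    (hf.tail i L hL).trans (measureReal_mono fun ω hω =>
      lipAlong_of_supPartialLT (fun x => hf.differentiable ω i x) hω)
  rcases hL.lt_or_eq with h | rfl
  · exact hpos L h
  · have hanti : Antitone fun n : ℕ =>
        {ω | LipAlong i (√(ρ i) * (1 / ((n : ℝ) + 1))) fun x => f x ω} := by
      intro n n' hn ω hω x s
      refine (hω x s).trans ?_
      gcongr
    have hInter : ⋂ n : ℕ, {ω | LipAlong i (√(ρ i) * (1 / ((n : ℝ) + 1))) fun x => f x ω} ⊆
        {ω | LipAlong i (√(ρ i) * 0) fun x => f x ω} := by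
      intro ω hω x s
      have h1 : ∀ n : ℕ, |f (Function.update x i s) ω - f x ω| ≤
          √(ρ i) * (1 / ((n : ℝ) + 1)) * |(s : ℝ) - x i| := fun n => Set.mem_iInter.1 hω n x s
      have h2 : Tendsto (fun n : ℕ => √(ρ i) * (1 / ((n : ℝ) + 1)) * |(s : ℝ) - x i|) atTop
          (𝓝 (√(ρ i) * 0 * |(s : ℝ) - x i|)) :=
        (tendsto_one_div_add_atTop_nhds_zero_nat.const_mul _).mul_const _
      exact ge_of_tendsto' h2 h1
    have ht := tendsto_measure_iInter_atTop (μ := P)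
      (fun n : ℕ => (hf.measurableSet_lipAlong i (√(ρ i) * (1 / ((n : ℝ) + 1)))).nullMeasurableSet)
      hanti ⟨0, measure_ne_top _ _⟩
    have ht' := (ENNReal.tendsto_toReal (measure_ne_top _ _)).comp ht
    refine (ge_of_tendsto' ht' fun n => ?_).trans (measureReal_mono hInter)
    refine le_trans ?_ (hpos (1 / ((n : ℝ) + 1)) (by positivity))
    have : Real.exp (-(1 / ((n : ℝ) + 1) / b) ^ 2) ≤ Real.exp (-(0 / b) ^ 2) := by
      refine Real.exp_le_exp.2 ?_
      have := sq_nonneg (1 / ((n : ℝ) + 1) / b)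
      simpa using this
    nlinarith

/-- With probability at least `1 - δ / c`, the sample path is Lipschitz with constant
`b √(log (c D a / δ))`. -/
theorem IsGPSample.measure_not_coordLip_le (hf : IsGPSample P k ρ a b f) (ha : 0 < a) (hb : 0 < b)
    {δ c : ℝ} (hδ : 0 < δ) (hc : 0 < c) (hD : 0 < D) :
    P {ω | CoordLip ρ (b * √(Real.log (c * D * a / δ))) fun x => f x ω}ᶜ ≤
      ENNReal.ofReal (δ / c) := by
  set L := b * √(Real.log (c * D * a / δ)) with hL
  have hD' : (0 : ℝ) < D := by exact_mod_cast hD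
  have hexp : a * Real.exp (-(L / b) ^ 2) ≤ δ / (c * D) := by
    have e : L / b = √(Real.log (c * D * a / δ)) := by rw [hL]; field_simp
    rw [e]
    rcases le_total 0 (Real.log (c * D * a / δ)) with h0 | h0
    · rw [Real.sq_sqrt h0, Real.exp_neg, Real.exp_log (by positivity)]
      refine le_of_eq ?_
      field_simp
    · rw [Real.sqrt_eq_zero_of_nonpos h0]
      have := (Real.log_nonpos_iff (by positivity)).1 h0
      rw [div_le_one hδ] at this
      rw [le_div_iff₀ (by positivity)]
      simp
      linarith
  have hsub : {ω | CoordLip ρ L fun x => f x ω}ᶜ ⊆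
      ⋃ i, {ω | LipAlong i (√(ρ i) * L) fun x => f x ω}ᶜ := by
    intro ω hω
    by_contra hcon
    simp only [Set.mem_iUnion, Set.mem_compl_iff, not_exists, not_not] at hcon
    exact hω (coordLip_of_lipAlong hcon)
  calc P {ω | CoordLip ρ L fun x => f x ω}ᶜ
      ≤ ∑ i, P {ω | LipAlong i (√(ρ i) * L) fun x => f x ω}ᶜ :=
        (measure_mono hsub).trans (measure_iUnion_fintype_le _ _)
    _ ≤ ∑ _i : Fin D, ENNReal.ofReal (δ / (c * D)) := by
        refine Finset.sum_le_sum fun i _ => ?_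
        have hm := hf.measurableSet_lipAlong i (√(ρ i) * L)
        rw [← ofReal_measureReal, probReal_compl_eq_one_sub hm]
        refine ENNReal.ofReal_le_ofReal ?_
        have := hf.le_measureReal_lipAlong ha i (show 0 ≤ L by positivity)
        linarith
    _ = ENNReal.ofReal (δ / c) := by
        rw [Finset.sum_const, Finset.card_univ, Fintype.card_fin, ← ENNReal.ofReal_nsmul]
        congr 1
        rw [nsmul_eq_mul]
        field_simp

end Paths

end

end LassoBO

namespace LassoBO

noncomputable section

open scoped ENNReal NNReal

set_option linter.unusedSectionVars false

/-! ### Measurability of a run of the algorithm -/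

section Run

variable {D : ℕ} {Ω S : Type*} [mΩ : MeasurableSpace Ω] [mS : MeasurableSpace S] {P : Measure Ω}
  [IsProbabilityMeasure P] {k : Cube D → Cube D → ℝ} {ρ : Fin D → ℝ} {a b σ δ : ℝ} {n N₀ : ℕ}
  {f : Cube D → Ω → ℝ} {ε : ℕ → Ω → ℝ} {z : ℕ → ℕ → Ω → Cube D} {U : Ω → S}
  {pt : ℕ → Ω → Cube D} {I : ℕ → Ω → Finset (Fin D)} {inc : ℕ → Ω → ℕ}

/-- The σ-algebra of the side information and the first `m` observations. -/
abbrev histAlg (f : Cube D → Ω → ℝ) (ε : ℕ → Ω → ℝ) (z : ℕ → ℕ → Ω → Cube D) (U : Ω → S)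
    (pt : ℕ → Ω → Cube D) (m : ℕ) : MeasurableSpace Ω :=
  MeasurableSpace.comap (history f ε z U pt m) inferInstance

theorem measurable_history_self (m : ℕ) :
    Measurable[histAlg f ε z U pt m] (history f ε z U pt m) :=
  comap_measurable _

theorem comap_seed_le_histAlg (m : ℕ) :
    MeasurableSpace.comap U inferInstance ≤ histAlg f ε z U pt m :=
  (measurable_snd.comp (measurable_fst.comp (measurable_history_self m))).comap_le

theorem measurable_sample_histAlg (m t j : ℕ) : Measurable[histAlg f ε z U pt m] (z t j) :=
  (measurable_pi_apply j).comp ((measurable_pi_apply t).comp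
    (measurable_fst.comp (measurable_fst.comp (measurable_history_self m))))

theorem measurable_obs_histAlg {s m : ℕ} (hs : s < m) :
    Measurable[histAlg f ε z U pt m] (obs f ε pt s) := by
  have h1 : obs f ε pt s = fun ω => (history f ε z U pt m ω).2 s := by
    funext ω
    simp [history, trunc, hs]
  rw [h1]
  exact (measurable_pi_apply s).comp (measurable_snd.comp (measurable_history_self m))

theorem pastInfo_le_histAlg (t : ℕ) :
    pastInfo N₀ U (obs f ε pt) z t ⊔ ⨆ j, MeasurableSpace.comap (z t j) inferInstance ≤
      histAlg f ε z U pt (N₀ + (t - 1)) := by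
  refine sup_le (sup_le (sup_le (comap_seed_le_histAlg _) ?_) ?_) ?_
  · exact iSup₂_le fun s hs => (measurable_obs_histAlg (Finset.mem_range.1 hs)).comap_le
  · exact iSup₂_le fun s _ => iSup_le fun j => (measurable_sample_histAlg _ s j).comap_le
  · exact iSup_le fun j => (measurable_sample_histAlg _ t j).comap_le

theorem IsRun.isAdaptive (h : IsRun k σ ρ a b δ n N₀ f ε z U pt I inc) : IsAdaptive f ε z U pt := by
  intro s
  rcases lt_or_ge s N₀ with hs | hs
  · exact (h.init_measurable s hs).mono (comap_seed_le_histAlg s) le_rfl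
  · obtain ⟨t, rfl⟩ := Nat.exists_eq_add_of_le hs
    exact (h.pt_measurable (t + 1) (by omega)).mono (pastInfo_le_histAlg (t + 1)) le_rfl

theorem pastInfo_mono {y : ℕ → Ω → ℝ} {t t' : ℕ} (h : t ≤ t') :
    pastInfo N₀ U y z t ≤ pastInfo N₀ U y z t' := by
  refine sup_le_sup (sup_le_sup_left ?_ _) ?_
  · exact biSup_mono fun s hs => Finset.mem_range.2 ((Finset.mem_range.1 hs).trans_le (by omega))
  · exact biSup_mono fun s hs =>
      Finset.mem_Ico.2 ⟨(Finset.mem_Ico.1 hs).1, (Finset.mem_Ico.1 hs).2.trans_le h⟩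

/-- The objective, the noise, the seed and the samples of the rounds before `t`. -/
abbrev nonSampleInfo (f : Cube D → Ω → ℝ) (hf : IsGPSample P k ρ a b f) (ε : ℕ → Ω → ℝ)
    (z : ℕ → ℕ → Ω → Cube D) (U : Ω → S) (t : ℕ) : MeasurableSpace Ω :=
  (⨆ s ∈ Finset.Ico 1 t, ⨆ j, MeasurableSpace.comap (z s j) inferInstance) ⊔
    (MeasurableSpace.comap U inferInstance ⊔
      (MeasurableSpace.comap (fun ω s => ε s ω) inferInstance ⊔
        MeasurableSpace.comap hf.path inferInstance))

theorem measurable_path_nonSampleInfo (hf : IsGPSample P k ρ a b f) (t : ℕ) :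
    Measurable[nonSampleInfo f hf ε z U t] hf.path :=
  (comap_measurable hf.path).mono (le_sup_of_le_right (le_sup_of_le_right le_sup_right)) le_rfl

theorem measurable_noise_nonSampleInfo (hf : IsGPSample P k ρ a b f) (t s : ℕ) :
    Measurable[nonSampleInfo f hf ε z U t] (ε s) :=
  ((measurable_pi_apply (X := fun _ : ℕ => ℝ) s).comp (comap_measurable fun ω s => ε s ω)).mono
    (le_sup_of_le_right (le_sup_of_le_right le_sup_left)) le_rfl

theorem comap_seed_le_nonSampleInfo (hf : IsGPSample P k ρ a b f) (t : ℕ) :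
    MeasurableSpace.comap U inferInstance ≤ nonSampleInfo f hf ε z U t :=
  le_sup_of_le_right le_sup_left

theorem comap_sample_le_nonSampleInfo (hf : IsGPSample P k ρ a b f) {s t : ℕ} (h1 : 1 ≤ s)
    (h2 : s < t) (j : ℕ) :
    MeasurableSpace.comap (z s j) inferInstance ≤ nonSampleInfo f hf ε z U t :=
  le_sup_of_le_left ((le_iSup (fun j => MeasurableSpace.comap (z s j) inferInstance) j).trans
    (le_biSup (fun s => ⨆ j, MeasurableSpace.comap (z s j) inferInstance)
      (Finset.mem_Ico.2 ⟨h1, h2⟩)))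

theorem measurable_obs_of {m : MeasurableSpace Ω} {Φ : Ω → C(Cube D, ℝ)}
    (hΦ : ∀ ω x, Φ ω x = f x ω) {s : ℕ} (h1 : Measurable[m] Φ) (h2 : Measurable[m] (pt s))
    (h3 : Measurable[m] (ε s)) : Measurable[m] (obs f ε pt s) := by
  have e : obs f ε pt s = fun ω => Φ ω (pt s ω) + ε s ω := by
    funext ω
    rw [hΦ, obs]
  rw [e]
  exact (measurable_path_eval.comp (h1.prodMk h2)).add h3

theorem IsRun.measurable_obs_nonSampleInfo (h : IsRun k σ ρ a b δ n N₀ f ε z U pt I inc)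
    (hf : IsGPSample P k ρ a b f) (s : ℕ) : ∀ t ≥ 1, s < N₀ + (t - 1) →
      Measurable[nonSampleInfo f hf ε z U t] (obs f ε pt s) := by
  induction s using Nat.strong_induction_on with
  | _ s ih =>
    intro t ht hs
    refine measurable_obs_of (hf.path_apply) (measurable_path_nonSampleInfo hf t) ?_
      (measurable_noise_nonSampleInfo hf t s)
    rcases lt_or_ge s N₀ with hs' | hs'
    · exact (h.init_measurable s hs').mono (comap_seed_le_nonSampleInfo hf t) le_rfl
    · obtain ⟨r, rfl⟩ := Nat.exists_eq_add_of_le hs'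
      refine (h.pt_measurable (r + 1) (by omega)).mono ?_ le_rfl
      refine sup_le (sup_le (sup_le (comap_seed_le_nonSampleInfo hf t) ?_) ?_) ?_
      · exact iSup₂_le fun i hi => (ih i (by simpa using hi) t ht
          (by have := Finset.mem_range.1 hi; omega)).comap_le
      · exact iSup₂_le fun i hi => iSup_le fun j => by
          have := Finset.mem_Ico.1 hi
          exact comap_sample_le_nonSampleInfo hf (by omega) (by omega) j
      · exact iSup_le fun j => comap_sample_le_nonSampleInfo hf (by omega) (by omega) j

theorem IsRun.pastInfo_le_nonSampleInfo (h : IsRun k σ ρ a b δ n N₀ f ε z U pt I inc)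
    (hf : IsGPSample P k ρ a b f) {t : ℕ} (ht : 1 ≤ t) :
    pastInfo N₀ U (obs f ε pt) z t ≤ nonSampleInfo f hf ε z U t := by
  refine sup_le (sup_le (comap_seed_le_nonSampleInfo hf t) ?_) le_sup_left
  exact iSup₂_le fun s hs =>
    (h.measurable_obs_nonSampleInfo hf s t ht (Finset.mem_range.1 hs)).comap_le

/-- The samples of round `t` are independent of everything else. -/
theorem IsModel.indep_sample_nonSampleInfo (h : IsModel P σ f ε z U) (hf : IsGPSample P k ρ a b f)
    (t : ℕ) : Indep (⨆ j, MeasurableSpace.comap (z t j) inferInstance)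
      (nonSampleInfo f hf ε z U t) P := by
  have hz : ∀ s j, MeasurableSpace.comap (z s j) inferInstance ≤ mΩ := fun s j =>
    (h.measurable_sample s j).comap_le
  have hzt : ⨆ j, MeasurableSpace.comap (z t j) inferInstance ≤ mΩ := iSup_le fun j => hz t j
  have hpast : ⨆ s ∈ Finset.Ico 1 t, ⨆ j, MeasurableSpace.comap (z s j) inferInstance ≤ mΩ :=
    iSup₂_le fun s _ => iSup_le fun j => hz s j
  have hU : MeasurableSpace.comap U inferInstance ≤ mΩ := h.measurable_seed.comap_le
  have hε : MeasurableSpace.comap (fun ω s => ε s ω) inferInstance ≤ mΩ :=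
    (measurable_pi_lambda _ h.measurable_noise).comap_le
  have hall : ∀ s j, MeasurableSpace.comap (z s j) inferInstance ≤
      MeasurableSpace.comap (fun ω t j => z t j ω) inferInstance := fun s j =>
    ((measurable_pi_apply j).comp ((measurable_pi_apply s).comp
      (comap_measurable fun ω t j => z t j ω))).comap_le
  have i1 : Indep (⨆ j, MeasurableSpace.comap (z t j) inferInstance)
      (⨆ s ∈ Finset.Ico 1 t, ⨆ j, MeasurableSpace.comap (z s j) inferInstance) P := by
    have := indep_iSup_of_disjoint (fun p : ℕ × ℕ => hz p.1 p.2) h.sample_indep.iIndep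
      (S := {p | p.1 = t}) (T := {p | p.1 ∈ Finset.Ico 1 t}) (by
        rw [Set.disjoint_left]
        rintro p hp hp'
        simp only [Set.mem_ofPred_eq] at hp hp'
        rw [hp] at hp'
        simp at hp')
    refine indep_of_indep_of_le this (iSup_le fun j => ?_)
      (iSup₂_le fun s hs => iSup_le fun j => ?_)
    · exact le_iSup₂_of_le (f := fun (p : ℕ × ℕ) (_ : p ∈ {p : ℕ × ℕ | p.1 = t}) =>
        MeasurableSpace.comap (z p.1 p.2) inferInstance) (t, j) rfl le_rfl
    · exact le_iSup₂_of_le (f := fun (p : ℕ × ℕ) (_ : p ∈ {p : ℕ × ℕ | p.1 ∈ Finset.Ico 1 t}) =>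
        MeasurableSpace.comap (z p.1 p.2) inferInstance) (s, j) hs le_rfl
  have hzU : MeasurableSpace.comap (fun ω t j => z t j ω) inferInstance ≤
      MeasurableSpace.comap (fun ω => (fun t j => z t j ω, U ω)) inferInstance :=
    (measurable_fst.comp (comap_measurable fun ω => (fun t j => z t j ω, U ω))).comap_le
  have hUU : MeasurableSpace.comap U inferInstance ≤
      MeasurableSpace.comap (fun ω => (fun t j => z t j ω, U ω)) inferInstance :=
    (measurable_snd.comp (comap_measurable fun ω => (fun t j => z t j ω, U ω))).comap_le
  have hεzU : MeasurableSpace.comap (fun ω => (fun t j => z t j ω, U ω)) inferInstance ≤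
      MeasurableSpace.comap (fun ω => (fun s => ε s ω, fun t j => z t j ω, U ω)) inferInstance :=
    (measurable_snd.comp (comap_measurable
      fun ω => (fun s => ε s ω, fun t j => z t j ω, U ω))).comap_le
  have hεε : MeasurableSpace.comap (fun ω s => ε s ω) inferInstance ≤
      MeasurableSpace.comap (fun ω => (fun s => ε s ω, fun t j => z t j ω, U ω)) inferInstance :=
    (measurable_fst.comp (comap_measurable
      fun ω => (fun s => ε s ω, fun t j => z t j ω, U ω))).comap_le
  have hzle : ∀ s, ⨆ j, MeasurableSpace.comap (z s j) inferInstance ≤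
      MeasurableSpace.comap (fun ω t j => z t j ω) inferInstance := fun s => iSup_le fun j => hall s j
  have hple : ⨆ s ∈ Finset.Ico 1 t, ⨆ j, MeasurableSpace.comap (z s j) inferInstance ≤
      MeasurableSpace.comap (fun ω t j => z t j ω) inferInstance := iSup₂_le fun s _ => hzle s
  have j1 := indep_of_indep_of_le_left h.indep_sample (sup_le (hzle t) hple)
  have j2 := indep_of_indep_of_le_left h.indep_noise.symm
    (sup_le (sup_le ((hzle t).trans hzU) (hple.trans hzU)) hUU)
  have j3 := indep_of_indep_of_le_right (indep_of_indep_of_le_left h.indep_f.symm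
    (sup_le (sup_le (sup_le ((hzle t).trans (hzU.trans hεzU)) (hple.trans (hzU.trans hεzU)))
      (hUU.trans hεzU)) hεε)) hf.comap_path_le
  refine indep_sup_assoc hzt hpast (sup_le hU (sup_le hε hf.measurable_path.comap_le)) i1 ?_
  refine indep_sup_assoc (sup_le hzt hpast) hU (sup_le hε hf.measurable_path.comap_le) j1 ?_
  exact indep_sup_assoc (sup_le (sup_le hzt hpast) hU) hε hf.measurable_path.comap_le j2 j3

end Run

/-! ### Approximate maximizers -/

theorem exists_dense_near_max {D : ℕ} {η : ℝ} (hη : 0 < η) (g : C(Cube D, ℝ)) :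
    ∃ i : ℕ, ∀ j : ℕ, g (TopologicalSpace.denseSeq (Cube D) j) ≤
      g (TopologicalSpace.denseSeq (Cube D) i) + η := by
  obtain ⟨x, -, hx⟩ := isCompact_univ.exists_isMaxOn (Set.univ_nonempty (α := Cube D))
    g.continuous.continuousOn
  have hopen : IsOpen {y | g x - η < g y} := isOpen_lt continuous_const g.continuous
  obtain ⟨i, hi⟩ := (TopologicalSpace.denseRange_denseSeq (Cube D)).exists_mem_open hopen
    ⟨x, by simp [hη]⟩
  refine ⟨i, fun j => ?_⟩
  have h1 : g x - η < g (TopologicalSpace.denseSeq (Cube D) i) := hi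
  have h2 : g (TopologicalSpace.denseSeq (Cube D) j) ≤ g x := hx (Set.mem_univ _)
  linarith

open scoped Classical in
/-- A point of a fixed dense sequence at which `g` is maximal up to `η`. -/
def nearArgmax {D : ℕ} {η : ℝ} (hη : 0 < η) (g : C(Cube D, ℝ)) : Cube D :=
  TopologicalSpace.denseSeq (Cube D) (Nat.find (exists_dense_near_max hη g))

theorem le_nearArgmax {D : ℕ} {η : ℝ} (hη : 0 < η) (g : C(Cube D, ℝ)) (x : Cube D) :
    g x ≤ g (nearArgmax hη g) + η := by
  classical
  have h1 := Nat.find_spec (exists_dense_near_max hη g)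
  have hcl : IsClosed {y | g y ≤ g (nearArgmax hη g) + η} :=
    isClosed_le g.continuous continuous_const
  have h2 : Set.range (TopologicalSpace.denseSeq (Cube D)) ⊆
      {y | g y ≤ g (nearArgmax hη g) + η} := by
    rintro _ ⟨j, rfl⟩
    simp only [nearArgmax, Set.mem_ofPred_eq]
    convert! h1 j
  exact closure_minimal h2 hcl (TopologicalSpace.denseRange_denseSeq (Cube D) x)

theorem measurable_nearArgmax {D : ℕ} {η : ℝ} (hη : 0 < η) :
    Measurable (nearArgmax (D := D) hη) := by
  classical
  have hev : ∀ x : Cube D, Measurable fun g : C(Cube D, ℝ) => g x := fun x =>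
    measurable_path_eval.comp (measurable_id.prodMk measurable_const)
  refine measurable_from_nat.comp (measurable_find _ fun i => ?_)
  simp only [Set.ofPred_forall]
  exact MeasurableSet.iInter fun j => measurableSet_le (hev _) ((hev _).add_const _)

end

end LassoBO

namespace LassoBO

noncomputable section

open scoped ENNReal NNReal

set_option linter.unusedSectionVars false

/-! ### Distance from the uniform samples to a point -/

theorem ofReal_le_volume_abs_sub_le (x : unitInterval) {r : ℝ} (h0 : 0 ≤ r) (h1 : r ≤ 1) :
    ENNReal.ofReal r ≤ volume {u : unitInterval | |(u : ℝ) - x| ≤ r} := by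
  have hx0 := x.2.1
  have hx1 := x.2.2
  let lo : unitInterval := ⟨max (x - r) 0, le_max_right _ _, max_le (by linarith) zero_le_one⟩
  let hi : unitInterval := ⟨min (x + r) 1, le_min (by linarith) zero_le_one, min_le_right _ _⟩
  have hsub : Set.Icc lo hi ⊆ {u : unitInterval | |(u : ℝ) - x| ≤ r} := by
    rintro u ⟨hu1, hu2⟩
    have h3 : max ((x : ℝ) - r) 0 ≤ u := hu1
    have h4 : (u : ℝ) ≤ min ((x : ℝ) + r) 1 := hu2
    have h5 : (x : ℝ) - r ≤ u := (le_max_left _ _).trans h3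
    have h6 : (u : ℝ) ≤ x + r := h4.trans (min_le_left _ _)
    rw [Set.mem_ofPred_eq, abs_le]
    exact ⟨by linarith, by linarith⟩
  refine le_trans ?_ (measure_mono hsub)
  rw [unitInterval.volume_Icc]
  refine ENNReal.ofReal_le_ofReal ?_
  change r ≤ min ((x : ℝ) + r) 1 - max ((x : ℝ) - r) 0
  rcases min_cases ((x : ℝ) + r) 1 with ⟨h, _⟩ | ⟨h, _⟩ <;>
    rcases max_cases ((x : ℝ) - r) 0 with ⟨h', _⟩ | ⟨h', _⟩ <;> rw [h, h'] <;> linarith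

/-- The distance from `w` to `x` in the coordinates outside `J`. -/
def offDist {D : ℕ} (J : Finset (Fin D)) (x w : Cube D) : ℝ≥0 :=
  Jᶜ.sup fun i => nndist (w i) (x i)

/-- The distance from `x` to the nearest of the points `w 0, …, w (M-1)` in the coordinates
outside `J`. -/
def sampleDist {D : ℕ} (J : Finset (Fin D)) (x : Cube D) (M : ℕ) (w : ℕ → Cube D) : ℝ :=
  ((⨅ j : Fin M, offDist J x (w j) : ℝ≥0) : ℝ)

theorem abs_sub_le_offDist {D : ℕ} {J : Finset (Fin D)} (x w : Cube D) {i : Fin D} (hi : i ∉ J) :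
    |(w i : ℝ) - x i| ≤ offDist J x w := by
  have h1 : nndist (w i) (x i) ≤ offDist J x w :=
    Finset.le_sup (f := fun i => nndist (w i) (x i)) (Finset.mem_compl.2 hi)
  have h2 : (nndist (w i) (x i) : ℝ) ≤ offDist J x w := NNReal.coe_le_coe.2 h1
  rwa [coe_nndist, Subtype.dist_eq, Real.dist_eq] at h2

theorem offDist_le_one {D : ℕ} (J : Finset (Fin D)) (x w : Cube D) : offDist J x w ≤ 1 := by
  refine Finset.sup_le fun i _ => ?_
  rw [← NNReal.coe_le_coe, coe_nndist, Subtype.dist_eq, Real.dist_eq]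
  have h1 := (w i).2
  have h2 := (x i).2
  exact abs_le.2 ⟨by push_cast; linarith [h1.1, h2.2], by push_cast; linarith [h1.2, h2.1]⟩

theorem exists_offDist_eq_sampleDist {D : ℕ} (J : Finset (Fin D)) (x : Cube D) {M : ℕ}
    (hM : 0 < M) (w : ℕ → Cube D) : ∃ j < M, (offDist J x (w j) : ℝ) = sampleDist J x M w := by
  have : Nonempty (Fin M) := ⟨⟨0, hM⟩⟩
  obtain ⟨j, hj⟩ := exists_eq_ciInf_of_finite (f := fun j : Fin M => offDist J x (w j))
  exact ⟨j, j.2, by rw [sampleDist, ← hj]⟩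

theorem sampleDist_nonneg {D : ℕ} (J : Finset (Fin D)) (x : Cube D) (M : ℕ) (w : ℕ → Cube D) :
    0 ≤ sampleDist J x M w := NNReal.coe_nonneg _

theorem sampleDist_le_offDist {D : ℕ} (J : Finset (Fin D)) (x : Cube D) {M : ℕ} (w : ℕ → Cube D)
    {j : ℕ} (hj : j < M) : sampleDist J x M w ≤ offDist J x (w j) :=
  NNReal.coe_le_coe.2 (ciInf_le (OrderBot.bddBelow _) (⟨j, hj⟩ : Fin M))

theorem sampleDist_le_one {D : ℕ} (J : Finset (Fin D)) (x : Cube D) {M : ℕ} (hM : 0 < M)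
    (w : ℕ → Cube D) : sampleDist J x M w ≤ 1 :=
  (sampleDist_le_offDist J x w hM).trans (by exact_mod_cast offDist_le_one J x (w 0))

theorem lt_sampleDist {D : ℕ} {J : Finset (Fin D)} {x : Cube D} {M : ℕ}
    {w : ℕ → Cube D} {r : ℝ} (hr : 0 ≤ r) (h : r < sampleDist J x M w) {j : ℕ} (hj : j < M) :
    ∃ i, i ∉ J ∧ r < |(w j i : ℝ) - x i| := by
  by_contra! hcon
  have h1 := h.trans_le (sampleDist_le_offDist J x w hj)
  lift r to ℝ≥0 using hr
  have h2 : offDist J x (w j) ≤ r := by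
    refine Finset.sup_le fun i hi => ?_
    rw [← NNReal.coe_le_coe, coe_nndist, Subtype.dist_eq, Real.dist_eq]
    exact hcon i (Finset.mem_compl.1 hi)
  exact absurd (NNReal.coe_lt_coe.1 h1) (not_lt.2 h2)

theorem measurable_finset_sup {α ι β : Type*} {m : MeasurableSpace α} [MeasurableSpace β]
    [SemilatticeSup β] [OrderBot β] [MeasurableSup₂ β] (s : Finset ι) {g : ι → α → β}
    (hg : ∀ i ∈ s, Measurable (g i)) : Measurable fun ω => s.sup fun i => g i ω := by
  classical
  induction s using Finset.induction_on with
  | empty => simp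
  | insert i s _ ih =>
    simp only [Finset.sup_insert]
    exact (hg i (by simp)).sup (ih fun j hj => hg j (by simp [hj]))

theorem measurable_mem_pred {α ι : Type*} {m : MeasurableSpace α} {J : α → Finset ι}
    (hJ : ∀ i, MeasurableSet {ω | i ∈ J ω}) : Measurable fun ω i => i ∈ J ω :=
  measurable_pi_lambda _ fun i => measurableSet_setOfPred.1 (hJ i)

theorem comap_pi_le {α ι β : Type*} {m : MeasurableSpace α} [MeasurableSpace β] {g : ι → α → β}
    (h : ∀ i, MeasurableSpace.comap (g i) inferInstance ≤ m) :
    MeasurableSpace.comap (fun ω i => g i ω) inferInstance ≤ m :=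
  (measurable_pi_lambda _ fun i => (comap_measurable (g i)).mono (h i) le_rfl).comap_le

section Sampling

variable {D : ℕ} {Ω S : Type*} [mΩ : MeasurableSpace Ω] [mS : MeasurableSpace S] {P : Measure Ω}
  [IsProbabilityMeasure P] {k : Cube D → Cube D → ℝ} {ρ : Fin D → ℝ} {a b σ δ : ℝ} {n N₀ : ℕ}
  {f : Cube D → Ω → ℝ} {ε : ℕ → Ω → ℝ} {z : ℕ → ℕ → Ω → Cube D} {U : Ω → S}

theorem nonSampleInfo_le (h : IsModel P σ f ε z U) (hf : IsGPSample P k ρ a b f) (t : ℕ) :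
    nonSampleInfo f hf ε z U t ≤ mΩ :=
  sup_le (iSup₂_le fun s _ => iSup_le fun j => (h.measurable_sample s j).comap_le)
    (sup_le h.measurable_seed.comap_le
      (sup_le (measurable_pi_lambda _ h.measurable_noise).comap_le hf.measurable_path.comap_le))

/-- The probability that all of `M` samples are far from a point that is chosen independently of
them. -/
theorem IsModel.measure_lt_sampleDist_le (h : IsModel P σ f ε z U) (hf : IsGPSample P k ρ a b f)
    (t M : ℕ) {x : Ω → Cube D} {J : Ω → Finset (Fin D)}
    (hx : Measurable[nonSampleInfo f hf ε z U t] x)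
    (hJ : ∀ i, MeasurableSet[nonSampleInfo f hf ε z U t] {ω | i ∈ J ω}) (hJne : ∀ ω, (J ω).Nonempty)
    {r : ℝ} (h0 : 0 ≤ r) (h1 : r ≤ 1) :
    P {ω | r < sampleDist (J ω) (x ω) M fun j => z t j ω} ≤
      ENNReal.ofReal (Real.exp (-(M * r ^ (D - 1)))) := by
  let Φ : Ω → ℕ → Cube D := fun ω j => z t j ω
  let θ : Ω → Cube D × (Fin D → Prop) := fun ω => (x ω, fun i => i ∈ J ω)
  have hΦ : Measurable Φ := measurable_pi_lambda _ fun j => h.measurable_sample t j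
  have hJ' : Measurable[nonSampleInfo f hf ε z U t] fun ω i => i ∈ J ω :=
    measurable_mem_pred hJ
  have hθ' : Measurable[nonSampleInfo f hf ε z U t] θ := hx.prodMk hJ'
  have hθ : Measurable θ := hθ'.mono (nonSampleInfo_le h hf t) le_rfl
  have hind : IndepFun Φ θ P := by
    refine indep_of_indep_of_le (h.indep_sample_nonSampleInfo hf t) ?_ hθ'.comap_le
    exact comap_pi_le fun j => le_iSup (fun j => MeasurableSpace.comap (z t j) inferInstance) j
  let B : Set ((ℕ → Cube D) × (Cube D × (Fin D → Prop))) :=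
    {q | ∀ j < M, ∃ i, ¬ q.2.2 i ∧ r < |(q.1 j i : ℝ) - q.2.1 i|}
  have hB : MeasurableSet B := by
    have e : B = ⋂ j, ⋂ (_ : j < M), ⋃ i, ({q | q.2.2 i}ᶜ ∩
        {q | r < |(q.1 j i : ℝ) - q.2.1 i|}) := by
      ext q
      simp [B]
    rw [e]
    refine MeasurableSet.iInter fun j => MeasurableSet.iInter fun _ => MeasurableSet.iUnion fun i => ?_
    refine MeasurableSet.inter (MeasurableSet.compl (measurableSet_setOfPred.2 ?_))
      (measurableSet_lt measurable_const ?_)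
    · exact (measurable_pi_apply i).comp (measurable_snd.comp measurable_snd)
    · have m1 : Measurable fun q : (ℕ → Cube D) × (Cube D × (Fin D → Prop)) => (q.1 j i : ℝ) :=
        measurable_subtype_coe.comp ((measurable_pi_apply i).comp
          ((measurable_pi_apply j).comp measurable_fst))
      have m2 : Measurable fun q : (ℕ → Cube D) × (Cube D × (Fin D → Prop)) => (q.2.1 i : ℝ) :=
        measurable_subtype_coe.comp ((measurable_pi_apply i).comp
          (measurable_fst.comp measurable_snd))
      exact (m1.sub m2).abs
  have hsub : {ω | r < sampleDist (J ω) (x ω) M fun j => z t j ω} ⊆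
      (fun ω => (Φ ω, θ ω)) ⁻¹' B := fun ω hω j hj => lt_sampleDist h0 hω hj
  refine (measure_mono hsub).trans ?_
  rw [← lintegral_indicator_one ((hΦ.prodMk hθ) hB)]
  refine (lintegral_indep_pair hΦ hθ hind (F := B.indicator 1)
    (measurable_one.indicator hB)).trans_le ?_
  refine (lintegral_mono (g := fun _ => ENNReal.ofReal (Real.exp (-(M * r ^ (D - 1)))))
    fun ω => ?_).trans (by simp)
  let K : Set (Cube D) := {w | ∀ i ∈ (J ω)ᶜ, w i ∈ {u : unitInterval | |(u : ℝ) - x ω i| ≤ r}}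
  have hKi : ∀ i, MeasurableSet {u : unitInterval | |(u : ℝ) - x ω i| ≤ r} := fun i =>
    measurableSet_le ((measurable_subtype_coe.sub measurable_const).abs) measurable_const
  have hK : MeasurableSet K := by
    have e : K = ⋂ i ∈ (J ω)ᶜ, (fun w : Cube D => w i) ⁻¹'
        {u : unitInterval | |(u : ℝ) - x ω i| ≤ r} := by
      ext w
      simp [K]
    rw [e]
    exact Finset.measurableSet_biInter _ fun i _ => measurable_pi_apply i (hKi i)
  have hvolK : ENNReal.ofReal (r ^ (D - 1)) ≤ volume K := by
    have e : volume K = ∏ i ∈ (J ω)ᶜ, volume {u : unitInterval | |(u : ℝ) - x ω i| ≤ r} :=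
      Measure.pi_pi_finset (fun _ : Fin D => (volume : Measure unitInterval)) _ _
    rw [e]
    calc ENNReal.ofReal (r ^ (D - 1)) ≤ ENNReal.ofReal (r ^ ((J ω)ᶜ).card) := by
          refine ENNReal.ofReal_le_ofReal (pow_le_pow_of_le_one h0 h1 ?_)
          rw [Finset.card_compl, Fintype.card_fin]
          have := (hJne ω).card_pos
          omega
      _ = ∏ _i ∈ (J ω)ᶜ, ENNReal.ofReal r := by
          rw [Finset.prod_const, ENNReal.ofReal_pow h0]
      _ ≤ _ := Finset.prod_le_prod' fun i _ => ofReal_le_volume_abs_sub_le _ h0 h1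
  have hinner : ∀ ω', B.indicator (1 : (ℕ → Cube D) × (Cube D × (Fin D → Prop)) → ℝ≥0∞) (Φ ω', θ ω) =
      (⋂ j ∈ Finset.range M, (z t j) ⁻¹' Kᶜ).indicator 1 ω' := by
    intro ω'
    have e : ((Φ ω', θ ω) ∈ B) ↔ ω' ∈ ⋂ j ∈ Finset.range M, (z t j) ⁻¹' Kᶜ := by
      simp [B, K, Φ, θ]
    by_cases hω : (Φ ω', θ ω) ∈ B
    · rw [Set.indicator_of_mem hω, Set.indicator_of_mem (e.1 hω)]
      rfl
    · rw [Set.indicator_of_notMem hω, Set.indicator_of_notMem (mt e.2 hω)]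
  simp_rw [hinner]
  rw [lintegral_indicator_one (Finset.measurableSet_biInter _ fun j _ =>
    h.measurable_sample t j hK.compl)]
  have hii : iIndepFun (fun j => z t j) P :=
    h.sample_indep.precomp (g := fun j : ℕ => (t, j)) fun j j' hjj => (Prod.ext_iff.1 hjj).2
  rw [hii.meas_biInter fun j _ => ⟨Kᶜ, hK.compl, rfl⟩]
  have hone : ∀ j ∈ Finset.range M, P (z t j ⁻¹' Kᶜ) ≤ ENNReal.ofReal (1 - r ^ (D - 1)) := by
    intro j _
    rw [← Measure.map_apply (h.measurable_sample t j) hK.compl, h.sample_law,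
      prob_compl_eq_one_sub hK, ENNReal.ofReal_sub _ (by positivity), ENNReal.ofReal_one]
    exact tsub_le_tsub_left hvolK 1
  have hr1 : r ^ (D - 1) ≤ 1 := pow_le_one₀ h0 h1
  refine (Finset.prod_le_prod' hone).trans ?_
  rw [Finset.prod_const, Finset.card_range, ← ENNReal.ofReal_pow (by linarith)]
  refine ENNReal.ofReal_le_ofReal ?_
  calc (1 - r ^ (D - 1)) ^ M ≤ Real.exp (-(r ^ (D - 1))) ^ M :=
        pow_le_pow_left₀ (by linarith) (by linarith [Real.add_one_le_exp (-(r ^ (D - 1)))]) _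
    _ = _ := by rw [← Real.exp_nat_mul]; ring_nf

theorem IsModel.measurable_sampleDist (h : IsModel P σ f ε z U) (t M : ℕ) {x : Ω → Cube D}
    {J : Ω → Finset (Fin D)} (hx : Measurable x) (hJ : ∀ i, MeasurableSet {ω | i ∈ J ω}) :
    Measurable fun ω => sampleDist (J ω) (x ω) M fun j => z t j ω := by
  unfold sampleDist
  refine measurable_coe_nnreal_real.comp (Measurable.iInf fun j => ?_)
  have e : (fun ω => offDist (J ω) (x ω) (z t j ω)) = fun ω =>
      Finset.univ.sup fun i => {ω | i ∈ J ω}ᶜ.indicator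
        (fun ω => nndist (z t j ω i) (x ω i)) ω := by
    funext ω
    refine le_antisymm (Finset.sup_le fun i hi => ?_) (Finset.sup_le fun i _ => ?_)
    · refine le_trans (le_of_eq ?_) (Finset.le_sup (Finset.mem_univ i))
      rw [Set.indicator_of_mem (by simpa using hi)]
    · by_cases hi : i ∈ J ω
      · rw [Set.indicator_of_notMem (by simpa using hi)]
        exact zero_le
      · rw [Set.indicator_of_mem (by simpa using hi)]
        exact Finset.le_sup (f := fun i => nndist (z t j ω i) (x ω i)) (Finset.mem_compl.2 hi)
  rw [e]
  refine measurable_finset_sup _ fun i _ => Measurable.indicator ?_ (hJ i).compl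
  exact (((measurable_pi_apply i).comp (h.measurable_sample t j)).nndist
    ((measurable_pi_apply i).comp hx))

end Sampling

end

end LassoBO

namespace LassoBO

noncomputable section

open scoped ENNReal NNReal

set_option linter.unusedSectionVars false

/-! ### Mean square distance of the samples -/

theorem lintegral_id_mul_exp_neg :
    ∫⁻ t in Set.Ioi (0 : ℝ), ENNReal.ofReal (Real.exp (-t) * t) = 1 := by
  have h1 := Real.GammaIntegral_convergent (s := 2) two_pos
  have h2 := Real.Gamma_eq_integral (s := 2) two_pos
  have e : ∀ t : ℝ, t ^ ((2 : ℝ) - 1) = t := fun t => by norm_num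
  simp only [e] at h1 h2
  rw [Real.Gamma_two] at h2
  rw [← ofReal_integral_eq_lintegral_ofReal h1, ← h2, ENNReal.ofReal_one]
  filter_upwards [ae_restrict_mem measurableSet_Ioi] with t ht
  have : (0 : ℝ) < t := ht
  positivity

theorem lintegral_sq_le_of_tail {Ω : Type*} [MeasurableSpace Ω] {P : Measure Ω} {Z : Ω → ℝ} {ℓ : ℝ}
    (hZ : Measurable Z) (h0 : ∀ ω, 0 ≤ Z ω)
    (h : ∀ s > 0, P {ω | s < Z ω} ≤ ENNReal.ofReal (Real.exp (-(ℓ + s)))) :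
    ∫⁻ ω, ENNReal.ofReal (Z ω ^ 2) ∂P ≤ ENNReal.ofReal (2 * Real.exp (-ℓ)) := by
  have h1 := lintegral_rpow_eq_lintegral_meas_lt_mul P (ae_of_all _ h0) hZ.aemeasurable
    (p := 2) two_pos
  have e : ∀ t : ℝ, t ^ ((2 : ℝ) - 1) = t := fun t => by norm_num
  simp only [e, Real.rpow_two] at h1
  rw [h1, ENNReal.ofReal_mul two_pos.le]
  gcongr
  calc ∫⁻ t in Set.Ioi 0, P {a | t < Z a} * ENNReal.ofReal t
      ≤ ∫⁻ t in Set.Ioi 0, ENNReal.ofReal (Real.exp (-ℓ)) *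
          ENNReal.ofReal (Real.exp (-t) * t) := by
        refine setLIntegral_mono' measurableSet_Ioi fun t ht => ?_
        refine (mul_le_mul_left (h t ht) _).trans (le_of_eq ?_)
        rw [← ENNReal.ofReal_mul (Real.exp_pos _).le, ← ENNReal.ofReal_mul (Real.exp_pos _).le,
          ← mul_assoc, ← Real.exp_add]
        congr 3
        ring
    _ = ENNReal.ofReal (Real.exp (-ℓ)) := by
        rw [lintegral_const_mul _ (by fun_prop), lintegral_id_mul_exp_neg, mul_one]

/-- The distance `r` in round `t`, replaced by its maximal value for small `t`. -/
def cappedDist (D t : ℕ) (r : ℝ) : ℝ := if t ≤ 2 ^ (D - 1) then 1 else r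

theorem cappedDist_nonneg {D t : ℕ} {r : ℝ} (h : 0 ≤ r) : 0 ≤ cappedDist D t r := by
  unfold cappedDist
  split_ifs <;> positivity

theorem le_cappedDist {D t : ℕ} {r : ℝ} (h : r ≤ 1) : r ≤ cappedDist D t r := by
  unfold cappedDist
  split_ifs
  exacts [h, le_rfl]

theorem rpow_le_of_le_two_pow {D n t : ℕ} (hD : 2 ≤ D) (hn : 1 < n) (ht : t ≤ 2 ^ (D - 1)) :
    (t : ℝ) ^ ((1 : ℝ) / (n * ((D : ℝ) - 1))) ≤ 1.5 := by
  have hD1 : (0 : ℝ) < (D : ℝ) - 1 := by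
    have : (2 : ℝ) ≤ D := by exact_mod_cast hD
    linarith
  have hn' : (2 : ℝ) ≤ n := by exact_mod_cast hn
  have h1 : (t : ℝ) ≤ 2 ^ ((D : ℝ) - 1) := by
    have e : ((D : ℝ) - 1) = ((D - 1 : ℕ) : ℝ) := by
      rw [Nat.cast_sub (by omega), Nat.cast_one]
    rw [e, Real.rpow_natCast]
    exact_mod_cast ht
  calc (t : ℝ) ^ ((1 : ℝ) / (n * ((D : ℝ) - 1)))
      ≤ ((2 : ℝ) ^ ((D : ℝ) - 1)) ^ ((1 : ℝ) / (n * ((D : ℝ) - 1))) :=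
        Real.rpow_le_rpow (by positivity) h1 (by positivity)
    _ = 2 ^ ((1 : ℝ) / n) := by
        rw [← Real.rpow_mul two_pos.le]
        congr 1
        field_simp
    _ ≤ 2 ^ ((1 : ℝ) / 2) := by
        refine Real.rpow_le_rpow_of_exponent_le one_le_two ?_
        exact one_div_le_one_div_of_le two_pos hn'
    _ ≤ 1.5 := by
        rw [← Real.sqrt_eq_rpow, Real.sqrt_le_left (by norm_num)]
        norm_num

section Sampling

variable {D : ℕ} {Ω S : Type*} [mΩ : MeasurableSpace Ω] [mS : MeasurableSpace S] {P : Measure Ω}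
  [IsProbabilityMeasure P] {k : Cube D → Cube D → ℝ} {ρ : Fin D → ℝ} {a b σ δ : ℝ} {n N₀ : ℕ}
  {f : Cube D → Ω → ℝ} {ε : ℕ → Ω → ℝ} {z : ℕ → ℕ → Ω → Cube D} {U : Ω → S}
  {x : ℕ → Ω → Cube D} {J : ℕ → Ω → Finset (Fin D)}

theorem numSub_pos {n t : ℕ} (ht : 1 ≤ t) : 0 < numSub n t :=
  Nat.ceil_pos.2 (Real.rpow_pos_of_pos (by exact_mod_cast ht) _)

theorem IsModel.measure_lt_scaledDist_le (h : IsModel P σ f ε z U) (hf : IsGPSample P k ρ a b f)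
    (hD : 2 ≤ D) (hn : 1 < n) {t : ℕ} (ht : 1 ≤ t)
    (hx : Measurable[nonSampleInfo f hf ε z U t] (x t))
    (hJ : ∀ i, MeasurableSet[nonSampleInfo f hf ε z U t] {ω | i ∈ J t ω})
    (hJne : ∀ ω, (J t ω).Nonempty) {ℓ : ℝ} (hℓ : 1.5 ≤ ℓ) {s : ℝ} (hs : 0 < s) :
    P {ω | s < max ((t : ℝ) ^ ((1 : ℝ) / (n * ((D : ℝ) - 1))) * cappedDist D t
      (sampleDist (J t ω) (x t ω) (numSub n t) fun j => z t j ω) - ℓ) 0} ≤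
      ENNReal.ofReal (Real.exp (-(ℓ + s))) := by
  have ht' : (0 : ℝ) < t := by exact_mod_cast ht
  have hD1 : (0 : ℝ) < (D : ℝ) - 1 := by
    have : (2 : ℝ) ≤ D := by exact_mod_cast hD
    linarith
  have hn' : (0 : ℝ) < n := by exact_mod_cast (by omega : 0 < n)
  set α : ℝ := (1 : ℝ) / (n * ((D : ℝ) - 1)) with hα
  have htα : (0 : ℝ) < (t : ℝ) ^ α := Real.rpow_pos_of_pos ht' _
  by_cases hsmall : t ≤ 2 ^ (D - 1)
  · have hempty : {ω | s < max ((t : ℝ) ^ α * cappedDist D t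
        (sampleDist (J t ω) (x t ω) (numSub n t) fun j => z t j ω) - ℓ) 0} = ∅ := by
      ext ω
      simp only [cappedDist, hsmall, if_true, mul_one, Set.mem_ofPred_eq, Set.mem_empty_iff_false,
        iff_false, not_lt]
      exact max_le (by linarith [rpow_le_of_le_two_pow hD hn hsmall]) hs.le
    rw [hempty, measure_empty]
    exact zero_le
  · set r := (ℓ + s) / (t : ℝ) ^ α with hr
    have hr0 : 0 ≤ r := by
      have : 0 < ℓ := by linarith
      positivity
    have hsub : {ω | s < max ((t : ℝ) ^ α * cappedDist D t
        (sampleDist (J t ω) (x t ω) (numSub n t) fun j => z t j ω) - ℓ) 0} ⊆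
        {ω | r < sampleDist (J t ω) (x t ω) (numSub n t) fun j => z t j ω} := by
      intro ω hω
      simp only [cappedDist, hsmall, if_false, Set.mem_ofPred_eq, lt_max_iff, not_lt.2 hs.le,
        or_false] at hω
      rw [Set.mem_ofPred_eq, hr, div_lt_iff₀ htα]
      linarith
    refine (measure_mono hsub).trans ?_
    by_cases hr1 : r ≤ 1
    · refine (h.measure_lt_sampleDist_le hf t _ hx hJ hJne hr0 hr1).trans ?_
      refine ENNReal.ofReal_le_ofReal (Real.exp_le_exp.2 (neg_le_neg ?_))
      have e1 : ((t : ℝ) ^ α) ^ (D - 1) = (t : ℝ) ^ ((1 : ℝ) / n) := by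
        rw [← Real.rpow_natCast, ← Real.rpow_mul ht'.le, Nat.cast_sub (by omega), Nat.cast_one, hα]
        congr 1
        field_simp
      calc ℓ + s ≤ (ℓ + s) ^ (D - 1) := le_self_pow₀ (by linarith) (by omega)
        _ = (t : ℝ) ^ ((1 : ℝ) / n) * r ^ (D - 1) := by
            rw [hr, div_pow, e1]
            have : (0 : ℝ) < (t : ℝ) ^ ((1 : ℝ) / n) := Real.rpow_pos_of_pos ht' _
            field_simp
        _ ≤ numSub n t * r ^ (D - 1) := by
            gcongr
            exact Nat.le_ceil _
    · have hempty : {ω | r < sampleDist (J t ω) (x t ω) (numSub n t) fun j => z t j ω} = ∅ := by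
        ext ω
        simp only [Set.mem_ofPred_eq, Set.mem_empty_iff_false, iff_false, not_lt]
        exact (sampleDist_le_one _ _ (numSub_pos ht) _).trans (not_le.1 hr1).le
      rw [hempty, measure_empty]
      exact zero_le

/-- The squared distances of the samples of rounds `1, …, T` to the target points are on average not
larger than expected. -/
theorem IsModel.measure_sum_cappedDist_sq (h : IsModel P σ f ε z U) (hf : IsGPSample P k ρ a b f)
    (hD : 2 ≤ D) (hn : 1 < n) (hx : ∀ t ≥ 1, Measurable[nonSampleInfo f hf ε z U t] (x t))
    (hJ : ∀ t ≥ 1, ∀ i, MeasurableSet[nonSampleInfo f hf ε z U t] {ω | i ∈ J t ω})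
    (hJne : ∀ t ≥ 1, ∀ ω, (J t ω).Nonempty) {ℓ : ℝ} (hℓ : 1.5 ≤ ℓ) {T : ℕ} (hT : 1 ≤ T) :
    P {ω | 4 * ℓ ^ 2 * ∑ t ∈ Finset.Icc 1 T, (t : ℝ) ^ (-(2 * ((1 : ℝ) / (n * ((D : ℝ) - 1))))) <
      ∑ t ∈ Finset.Icc 1 T, cappedDist D t
        (sampleDist (J t ω) (x t ω) (numSub n t) fun j => z t j ω) ^ 2} ≤
      ENNReal.ofReal (2 * Real.exp (-ℓ) / ℓ ^ 2) := by
  set α : ℝ := (1 : ℝ) / (n * ((D : ℝ) - 1)) with hα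
  set d : ℕ → Ω → ℝ := fun t ω => cappedDist D t
    (sampleDist (J t ω) (x t ω) (numSub n t) fun j => z t j ω) with hd
  set Z : ℕ → Ω → ℝ := fun t ω => max ((t : ℝ) ^ α * d t ω - ℓ) 0 with hZ
  set w : ℕ → ℝ := fun t => (t : ℝ) ^ (-(2 * α)) with hw
  have hdm : ∀ t ∈ Finset.Icc 1 T, Measurable (d t) := by
    intro t ht
    have ht1 := (Finset.mem_Icc.1 ht).1
    simp only [hd, cappedDist]
    split_ifs
    · exact measurable_const
    · exact h.measurable_sampleDist t _ ((hx t ht1).mono (nonSampleInfo_le h hf t) le_rfl)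
        fun i => nonSampleInfo_le h hf t _ (hJ t ht1 i)
  have hZm : ∀ t ∈ Finset.Icc 1 T, Measurable (Z t) := fun t ht =>
    (((hdm t ht).const_mul _).sub_const _).max measurable_const
  have hwpos : ∀ t ∈ Finset.Icc 1 T, 0 < w t := fun t ht =>
    Real.rpow_pos_of_pos (by exact_mod_cast (Finset.mem_Icc.1 ht).1) _
  have hZ2 : ∀ t ∈ Finset.Icc 1 T, ∫⁻ ω, ENNReal.ofReal (Z t ω ^ 2) ∂P ≤
      ENNReal.ofReal (2 * Real.exp (-ℓ)) := by
    intro t ht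
    have ht1 := (Finset.mem_Icc.1 ht).1
    exact lintegral_sq_le_of_tail (hZm t ht) (fun ω => le_max_right _ _) fun s hs =>
      h.measure_lt_scaledDist_le hf hD hn ht1 (hx t ht1) (hJ t ht1) (hJne t ht1) hℓ hs
  set W := ∑ t ∈ Finset.Icc 1 T, w t with hW
  have hWpos : 0 < W := Finset.sum_pos hwpos ⟨1, by simp [hT]⟩
  have hℓ0 : 0 < ℓ := by linarith
  have hsub : {ω | 4 * ℓ ^ 2 * W < ∑ t ∈ Finset.Icc 1 T, d t ω ^ 2} ⊆
      {ω | ENNReal.ofReal (ℓ ^ 2 * W) ≤ ENNReal.ofReal (∑ t ∈ Finset.Icc 1 T, w t * Z t ω ^ 2)} := by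
    intro ω hω
    refine ENNReal.ofReal_le_ofReal ?_
    have h1 : ∀ t ∈ Finset.Icc 1 T, d t ω ^ 2 ≤ 2 * ℓ ^ 2 * w t + 2 * (w t * Z t ω ^ 2) := by
      intro t ht
      have ht0 : (0 : ℝ) < t := by exact_mod_cast (Finset.mem_Icc.1 ht).1
      have hd0 : 0 ≤ d t ω := cappedDist_nonneg (sampleDist_nonneg _ _ _ _)
      have hY : (t : ℝ) ^ α * d t ω ≤ ℓ + Z t ω := by
        have := le_max_left ((t : ℝ) ^ α * d t ω - ℓ) 0
        simp only [hZ]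
        linarith
      have hwt : w t * ((t : ℝ) ^ α) ^ 2 = 1 := by
        rw [hw, ← Real.rpow_natCast, ← Real.rpow_mul ht0.le, ← Real.rpow_add ht0]
        push_cast
        rw [show -(2 * α) + α * 2 = 0 by ring, Real.rpow_zero]
      have hY2 : ((t : ℝ) ^ α * d t ω) ^ 2 ≤ (ℓ + Z t ω) ^ 2 :=
        pow_le_pow_left₀ (mul_nonneg (Real.rpow_nonneg ht0.le _) hd0) hY 2
      calc d t ω ^ 2 = w t * ((t : ℝ) ^ α * d t ω) ^ 2 := by
            rw [mul_pow, ← mul_assoc, hwt, one_mul]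
        _ ≤ w t * (ℓ + Z t ω) ^ 2 := mul_le_mul_of_nonneg_left hY2 (hwpos t ht).le
        _ ≤ w t * (2 * ℓ ^ 2 + 2 * Z t ω ^ 2) := by
            refine mul_le_mul_of_nonneg_left ?_ (hwpos t ht).le
            nlinarith [sq_nonneg (ℓ - Z t ω)]
        _ = _ := by ring
    have h2 := Finset.sum_le_sum h1
    rw [Finset.sum_add_distrib, ← Finset.mul_sum, ← Finset.mul_sum, ← hW] at h2
    have h3 : 4 * ℓ ^ 2 * W < ∑ t ∈ Finset.Icc 1 T, d t ω ^ 2 := hω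
    linarith
  have hmeas : Measurable fun ω => ENNReal.ofReal (∑ t ∈ Finset.Icc 1 T, w t * Z t ω ^ 2) :=
    (Finset.measurable_sum _ fun t ht => ((hZm t ht).pow_const 2).const_mul _).ennreal_ofReal
  refine (measure_mono hsub).trans ?_
  have hmk := mul_meas_ge_le_lintegral₀ (μ := P) hmeas.aemeasurable (ENNReal.ofReal (ℓ ^ 2 * W))
  have hpos : 0 < ℓ ^ 2 * W := by positivity
  have hint : ∫⁻ ω, ENNReal.ofReal (∑ t ∈ Finset.Icc 1 T, w t * Z t ω ^ 2) ∂P ≤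
      ENNReal.ofReal (W * (2 * Real.exp (-ℓ))) := by
    have e : ∀ ω, ENNReal.ofReal (∑ t ∈ Finset.Icc 1 T, w t * Z t ω ^ 2) =
        ∑ t ∈ Finset.Icc 1 T, ENNReal.ofReal (w t) * ENNReal.ofReal (Z t ω ^ 2) := by
      intro ω
      rw [ENNReal.ofReal_sum_of_nonneg fun t ht => mul_nonneg (hwpos t ht).le (sq_nonneg _)]
      exact Finset.sum_congr rfl fun t ht => ENNReal.ofReal_mul (hwpos t ht).le
    simp_rw [e]
    rw [lintegral_finsetSum' _ fun t ht =>
      (((hZm t ht).pow_const 2).ennreal_ofReal.const_mul _).aemeasurable, hW, Finset.sum_mul,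
      ENNReal.ofReal_sum_of_nonneg fun t ht => mul_nonneg (hwpos t ht).le (by positivity)]
    refine Finset.sum_le_sum fun t ht => ?_
    rw [lintegral_const_mul _ ((hZm t ht).pow_const 2).ennreal_ofReal,
      ENNReal.ofReal_mul (hwpos t ht).le]
    gcongr
    exact hZ2 t ht
  have h4 := hmk.trans hint
  have e5 : 2 * Real.exp (-ℓ) / ℓ ^ 2 = (W * (2 * Real.exp (-ℓ))) / (ℓ ^ 2 * W) := by
    field_simp
  rw [e5, ENNReal.ofReal_div_of_pos hpos, ENNReal.le_div_iff_mul_le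
    (Or.inl (by simpa using hpos)) (Or.inl ENNReal.ofReal_ne_top), mul_comm]
  exact h4

end Sampling

end

end LassoBO

namespace LassoBO

noncomputable section

open scoped ENNReal NNReal

set_option linter.unusedSectionVars false

/-! ### Simultaneous confidence bounds on a grid -/

/-- The quantity under the logarithm in the second summand of `β_t`. -/
def gridScale {D : ℕ} (ρ : Fin D → ℝ) (a b δ : ℝ) (d t : ℕ) : ℝ :=
  4 * √(⨆ i, ρ i) * b * d * √(Real.log (12 * D * a / δ)) * t ^ 2

/-- The number of grid points per important variable. -/
def gridSize {D : ℕ} (ρ : Fin D → ℝ) (a b δ : ℝ) (d t : ℕ) : ℕ := ⌈gridScale ρ a b δ d t / 7⌉₊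

theorem gridSize_pos {D : ℕ} {ρ : Fin D → ℝ} {a b δ : ℝ} {d t : ℕ}
    (h : 1 ≤ gridScale ρ a b δ d t) : 0 < gridSize ρ a b δ d t :=
  Nat.ceil_pos.2 (by positivity)

theorem gridSize_le {D : ℕ} {ρ : Fin D → ℝ} {a b δ : ℝ} {d t : ℕ}
    (h : 1 ≤ gridScale ρ a b δ d t) : (gridSize ρ a b δ d t : ℝ) ≤ gridScale ρ a b δ d t := by
  rcases le_total (gridScale ρ a b δ d t) 7 with h7 | h7
  · have h1 : gridSize ρ a b δ d t ≤ 1 := Nat.ceil_le.2 (by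
      rw [Nat.cast_one, div_le_one (by norm_num)]
      exact h7)
    have h2 : (gridSize ρ a b δ d t : ℝ) ≤ 1 := by exact_mod_cast h1
    linarith
  · have h1 := Nat.ceil_lt_add_one (a := gridScale ρ a b δ d t / 7) (by positivity)
    unfold gridSize
    linarith

theorem le_gridSize {D : ℕ} (ρ : Fin D → ℝ) (a b δ : ℝ) (d t : ℕ) :
    gridScale ρ a b δ d t / 7 ≤ gridSize ρ a b δ d t := Nat.le_ceil _

theorem beta_eq {D : ℕ} (ρ : Fin D → ℝ) (a b δ : ℝ) (d t : ℕ) :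
    beta ρ a b δ d t = 2 * Real.log (Real.pi ^ 2 * t ^ 2 / δ) +
      2 * d * Real.log (gridScale ρ a b δ d t) := rfl

theorem log_pi_sq_div_nonneg {δ : ℝ} (hδ : 0 < δ) (hδ' : δ < 1) {t : ℕ} (ht : 1 ≤ t) :
    0 ≤ Real.log (Real.pi ^ 2 * t ^ 2 / δ) := by
  refine Real.log_nonneg ?_
  have h1 : (1 : ℝ) ≤ t := by exact_mod_cast ht
  have h2 : (1 : ℝ) ≤ Real.pi ^ 2 := one_le_pow₀ (by linarith [Real.pi_gt_three])
  have h3 : (1 : ℝ) ≤ (t : ℝ) ^ 2 := one_le_pow₀ h1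
  rw [le_div_iff₀ hδ, one_mul]
  exact hδ'.le.trans (one_le_mul_of_one_le_of_one_le h2 h3)

theorem beta_nonneg {D : ℕ} {ρ : Fin D → ℝ} {a b δ : ℝ} (hδ : 0 < δ) (hδ' : δ < 1) {d t : ℕ}
    (ht : 1 ≤ t) (h : 1 ≤ gridScale ρ a b δ d t) : 0 ≤ beta ρ a b δ d t := by
  rw [beta_eq]
  have h1 := log_pi_sq_div_nonneg hδ hδ' ht
  have h2 := Real.log_nonneg h
  positivity

theorem exp_neg_beta {D : ℕ} {ρ : Fin D → ℝ} {a b δ : ℝ} (hδ : 0 < δ) {d t : ℕ}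
    (ht : 1 ≤ t) (h : 1 ≤ gridScale ρ a b δ d t) :
    Real.exp (-(beta ρ a b δ d t) / 2) =
      δ / (Real.pi ^ 2 * t ^ 2) / gridScale ρ a b δ d t ^ d := by
  have ht0 : (0 : ℝ) < t := by exact_mod_cast ht
  have hg : 0 < gridScale ρ a b δ d t := by linarith
  have h1 : -(beta ρ a b δ d t) / 2 = -Real.log (Real.pi ^ 2 * t ^ 2 / δ) +
      -(Real.log (gridScale ρ a b δ d t ^ d)) := by
    rw [beta_eq, Real.log_pow]
    ring
  have hpi := Real.pi_pos
  rw [h1, Real.exp_add, Real.exp_neg, Real.exp_neg, Real.exp_log (by positivity),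
    Real.exp_log (by positivity), inv_div, div_eq_mul_inv _ (gridScale ρ a b δ d t ^ d)]

/-- The centre of the `v`-th of `N` subintervals of `[0,1]`. -/
def cellCentre (N : ℕ) (v : Fin N) : unitInterval :=
  ⟨(2 * (v : ℝ) + 1) / (2 * N), by positivity, by
    have h1 : ((v : ℕ) : ℝ) + 1 ≤ N := by exact_mod_cast v.2
    have h2 : (0 : ℝ) ≤ (v : ℕ) := Nat.cast_nonneg _
    rw [div_le_one (by linarith)]
    linarith⟩

theorem exists_cellCentre {N : ℕ} (hN : 0 < N) (s : unitInterval) :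
    ∃ v : Fin N, |(s : ℝ) - cellCentre N v| ≤ 1 / (2 * N) := by
  have hN' : (0 : ℝ) < N := by exact_mod_cast hN
  have hs0 := s.2.1
  have hs1 := s.2.2
  have key : ∀ v : Fin N, (v : ℝ) ≤ s * N → (s : ℝ) * N ≤ v + 1 →
      |(s : ℝ) - cellCentre N v| ≤ 1 / (2 * N) := by
    intro v h1 h2
    have e : (s : ℝ) - cellCentre N v = (2 * (s * N) - 2 * v - 1) / (2 * N) := by
      simp only [cellCentre]
      field_simp
      ring
    rw [e, abs_div, abs_of_pos (show (0 : ℝ) < 2 * N by positivity)]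
    refine div_le_div_of_nonneg_right ?_ (by positivity)
    exact abs_le.2 ⟨by linarith, by linarith⟩
  by_cases h : ⌊(s : ℝ) * N⌋₊ < N
  · exact ⟨⟨_, h⟩, key _ (Nat.floor_le (by positivity)) (Nat.lt_floor_add_one _).le⟩
  · have h1 : (N : ℝ) ≤ s * N := (Nat.le_floor_iff (by positivity)).1 (not_lt.1 h)
    have h2 : ((N - 1 : ℕ) : ℝ) = (N : ℝ) - 1 := by
      rw [Nat.cast_sub hN, Nat.cast_one]
    refine ⟨⟨N - 1, by omega⟩, key _ ?_ ?_⟩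
    · change ((N - 1 : ℕ) : ℝ) ≤ _
      linarith
    · change _ ≤ ((N - 1 : ℕ) : ℝ) + 1
      nlinarith

/-- The point with grid coordinates `u` in `J` and the coordinates of `w` outside `J`. -/
def gridPoint {D : ℕ} (J : Finset (Fin D)) (N : ℕ) (u : J → Fin N) (w : Cube D) : Cube D :=
  fun i => if h : i ∈ J then cellCentre N (u ⟨i, h⟩) else w i

theorem measurable_card_finset {α ι : Type*} [Fintype ι] {m : MeasurableSpace α}
    {J : α → Finset ι} (hJ : ∀ i, MeasurableSet {ω | i ∈ J ω}) :
    Measurable fun ω => (J ω).card := by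
  classical
  have e : (fun ω => (J ω).card) = fun ω => ∑ i, if i ∈ J ω then 1 else 0 := by
    funext ω
    simp
  rw [e]
  exact Finset.measurable_sum _ fun i _ => Measurable.ite (hJ i) measurable_const measurable_const

theorem measurableSet_eq_finset {α ι : Type*} [Fintype ι] {m : MeasurableSpace α}
    {J : α → Finset ι} (hJ : ∀ i, MeasurableSet {ω | i ∈ J ω}) (K : Finset ι) :
    MeasurableSet {ω | J ω = K} := by
  have e : {ω | J ω = K} = ⋂ i, {ω | i ∈ J ω ↔ i ∈ K} := by
    ext ω
    simp [Finset.ext_iff]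
  rw [e]
  refine MeasurableSet.iInter fun i => ?_
  by_cases hi : i ∈ K
  · simpa [hi] using hJ i
  · have e : {ω | i ∈ J ω ↔ i ∈ K} = {ω | i ∈ J ω}ᶜ := by
      ext ω
      simp [hi]
    rw [e]
    exact (hJ i).compl

theorem card_le_dMax {D : ℕ} {Ω : Type*} (I : ℕ → Ω → Finset (Fin D)) {t : ℕ} (ht : 1 ≤ t) (ω : Ω) :
    (I t ω).card ≤ dMax I t ω :=
  Finset.le_sup (f := fun s => (I s ω).card) (Finset.mem_Icc.2 ⟨ht, le_rfl⟩)

theorem dMax_le {D : ℕ} {Ω : Type*} (I : ℕ → Ω → Finset (Fin D)) (t : ℕ) (ω : Ω) :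
    dMax I t ω ≤ D :=
  Finset.sup_le fun _ _ => (Finset.card_le_univ _).trans (by simp)

/-- The confidence bounds in round `t`: a lower bound at the next data point and upper bounds on a
grid. -/
def GoodBounds {D : ℕ} {Ω : Type*} (k : Cube D → Cube D → ℝ) (σ : ℝ) (ρ : Fin D → ℝ) (a b δ : ℝ)
    (n N₀ : ℕ) (f : Cube D → Ω → ℝ) (ε : ℕ → Ω → ℝ) (z : ℕ → ℕ → Ω → Cube D)
    (pt : ℕ → Ω → Cube D) (I : ℕ → Ω → Finset (Fin D)) (t : ℕ) (ω : Ω) : Prop :=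
  let β := beta ρ a b δ (dMax I t ω) t
  let m := N₀ + (t - 1)
  let X := fun s => pt s ω
  let Y := fun s => obs f ε pt s ω
  postMean k σ m X Y (pt m ω) - √β * √(postVar k σ m X (pt m ω)) ≤ f (pt m ω) ω ∧
    ∀ j < numSub n t, ∀ u : I t ω → Fin (gridSize ρ a b δ (dMax I t ω) t),
      f (gridPoint (I t ω) _ u (z t j ω)) ω ≤
        acquisition k σ β m X Y (gridPoint (I t ω) _ u (z t j ω))

section Confidence

variable {D : ℕ} {Ω S : Type*} [mΩ : MeasurableSpace Ω] [mS : MeasurableSpace S] {P : Measure Ω}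
  [IsProbabilityMeasure P] {k : Cube D → Cube D → ℝ} {ρ : Fin D → ℝ} {a b σ δ : ℝ} {n N₀ : ℕ}
  {f : Cube D → Ω → ℝ} {ε : ℕ → Ω → ℝ} {z : ℕ → ℕ → Ω → Cube D} {U : Ω → S}
  {pt : ℕ → Ω → Cube D} {I : ℕ → Ω → Finset (Fin D)} {inc : ℕ → Ω → ℕ}

theorem IsRun.measurableSet_mem_histAlg (hr : IsRun k σ ρ a b δ n N₀ f ε z U pt I inc) {s t : ℕ}
    (hs : 1 ≤ s) (hst : s ≤ t) (i : Fin D) :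
    MeasurableSet[histAlg f ε z U pt (N₀ + (t - 1))] {ω | i ∈ I s ω} :=
  ((pastInfo_mono hst).trans (le_sup_left.trans (pastInfo_le_histAlg t))) _
    (hr.select_measurable s hs i)

theorem IsRun.measurable_dMax (hr : IsRun k σ ρ a b δ n N₀ f ε z U pt I inc) (t : ℕ) :
    Measurable[histAlg f ε z U pt (N₀ + (t - 1))] (dMax I t) :=
  measurable_finset_sup _ fun _ hs => measurable_card_finset fun i =>
    hr.measurableSet_mem_histAlg (Finset.mem_Icc.1 hs).1 (Finset.mem_Icc.1 hs).2 i

theorem measurable_gridPoint {α : Type*} {m : MeasurableSpace α} (J : Finset (Fin D)) (N : ℕ)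
    (u : J → Fin N) {w : α → Cube D} (hw : Measurable w) :
    Measurable fun ω => gridPoint J N u (w ω) := by
  refine measurable_pi_lambda _ fun i => ?_
  unfold gridPoint
  split_ifs
  · exact measurable_const
  · exact (measurable_pi_apply i).comp hw

/-- The part of the failure event of the confidence bounds on which the selected set is `J` and
`d̃_t = d`. -/
theorem IsRun.measure_fail_inter_le (hr : IsRun k σ ρ a b δ n N₀ f ε z U pt I inc)
    (h : IsModel P σ f ε z U) (hf : IsGPSample P k ρ a b f) (hσ : 0 < σ) (hδ : 0 < δ)
    (hδ' : δ < 1) {t : ℕ} (ht : 1 ≤ t) (J : Finset (Fin D)) (d : ℕ) :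
    P ({ω | I t ω = J ∧ dMax I t ω = d} ∩ {ω | 1 ≤ gridScale ρ a b δ (dMax I t ω) t ∧
        ¬ GoodBounds k σ ρ a b δ n N₀ f ε z pt I t ω}) ≤
      ENNReal.ofReal ((numSub n t + 1) * (δ / (2 * Real.pi ^ 2 * t ^ 2))) *
        P {ω | I t ω = J ∧ dMax I t ω = d} := by
  set A := {ω | I t ω = J ∧ dMax I t ω = d} with hA
  set m := N₀ + (t - 1) with hm
  by_cases hcase : 1 ≤ gridScale ρ a b δ d t ∧ J.card ≤ d
  swap
  · have hempty : A ∩ {ω | 1 ≤ gridScale ρ a b δ (dMax I t ω) t ∧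
        ¬ GoodBounds k σ ρ a b δ n N₀ f ε z pt I t ω} = ∅ := by
      ext ω
      simp only [hA, Set.mem_inter_iff, Set.mem_ofPred_eq, Set.mem_empty_iff_false, iff_false,
        not_and]
      rintro ⟨h1, h2⟩ h3
      refine absurd ⟨h2 ▸ h3, ?_⟩ hcase
      rw [← h1, ← h2]
      exact card_le_dMax I ht ω
    rw [hempty, measure_empty]
    exact zero_le
  obtain ⟨hτ, hJd⟩ := hcase
  set τ := gridScale ρ a b δ d t with hτdef
  set N := gridSize ρ a b δ d t with hN
  set c := √(beta ρ a b δ d t) with hc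
  have hβ := beta_nonneg hδ hδ' ht hτ
  have hAm : MeasurableSet[histAlg f ε z U pt m] A := by
    refine MeasurableSet.inter ?_ ?_
    · exact measurableSet_eq_finset (fun i => hr.measurableSet_mem_histAlg ht le_rfl i) J
    · exact hr.measurable_dMax t (measurableSet_singleton d)
  have hpt : Measurable[histAlg f ε z U pt m] (pt m) := hr.isAdaptive m
  let dev : (Ω → Cube D) → ℤˣ → Set Ω := fun ξ s => {ω | c * √(postVar k σ m (fun i => pt i ω) (ξ ω)) <
    ((s : ℤ) : ℝ) * (f (ξ ω) ω - postMean k σ m (fun i => pt i ω) (fun i => obs f ε pt i ω) (ξ ω))}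
  let ξ : ℕ → (J → Fin N) → Ω → Cube D := fun j u ω => gridPoint J N u (z t j ω)
  have hξ : ∀ j u, Measurable[histAlg f ε z U pt m] (ξ j u) := fun j u =>
    measurable_gridPoint J N u (measurable_sample_histAlg m t j)
  set q := ENNReal.ofReal (Real.exp (-c ^ 2 / 2) / 2) with hq
  have hdev : ∀ (η : Ω → Cube D) (_ : Measurable[histAlg f ε z U pt m] η) (s : ℤˣ),
      P (A ∩ dev η s) ≤ q * P A := fun η hη s =>
    hr.isAdaptive.measure_deviation_le h hf hσ m hη hAm (Real.sqrt_nonneg _) s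
  have hsub : A ∩ {ω | 1 ≤ gridScale ρ a b δ (dMax I t ω) t ∧
      ¬ GoodBounds k σ ρ a b δ n N₀ f ε z pt I t ω} ⊆
      (A ∩ dev (pt m) (-1)) ∪ ⋃ p ∈ Finset.range (numSub n t) ×ˢ
        (Finset.univ : Finset (J → Fin N)), (A ∩ dev (ξ p.1 p.2) 1) := by
    rintro ω ⟨hωA, -, hωB⟩
    by_contra hcon
    refine hωB ?_
    obtain ⟨h1, h2⟩ := hωA
    simp only [Set.mem_union, Set.mem_iUnion, not_or, not_exists, Finset.mem_product,
      Finset.mem_range, Finset.mem_univ, and_true, Set.mem_inter_iff, not_and, exists_prop] at hcon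
    have hω : ω ∈ A := ⟨h1, h2⟩
    constructor
    · have h3 := hcon.1 hω
      simp only [dev, Set.mem_ofPred_eq, not_lt] at h3
      rw [h2, ← hm]
      push_cast at h3
      linarith
    · subst h1 h2
      intro j hj u
      have h3 := hcon.2 (j, u) hj hω
      simp only [dev, ξ, Set.mem_ofPred_eq, not_lt] at h3
      rw [acquisition]
      push_cast at h3
      linarith
  have hexp : Real.exp (-c ^ 2 / 2) = δ / (Real.pi ^ 2 * t ^ 2) / τ ^ d := by
    rw [hc, Real.sq_sqrt hβ]
    exact exp_neg_beta hδ ht hτ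
  have hcount : (numSub n t : ℝ) * (N : ℝ) ^ J.card + 1 ≤ (numSub n t + 1) * τ ^ d := by
    have h1 : (N : ℝ) ^ J.card ≤ τ ^ d :=
      (pow_le_pow_left₀ (Nat.cast_nonneg _) (gridSize_le hτ) _).trans
        (pow_le_pow_right₀ hτ hJd)
    have h2 : 1 ≤ τ ^ d := one_le_pow₀ hτ
    have h3 : (0 : ℝ) ≤ numSub n t := Nat.cast_nonneg _
    nlinarith [mul_le_mul_of_nonneg_left h1 h3]
  calc P (A ∩ {ω | 1 ≤ gridScale ρ a b δ (dMax I t ω) t ∧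
        ¬ GoodBounds k σ ρ a b δ n N₀ f ε z pt I t ω})
      ≤ P (A ∩ dev (pt m) (-1)) + ∑ p ∈ Finset.range (numSub n t) ×ˢ
          (Finset.univ : Finset (J → Fin N)), P (A ∩ dev (ξ p.1 p.2) 1) :=
        (measure_mono hsub).trans ((measure_union_le _ _).trans
          (add_le_add_right (measure_biUnion_finset_le _ _) _))
    _ ≤ q * P A + ∑ _p ∈ Finset.range (numSub n t) ×ˢ
          (Finset.univ : Finset (J → Fin N)), q * P A :=
        add_le_add (hdev _ hpt _) (Finset.sum_le_sum fun p _ => hdev _ (hξ _ _) _)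
    _ = ENNReal.ofReal ((numSub n t * (N : ℝ) ^ J.card + 1) * (Real.exp (-c ^ 2 / 2) / 2)) *
          P A := by
        rw [Finset.sum_const, Finset.card_product, Finset.card_range, Finset.card_univ,
          Fintype.card_fun, Fintype.card_fin, Fintype.card_coe, nsmul_eq_mul, add_comm,
          ← add_one_mul, ← mul_assoc, hq, ENNReal.ofReal_mul (by positivity)]
        congr 2
        rw [ENNReal.ofReal_add (by positivity) zero_le_one, ENNReal.ofReal_one,
          ENNReal.ofReal_mul (by positivity), ENNReal.ofReal_pow (by positivity),
          ENNReal.ofReal_natCast, ENNReal.ofReal_natCast]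
        push_cast
        rfl
    _ ≤ _ := by
        refine mul_le_mul_left (ENNReal.ofReal_le_ofReal ?_) _
        rw [hexp]
        have hτ0 : 0 < τ ^ d := by positivity
        have hpi := Real.pi_pos
        have ht0 : (0 : ℝ) < t := by exact_mod_cast ht
        calc (numSub n t * (N : ℝ) ^ J.card + 1) * (δ / (Real.pi ^ 2 * t ^ 2) / τ ^ d / 2)
            ≤ ((numSub n t + 1) * τ ^ d) * (δ / (Real.pi ^ 2 * t ^ 2) / τ ^ d / 2) := by gcongr
          _ = _ := by field_simp

/-- The confidence bounds in round `t` hold with high probability. -/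
theorem IsRun.measure_fail_le (hr : IsRun k σ ρ a b δ n N₀ f ε z U pt I inc)
    (h : IsModel P σ f ε z U) (hf : IsGPSample P k ρ a b f) (hσ : 0 < σ) (hδ : 0 < δ)
    (hδ' : δ < 1) {t : ℕ} (ht : 1 ≤ t) :
    P {ω | 1 ≤ gridScale ρ a b δ (dMax I t ω) t ∧
        ¬ GoodBounds k σ ρ a b δ n N₀ f ε z pt I t ω} ≤
      ENNReal.ofReal ((numSub n t + 1) * (δ / (2 * Real.pi ^ 2 * t ^ 2))) := by
  set B := {ω | 1 ≤ gridScale ρ a b δ (dMax I t ω) t ∧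
        ¬ GoodBounds k σ ρ a b δ n N₀ f ε z pt I t ω} with hB
  let A : Finset (Fin D) × ℕ → Set Ω := fun p => {ω | I t ω = p.1 ∧ dMax I t ω = p.2}
  let s : Finset (Finset (Fin D) × ℕ) := Finset.univ ×ˢ Finset.range (D + 1)
  have hle : histAlg f ε z U pt (N₀ + (t - 1)) ≤ mΩ :=
    (IsAdaptive.measurable_obs_history h hf hr.isAdaptive _).2.comap_le
  have hAm : ∀ p, MeasurableSet (A p) := fun p => hle _ (MeasurableSet.inter
    (measurableSet_eq_finset (fun i => hr.measurableSet_mem_histAlg ht le_rfl i) p.1)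
    (hr.measurable_dMax t (measurableSet_singleton p.2)))
  have hsub : B ⊆ ⋃ p ∈ s, A p ∩ B := by
    intro ω hω
    simp only [Set.mem_iUnion]
    refine ⟨(I t ω, dMax I t ω), ?_, ⟨rfl, rfl⟩, hω⟩
    simp [s, Nat.lt_succ_of_le (dMax_le I t ω)]
  have hdisj : (s : Set (Finset (Fin D) × ℕ)).PairwiseDisjoint A := by
    intro p _ p' _ hpp
    refine Set.disjoint_left.2 fun ω h1 h2 => hpp ?_
    exact Prod.ext (h1.1.symm.trans h2.1) (h1.2.symm.trans h2.2)
  calc P B ≤ ∑ p ∈ s, P (A p ∩ B) := (measure_mono hsub).trans (measure_biUnion_finset_le _ _)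
    _ ≤ ∑ p ∈ s, ENNReal.ofReal ((numSub n t + 1) * (δ / (2 * Real.pi ^ 2 * t ^ 2))) * P (A p) :=
        Finset.sum_le_sum fun p _ => hr.measure_fail_inter_le h hf hσ hδ hδ' ht p.1 p.2
    _ = ENNReal.ofReal ((numSub n t + 1) * (δ / (2 * Real.pi ^ 2 * t ^ 2))) * P (⋃ p ∈ s, A p) := by
        rw [← Finset.mul_sum, measure_biUnion_finset hdisj fun p _ => hAm p]
    _ ≤ _ := (mul_le_mul_right prob_le_one _).trans (mul_one _).le

theorem numSub_le (hn : 1 < n) {t : ℕ} (ht : 1 ≤ t) : (numSub n t : ℝ) ≤ (t : ℝ) ^ ((1 : ℝ) / 2) + 1 := by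
  have ht1 : (1 : ℝ) ≤ t := by exact_mod_cast ht
  have h1 := (Nat.ceil_lt_add_one (a := (t : ℝ) ^ ((1 : ℝ) / n)) (by positivity)).le
  have h2 : (t : ℝ) ^ ((1 : ℝ) / n) ≤ (t : ℝ) ^ ((1 : ℝ) / 2) :=
    Real.rpow_le_rpow_of_exponent_le ht1
      (one_div_le_one_div_of_le two_pos (by exact_mod_cast hn))
  unfold numSub
  linarith

theorem sum_sqrt_add_two_div_sq_le {T : ℕ} (hT : 1 ≤ T) :
    ∑ t ∈ Finset.Icc 1 T, (√(t : ℝ) + 2) / (t : ℝ) ^ 2 ≤ 7 - 2 / √(T : ℝ) - 2 / T := by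
  induction T, hT using Nat.le_induction with
  | base => norm_num
  | succ T hT ih =>
    rw [Finset.sum_Icc_succ_top (by omega)]
    push_cast
    have hT0 : (0 : ℝ) < T := by exact_mod_cast hT
    set p := √(T : ℝ) with hp
    set q := √((T : ℝ) + 1) with hq
    have hp0 : 0 < p := Real.sqrt_pos.2 hT0
    have hq0 : 0 < q := Real.sqrt_pos.2 (by linarith)
    have hp2 : p ^ 2 = T := Real.sq_sqrt hT0.le
    have hq2 : q ^ 2 = (T : ℝ) + 1 := Real.sq_sqrt (by linarith)
    have hpq : p ≤ q := Real.sqrt_le_sqrt (by linarith)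
    have h1 : q / ((T : ℝ) + 1) ^ 2 ≤ 2 / p - 2 / q := by
      rw [← hq2]
      have e1 : q / (q ^ 2) ^ 2 = 1 / q ^ 3 := by field_simp
      have e2 : 2 / p - 2 / q = 2 * (q - p) / (p * q) := by field_simp
      have e3 : (q - p) * (q + p) = 1 := by linear_combination hq2 - hp2
      have e4 : q - p = 1 / (q + p) := by
        rw [eq_div_iff (by positivity)]
        exact e3
      rw [e1, e2, e4, mul_one_div, div_div, div_le_div_iff₀ (by positivity) (by positivity)]
      nlinarith [mul_le_mul_of_nonneg_right hpq hq0.le, mul_nonneg hp0.le hq0.le,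
        mul_nonneg (mul_nonneg hp0.le hq0.le) (sub_nonneg.2 hpq),
        mul_nonneg (mul_nonneg hq0.le hq0.le) (sub_nonneg.2 hpq)]
    have h2 : 2 / ((T : ℝ) + 1) ^ 2 ≤ 2 / T - 2 / ((T : ℝ) + 1) := by
      have e2 : 2 / (T : ℝ) - 2 / ((T : ℝ) + 1) = 2 / (T * ((T : ℝ) + 1)) := by
        field_simp
        ring
      rw [e2]
      refine div_le_div_of_nonneg_left (by norm_num) (by positivity) ?_
      nlinarith
    rw [add_div]
    linarith

/-- With high probability the confidence bounds hold in all rounds. -/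
theorem IsRun.measure_exists_fail_le (hr : IsRun k σ ρ a b δ n N₀ f ε z U pt I inc)
    (h : IsModel P σ f ε z U) (hf : IsGPSample P k ρ a b f) (hσ : 0 < σ) (hδ : 0 < δ)
    (hδ' : δ < 1) (hn : 1 < n) :
    P {ω | ∃ t ≥ 1, 1 ≤ gridScale ρ a b δ (dMax I t ω) t ∧
        ¬ GoodBounds k σ ρ a b δ n N₀ f ε z pt I t ω} ≤ ENNReal.ofReal (0.36 * δ) := by
  have hsub : {ω | ∃ t ≥ 1, 1 ≤ gridScale ρ a b δ (dMax I t ω) t ∧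
        ¬ GoodBounds k σ ρ a b δ n N₀ f ε z pt I t ω} ⊆
      ⋃ s : ℕ, {ω | 1 ≤ gridScale ρ a b δ (dMax I (s + 1) ω) (s + 1) ∧
        ¬ GoodBounds k σ ρ a b δ n N₀ f ε z pt I (s + 1) ω} := by
    rintro ω ⟨t, ht, hω⟩
    obtain ⟨s, rfl⟩ := Nat.exists_eq_add_of_le' ht
    exact Set.mem_iUnion.2 ⟨s, hω⟩
  refine (measure_mono hsub).trans ((measure_iUnion_le _).trans ?_)
  refine (ENNReal.tsum_le_tsum fun s => hr.measure_fail_le h hf hσ hδ hδ' (by omega)).trans ?_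
  refine ENNReal.tsum_le_of_sum_range_le fun T => ?_
  have hpi := Real.pi_pos
  rw [← ENNReal.ofReal_sum_of_nonneg fun s _ => by positivity]
  refine ENNReal.ofReal_le_ofReal ?_
  rcases Nat.eq_zero_or_pos T with rfl | hT
  · simp only [Finset.range_zero, Finset.sum_empty]
    positivity
  have h1 : ∑ s ∈ Finset.range T, ((numSub n (s + 1) : ℝ) + 1) *
      (δ / (2 * Real.pi ^ 2 * ((s + 1 : ℕ) : ℝ) ^ 2)) ≤
      δ / (2 * Real.pi ^ 2) * ∑ t ∈ Finset.Icc 1 T, (√(t : ℝ) + 2) / (t : ℝ) ^ 2 := by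
    have e : ∑ t ∈ Finset.Icc 1 T, (√(t : ℝ) + 2) / (t : ℝ) ^ 2 = ∑ s ∈ Finset.range T,
        (√((s + 1 : ℕ) : ℝ) + 2) / ((s + 1 : ℕ) : ℝ) ^ 2 := by
      rw [Finset.range_eq_Ico, Finset.sum_Ico_add' (fun t : ℕ => (√(t : ℝ) + 2) / (t : ℝ) ^ 2) 0 T 1]
      rfl
    rw [e, Finset.mul_sum]
    refine Finset.sum_le_sum fun s _ => ?_
    have h2 := numSub_le hn (t := s + 1) (by omega)
    rw [← Real.sqrt_eq_rpow] at h2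
    calc ((numSub n (s + 1) : ℝ) + 1) * (δ / (2 * Real.pi ^ 2 * ((s + 1 : ℕ) : ℝ) ^ 2))
        ≤ (√((s + 1 : ℕ) : ℝ) + 2) * (δ / (2 * Real.pi ^ 2 * ((s + 1 : ℕ) : ℝ) ^ 2)) := by
          refine mul_le_mul_of_nonneg_right (by linarith) (by positivity)
      _ = _ := by field_simp
  refine h1.trans ?_
  have h3 := sum_sqrt_add_two_div_sq_le hT
  have h4 : (0 : ℝ) ≤ 2 / √(T : ℝ) := by positivity
  have h5 : (0 : ℝ) ≤ 2 / (T : ℝ) := by positivity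
  calc δ / (2 * Real.pi ^ 2) * ∑ t ∈ Finset.Icc 1 T, (√(t : ℝ) + 2) / (t : ℝ) ^ 2
      ≤ δ / (2 * Real.pi ^ 2) * 7 := mul_le_mul_of_nonneg_left (by linarith) (by positivity)
    _ ≤ 0.36 * δ := by
        rw [div_mul_eq_mul_div, div_le_iff₀ (by positivity)]
        have h6 : (9.8 : ℝ) ≤ Real.pi ^ 2 := by nlinarith [Real.pi_gt_d2]
        nlinarith

end Confidence

end

end LassoBO

namespace LassoBO

noncomputable section

open scoped ENNReal NNReal

set_option linter.unusedSectionVars false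

/-! ### Pathwise regret bounds -/

theorem sum_sqrt_le_sqrt_card_mul {ι : Type*} (s : Finset ι) {r : ι → ℝ} (hr : ∀ i, 0 ≤ r i) :
    ∑ i ∈ s, √(r i) ≤ √s.card * √(∑ i ∈ s, r i) := by
  rw [← Real.sqrt_mul (Nat.cast_nonneg _)]
  refine Real.le_sqrt_of_sq_le ?_
  refine (sq_sum_le_card_mul_sum_sq (s := s) (f := fun i => √(r i))).trans (le_of_eq ?_)
  congr 1
  exact Finset.sum_congr rfl fun i _ => Real.sq_sqrt (hr i)

section Scale

variable {D : ℕ} {ρ : Fin D → ℝ} {a b δ : ℝ}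

theorem sqrt_le_sqrt_iSup (ρ : Fin D → ℝ) (i : Fin D) : √(ρ i) ≤ √(⨆ i, ρ i) :=
  Real.sqrt_le_sqrt (le_ciSup (Set.finite_range ρ).bddAbove i)

theorem gridScale_eq (ρ : Fin D → ℝ) (a b δ : ℝ) (d t : ℕ) : gridScale ρ a b δ d t =
    4 * (t : ℝ) ^ 2 * ((b * √(Real.log (12 * D * a / δ))) * (d * √(⨆ i, ρ i))) := by
  unfold gridScale
  ring

theorem gridScale_mono (hb : 0 ≤ b) {d d' t t' : ℕ} (hd : d ≤ d') (ht : t ≤ t') :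
    gridScale ρ a b δ d t ≤ gridScale ρ a b δ d' t' := by
  have h1 : (d : ℝ) ≤ d' := by exact_mod_cast hd
  have h2 : (t : ℝ) ≤ t' := by exact_mod_cast ht
  unfold gridScale
  gcongr

theorem beta_mono (hb : 0 ≤ b) (hδ : 0 < δ) {d d' t t' : ℕ} (hd : d ≤ d') (ht0 : 1 ≤ t)
    (ht : t ≤ t') (h : 1 ≤ gridScale ρ a b δ d t) :
    beta ρ a b δ d t ≤ beta ρ a b δ d' t' := by
  have hg := gridScale_mono (ρ := ρ) (a := a) (δ := δ) hb hd ht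
  have h0 : (0 : ℝ) < t := by exact_mod_cast ht0
  have h1 : (d : ℝ) ≤ d' := by exact_mod_cast hd
  have h2 : (t : ℝ) ≤ t' := by exact_mod_cast ht
  have hpi := Real.pi_pos
  have h3 : Real.log (Real.pi ^ 2 * t ^ 2 / δ) ≤ Real.log (Real.pi ^ 2 * t' ^ 2 / δ) :=
    Real.log_le_log (by positivity) (by gcongr)
  have h4 : Real.log (gridScale ρ a b δ d t) ≤ Real.log (gridScale ρ a b δ d' t') :=
    Real.log_le_log (by linarith) hg
  have h5 := Real.log_nonneg h
  rw [beta_eq, beta_eq]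
  gcongr

/-- The contribution of at most `d` coordinates to the variation of a Lipschitz function. -/
theorem mul_sum_sqrt_le {J : Finset (Fin D)} {ℓ : ℝ} {d t : ℕ} (hℓ0 : 0 ≤ ℓ)
    (hℓ : ℓ ≤ b * √(Real.log (12 * D * a / δ))) (hJ : J.card ≤ d) (ht : 1 ≤ t) :
    ℓ * ∑ i ∈ J, √(ρ i) ≤ gridScale ρ a b δ d t / (4 * t ^ 2) := by
  have h0 : (0 : ℝ) < t := by exact_mod_cast ht
  have h1 : (J.card : ℝ) ≤ d := by exact_mod_cast hJ
  have h2 : ∑ i ∈ J, √(ρ i) ≤ d * √(⨆ i, ρ i) := by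
    calc ∑ i ∈ J, √(ρ i) ≤ ∑ _i ∈ J, √(⨆ i, ρ i) :=
          Finset.sum_le_sum fun i _ => sqrt_le_sqrt_iSup ρ i
      _ = J.card * √(⨆ i, ρ i) := by rw [Finset.sum_const, nsmul_eq_mul]
      _ ≤ _ := by gcongr
  rw [gridScale_eq, mul_div_cancel_left₀ _ (by positivity)]
  exact mul_le_mul hℓ h2 (Finset.sum_nonneg fun i _ => Real.sqrt_nonneg _) (hℓ0.trans hℓ)

end Scale

theorem CoordLip.sub_le_split {D : ℕ} {ρ : Fin D → ℝ} {ℓ : ℝ} {g : Cube D → ℝ}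
    (h : CoordLip ρ ℓ g) (hℓ : 0 ≤ ℓ) {x y : Cube D} (J : Finset (Fin D)) {r s : ℝ}
    (hr : ∀ i ∈ J, |(x i : ℝ) - y i| ≤ r) (hs : ∀ i ∉ J, |(x i : ℝ) - y i| ≤ s) :
    g x - g y ≤ (ℓ * ∑ i ∈ J, √(ρ i)) * r + (ℓ * ∑ i ∈ Jᶜ, √(ρ i)) * s := by
  refine (le_abs_self _).trans ((h x y).trans ?_)
  rw [← Finset.sum_add_sum_compl J, mul_add, mul_assoc, mul_assoc, Finset.sum_mul, Finset.sum_mul]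
  refine add_le_add ?_ ?_ <;> refine mul_le_mul_of_nonneg_left (Finset.sum_le_sum fun i hi => ?_) hℓ
  · exact mul_le_mul_of_nonneg_left (hr i hi) (Real.sqrt_nonneg _)
  · exact mul_le_mul_of_nonneg_left (hs i (Finset.mem_compl.1 hi)) (Real.sqrt_nonneg _)

theorem abs_unitInterval_sub_le (x y : unitInterval) : |(x : ℝ) - y| ≤ 1 :=
  abs_le.2 ⟨by linarith [x.2.1, y.2.2], by linarith [x.2.2, y.2.1]⟩

section Regret

variable {D : ℕ} {Ω S : Type*} [mΩ : MeasurableSpace Ω] [mS : MeasurableSpace S] {P : Measure Ω}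
  [IsProbabilityMeasure P] {k : Cube D → Cube D → ℝ} {ρ : Fin D → ℝ} {a b σ δ : ℝ} {n N₀ : ℕ}
  {f : Cube D → Ω → ℝ} {ε : ℕ → Ω → ℝ} {z : ℕ → ℕ → Ω → Cube D} {U : Ω → S}
  {pt : ℕ → Ω → Cube D} {I : ℕ → Ω → Finset (Fin D)} {inc : ℕ → Ω → ℕ}

/-- The regret of round `t` under the confidence bounds of this round. -/
theorem IsRun.sub_le_of_goodBounds (hr : IsRun k σ ρ a b δ n N₀ f ε z U pt I inc) {t : ℕ}
    (ht : 1 ≤ t) {ω : Ω} (hτ : 1 ≤ gridScale ρ a b δ (dMax I t ω) t)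
    (hgood : GoodBounds k σ ρ a b δ n N₀ f ε z pt I t ω) {ℓ : ℝ} (hℓ0 : 0 ≤ ℓ)
    (hℓ : ℓ ≤ b * √(Real.log (12 * D * a / δ))) (hlip : CoordLip ρ ℓ fun x => f x ω)
    (x : Cube D) :
    f x ω - f (pt (N₀ + (t - 1)) ω) ω ≤
      2 * √(beta ρ a b δ (dMax I t ω) t) *
        √(postVar k σ (N₀ + (t - 1)) (fun s => pt s ω) (pt (N₀ + (t - 1)) ω)) +
      7 / (8 * t ^ 2) + (ℓ * ∑ i ∈ (I t ω)ᶜ, √(ρ i)) *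
        sampleDist (I t ω) x (numSub n t) fun j => z t j ω := by
  have ht0 : (0 : ℝ) < t := by exact_mod_cast ht
  have hN := gridSize_pos hτ
  have hN' : (0 : ℝ) < gridSize ρ a b δ (dMax I t ω) t := by exact_mod_cast hN
  obtain ⟨hlow, hup⟩ := hgood
  obtain ⟨j, hj, hjd⟩ := exists_offDist_eq_sampleDist (I t ω) x (numSub_pos (n := n) ht)
    fun j => z t j ω
  choose v hv using fun i => exists_cellCentre hN (x i)
  let u : I t ω → Fin (gridSize ρ a b δ (dMax I t ω) t) := fun i => v i
  set ξ := gridPoint (I t ω) _ u (z t j ω) with hξ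
  have hmem : ξ ∈ searchSpace (I t ω)
      ({w | ∃ j < numSub n t, w = z t j ω} ∪ {pt (inc t ω) ω}) := by
    refine ⟨z t j ω, Or.inl ⟨j, hj, rfl⟩, fun i hi => ?_⟩
    simp [hξ, gridPoint, hi]
  have h1 := (hr.pt_argmax t ht ω).2 ξ hmem
  have h2 := hup j hj u
  have h3 := h2.trans h1
  rw [acquisition] at h3
  have h4 := hlip.sub_le_split hℓ0 (I t ω) (x := x) (y := ξ)
    (r := 1 / (2 * gridSize ρ a b δ (dMax I t ω) t))
    (s := sampleDist (I t ω) x (numSub n t) fun j => z t j ω)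
    (fun i hi => by simpa [hξ, gridPoint, hi, u] using hv i)
    (fun i hi => by
      rw [← hjd, abs_sub_comm]
      simpa [hξ, gridPoint, hi] using abs_sub_le_offDist (J := I t ω) x (z t j ω) hi)
  have h5 := mul_sum_sqrt_le (ρ := ρ) hℓ0 hℓ (card_le_dMax I ht ω) ht
  have h6 : (ℓ * ∑ i ∈ I t ω, √(ρ i)) * (1 / (2 * gridSize ρ a b δ (dMax I t ω) t)) ≤
      7 / (8 * t ^ 2) := by
    have h7 := le_gridSize ρ a b δ (dMax I t ω) t
    calc (ℓ * ∑ i ∈ I t ω, √(ρ i)) * (1 / (2 * gridSize ρ a b δ (dMax I t ω) t))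
        ≤ gridScale ρ a b δ (dMax I t ω) t / (4 * t ^ 2) *
          (1 / (2 * gridSize ρ a b δ (dMax I t ω) t)) :=
          mul_le_mul_of_nonneg_right h5 (by positivity)
      _ ≤ (7 * gridSize ρ a b δ (dMax I t ω) t) / (4 * t ^ 2) *
          (1 / (2 * gridSize ρ a b δ (dMax I t ω) t)) := by
          gcongr
          linarith
      _ = 7 / (8 * t ^ 2) := by
          field_simp
          norm_num
  linarith

/-- The regret of round `t` while the scale of the grid is small. -/
theorem sub_le_of_gridScale_le_one {t : ℕ} (ht : 1 ≤ t) {ω : Ω}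
    (hτ : gridScale ρ a b δ (dMax I t ω) t ≤ 1) {ℓ : ℝ} (hℓ0 : 0 ≤ ℓ)
    (hℓ : ℓ ≤ b * √(Real.log (12 * D * a / δ))) (hlip : CoordLip ρ ℓ fun x => f x ω)
    (x y : Cube D) :
    f x ω - f y ω ≤ 1 / (4 * t ^ 2) + ℓ * ∑ i ∈ (I t ω)ᶜ, √(ρ i) := by
  have ht0 : (0 : ℝ) < t := by exact_mod_cast ht
  have h4 := hlip.sub_le_split hℓ0 (I t ω) (x := x) (y := y) (r := 1) (s := 1)
    (fun i _ => abs_unitInterval_sub_le _ _) (fun i _ => abs_unitInterval_sub_le _ _)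
  have h5 := mul_sum_sqrt_le (ρ := ρ) hℓ0 hℓ (card_le_dMax I ht ω) ht
  have h6 : gridScale ρ a b δ (dMax I t ω) t / (4 * (t : ℝ) ^ 2) ≤ 1 / (4 * t ^ 2) := by gcongr
  simp only [mul_one] at h4
  linarith

theorem dMax_mono (I : ℕ → Ω → Finset (Fin D)) {t t' : ℕ} (h : t ≤ t') (ω : Ω) :
    dMax I t ω ≤ dMax I t' ω :=
  Finset.sup_mono (Finset.Icc_subset_Icc_right h)

/-- Bound on the cumulative regret of a path that satisfies a Lipschitz condition and the confidence
bounds. -/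
theorem IsRun.regret_le (hr : IsRun k σ ρ a b δ n N₀ f ε z U pt I inc) (hD : 2 ≤ D) (hb : 0 < b)
    (hδ : 0 < δ) (hρ : ∀ i, 0 < ρ i) {ω : Ω}
    (hgood : ∀ t ≥ 1, 1 ≤ gridScale ρ a b δ (dMax I t ω) t →
      GoodBounds k σ ρ a b δ n N₀ f ε z pt I t ω)
    {ℓ : ℝ} (hℓ0 : 0 ≤ ℓ) (hℓ : ℓ ≤ b * √(Real.log (12 * D * a / δ)))
    (hlip : CoordLip ρ ℓ fun x => f x ω) {x : ℕ → Cube D}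
    (hx : ∀ t ≥ 1, ∀ y, f y ω ≤ f (x t) ω + 1 / (8 * (t : ℝ) ^ 2)) (T : ℕ) :
    regret f pt N₀ T ω ≤
      √(beta ρ a b δ (dMax I T ω) T) * (∑ t ∈ Finset.Icc 1 T, 2 *
        √(postVar k σ (N₀ + (t - 1)) (fun s => pt s ω) (pt (N₀ + (t - 1)) ω))) +
      ∑ t ∈ Finset.Icc 1 T, 1 / (t : ℝ) ^ 2 +
      ∑ t ∈ Finset.Icc 1 T, (ℓ * √((I t ω)ᶜ.card) * √(∑ i ∈ (I t ω)ᶜ, ρ i)) *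
        cappedDist D t (sampleDist (I t ω) (x t) (numSub n t) fun j => z t j ω) := by
  classical
  set v : ℕ → ℝ := fun t => √(postVar k σ (N₀ + (t - 1)) (fun s => pt s ω) (pt (N₀ + (t - 1)) ω))
    with hv
  set r : ℕ → ℝ := fun t => (⨆ x, f x ω) - f (pt (N₀ + (t - 1)) ω) ω with hrdef
  set q : ℕ → ℝ := fun t => (ℓ * √((I t ω)ᶜ.card) * √(∑ i ∈ (I t ω)ᶜ, ρ i)) *
    cappedDist D t (sampleDist (I t ω) (x t) (numSub n t) fun j => z t j ω) with hq
  set B := √(beta ρ a b δ (dMax I T ω) T) with hB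
  have hv0 : ∀ t, 0 ≤ v t := fun t => Real.sqrt_nonneg _
  have hB0 : 0 ≤ B := Real.sqrt_nonneg _
  have hq0 : ∀ t, 0 ≤ q t := fun t =>
    mul_nonneg (by positivity) (cappedDist_nonneg (sampleDist_nonneg _ _ _ _))
  have hcs : ∀ t, ℓ * ∑ i ∈ (I t ω)ᶜ, √(ρ i) ≤
      ℓ * √((I t ω)ᶜ.card) * √(∑ i ∈ (I t ω)ᶜ, ρ i) := fun t => by
    rw [mul_assoc]
    exact mul_le_mul_of_nonneg_left (sum_sqrt_le_sqrt_card_mul _ fun i => (hρ i).le) hℓ0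
  have hle : ∀ (y : Cube D) (e : ℝ), (∀ x, f x ω - f y ω ≤ e) → (⨆ x, f x ω) - f y ω ≤ e := by
    intro y e h
    have : ⨆ x, f x ω ≤ e + f y ω := ciSup_le fun x => by linarith [h x]
    linarith
  have hlate : ∀ t ∈ Finset.Icc 1 T, 1 ≤ gridScale ρ a b δ (dMax I t ω) t →
      r t ≤ B * (2 * v t) + 1 / (t : ℝ) ^ 2 + q t := by
    intro t ht hτ
    obtain ⟨ht1, htT⟩ := Finset.mem_Icc.1 ht
    have ht0 : (0 : ℝ) < t := by exact_mod_cast ht1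
    refine hle _ _ fun y => ?_
    have h1 := hr.sub_le_of_goodBounds ht1 hτ (hgood t ht1 hτ) hℓ0 hℓ hlip (x t)
    have h2 := hx t ht1 y
    have h3 : √(beta ρ a b δ (dMax I t ω) t) ≤ B :=
      Real.sqrt_le_sqrt (beta_mono hb.le hδ (dMax_mono I htT ω) ht1 htT hτ)
    have h4 : (ℓ * ∑ i ∈ (I t ω)ᶜ, √(ρ i)) *
        (sampleDist (I t ω) (x t) (numSub n t) fun j => z t j ω) ≤ q t :=
      mul_le_mul (hcs t) (le_cappedDist (sampleDist_le_one _ _ (numSub_pos ht1) _))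
        (sampleDist_nonneg _ _ _ _) (by positivity)
    have h5 : 2 * √(beta ρ a b δ (dMax I t ω) t) * v t ≤ B * (2 * v t) := by
      have := mul_le_mul_of_nonneg_right h3 (hv0 t)
      linarith
    have h6 : 7 / (8 * (t : ℝ) ^ 2) + 1 / (8 * (t : ℝ) ^ 2) = 1 / (t : ℝ) ^ 2 := by
      field_simp
      norm_num
    simp only [hv] at h5 ⊢
    linarith
  set E := (Finset.Icc 1 T).filter fun t => ¬ 1 ≤ gridScale ρ a b δ (dMax I t ω) t with hE
  set L := (Finset.Icc 1 T).filter fun t => 1 ≤ gridScale ρ a b δ (dMax I t ω) t with hL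
  have hsplit : ∀ g : ℕ → ℝ, ∑ t ∈ Finset.Icc 1 T, g t = ∑ t ∈ L, g t + ∑ t ∈ E, g t := fun g =>
    (Finset.sum_filter_add_sum_filter_not _ _ _).symm
  have hEsub : ∀ t ∈ E, Finset.Icc 1 t ⊆ E := by
    intro t ht s hs
    obtain ⟨ht1, ht2⟩ := Finset.mem_filter.1 ht
    obtain ⟨hs1, hs2⟩ := Finset.mem_Icc.1 hs
    refine Finset.mem_filter.2 ⟨Finset.mem_Icc.2 ⟨hs1, hs2.trans (Finset.mem_Icc.1 ht1).2⟩, ?_⟩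
    exact fun h => ht2 (h.trans (gridScale_mono hb.le (dMax_mono I hs2 ω) hs2))
  have hEle : ∀ t ∈ E, t ≤ E.card := by
    intro t ht
    simpa using Finset.card_le_card (hEsub t ht)
  have hearly : ∑ t ∈ E, r t ≤ ∑ t ∈ E, (B * (2 * v t) + 1 / (t : ℝ) ^ 2 + q t) := by
    rcases E.eq_empty_or_nonempty with h0 | hne
    · simp [h0]
    have hcard : 1 ≤ E.card := hne.card_pos
    have hmem : ∀ t, 1 ≤ t → t ≤ E.card → t ∈ E := by
      have hEeq : E = Finset.Icc 1 E.card := by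
        refine Finset.eq_of_subset_of_card_le (fun t ht => ?_) (by rw [Nat.card_Icc]; omega)
        exact Finset.mem_Icc.2 ⟨(Finset.mem_Icc.1 (Finset.mem_filter.1 ht).1).1, hEle t ht⟩
      intro t h1 h2
      have h3 := Finset.mem_Icc.2 ⟨h1, h2⟩
      rwa [← hEeq] at h3
    have hmemE : E.card ∈ E := hmem _ hcard le_rfl
    by_cases hbig : D ≤ 4 * E.card
    · have hτe := (Finset.mem_filter.1 hmemE).2
      rw [not_le, gridScale_eq] at hτe
      have he0 : (1 : ℝ) ≤ E.card := by exact_mod_cast hcard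
      have hd1 : (1 : ℝ) ≤ dMax I E.card ω := by
        have h1 := card_le_dMax I hcard ω
        have h2 := (hr.select_nonempty E.card hcard ω).card_pos
        exact_mod_cast h2.trans_le h1
      set G := b * √(Real.log (12 * D * a / δ)) with hG
      have hG0 : 0 ≤ G := hℓ0.trans hℓ
      have hs0 : 0 ≤ √(⨆ i, ρ i) := Real.sqrt_nonneg _
      have h1 : 4 * (E.card : ℝ) ^ 2 * (G * √(⨆ i, ρ i)) ≤ 1 := by
        refine le_trans ?_ hτe.le
        have h2 : G * √(⨆ i, ρ i) ≤ G * (dMax I E.card ω * √(⨆ i, ρ i)) :=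
          mul_le_mul_of_nonneg_left (le_mul_of_one_le_left hs0 hd1) hG0
        exact mul_le_mul_of_nonneg_left h2 (by positivity)
      have hrE : ∀ t ∈ E, r t ≤ D * (G * √(⨆ i, ρ i)) := by
        intro t _
        refine hle _ _ fun y => ?_
        have h3 := hlip.sub_le_split hℓ0 Finset.univ (x := y) (y := pt (N₀ + (t - 1)) ω) (r := 1)
          (s := 0) (fun i _ => abs_unitInterval_sub_le _ _) (fun i hi => by simp at hi)
        have h4 : ∑ i, √(ρ i) ≤ D * √(⨆ i, ρ i) := by
          calc ∑ i, √(ρ i) ≤ ∑ _i : Fin D, √(⨆ i, ρ i) :=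
                Finset.sum_le_sum fun i _ => sqrt_le_sqrt_iSup ρ i
            _ = _ := by simp
        have h5 : ℓ * ∑ i, √(ρ i) ≤ G * (D * √(⨆ i, ρ i)) :=
          mul_le_mul hℓ h4 (Finset.sum_nonneg fun i _ => Real.sqrt_nonneg _) hG0
        simp only [mul_one, mul_zero, add_zero] at h3
        linarith
      have hDe : (D : ℝ) ≤ 4 * E.card := by exact_mod_cast hbig
      have h6 : ∑ t ∈ E, r t ≤ 1 := by
        refine (Finset.sum_le_sum hrE).trans ?_
        rw [Finset.sum_const, nsmul_eq_mul]
        calc (E.card : ℝ) * (D * (G * √(⨆ i, ρ i)))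
            ≤ E.card * (4 * E.card * (G * √(⨆ i, ρ i))) := by gcongr
          _ = 4 * (E.card : ℝ) ^ 2 * (G * √(⨆ i, ρ i)) := by ring
          _ ≤ 1 := h1
      have h1E : 1 ∈ E := hmem 1 le_rfl hcard
      refine h6.trans ?_
      have h7 : ∀ t ∈ E, 0 ≤ B * (2 * v t) + 1 / (t : ℝ) ^ 2 + q t := fun t _ => by
        have := hv0 t
        have := hq0 t
        positivity
      refine le_trans ?_ (Finset.single_le_sum h7 h1E)
      have := hv0 1
      have := hq0 1
      have h8 : 0 ≤ B * (2 * v 1) := by positivity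
      push_cast
      linarith
    · refine Finset.sum_le_sum fun t ht => ?_
      have ht1 := (Finset.mem_Icc.1 (Finset.mem_filter.1 ht).1).1
      have ht0 : (0 : ℝ) < t := by exact_mod_cast ht1
      have htD : t ≤ 2 ^ (D - 1) := by
        have h1 := hEle t ht
        have h2 : D - 1 < 2 ^ (D - 1) := Nat.lt_two_pow_self
        omega
      refine hle _ _ fun y => ?_
      have h1 := sub_le_of_gridScale_le_one ht1 (not_le.1 (Finset.mem_filter.1 ht).2).le hℓ0 hℓ hlip
        y (pt (N₀ + (t - 1)) ω)
      have h2 : q t = ℓ * √((I t ω)ᶜ.card) * √(∑ i ∈ (I t ω)ᶜ, ρ i) := by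
        simp [hq, cappedDist, htD]
      have h3 := hcs t
      have h4 : 1 / (4 * (t : ℝ) ^ 2) ≤ 1 / (t : ℝ) ^ 2 :=
        one_div_le_one_div_of_le (by positivity) (by nlinarith [sq_nonneg (t : ℝ)])
      have h5 := mul_nonneg hB0 (mul_nonneg two_pos.le (hv0 t))
      linarith
  have hlateSum : ∑ t ∈ L, r t ≤ ∑ t ∈ L, (B * (2 * v t) + 1 / (t : ℝ) ^ 2 + q t) :=
    Finset.sum_le_sum fun t ht => hlate t (Finset.mem_filter.1 ht).1 (Finset.mem_filter.1 ht).2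
  have htotal := add_le_add hlateSum hearly
  rw [← hsplit, ← hsplit, Finset.sum_add_distrib, Finset.sum_add_distrib, ← Finset.mul_sum] at htotal
  exact htotal

end Regret

end

end LassoBO

namespace LassoBO

noncomputable section

open scoped ENNReal NNReal

set_option linter.unusedSectionVars false

/-! ### Regret bound with high probability -/

theorem pow_self_le_factorial_sq (m : ℕ) : m ^ m ≤ m.factorial ^ 2 := by
  have h1 : ∏ i ∈ Finset.range m, (m - i) = m.factorial := by
    rw [← Finset.prod_range_add_one_eq_factorial, ← Finset.prod_range_reflect]
    refine Finset.prod_congr rfl fun i hi => ?_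
    have := Finset.mem_range.1 hi
    omega
  calc m ^ m = ∏ _i ∈ Finset.range m, m := by simp
    _ ≤ ∏ i ∈ Finset.range m, ((i + 1) * (m - i)) := by
        refine Finset.prod_le_prod' fun i hi => ?_
        have := Finset.mem_range.1 hi
        obtain ⟨c, rfl⟩ := Nat.exists_eq_add_of_lt this
        have e : i + c + 1 - i = c + 1 := by omega
        rw [e]
        nlinarith [Nat.zero_le (i * c)]
    _ = m.factorial ^ 2 := by
        rw [Finset.prod_mul_distrib, Finset.prod_range_add_one_eq_factorial, h1, sq]

theorem sqrt_le_factorial_rpow {m : ℕ} (hm : 1 ≤ m) :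
    √(m : ℝ) ≤ ((m + 1).factorial : ℝ) ^ ((1 : ℝ) / m) := by
  have hm0 : (0 : ℝ) < m := by exact_mod_cast hm
  have h1 : √(m : ℝ) ^ m ≤ ((m + 1).factorial : ℝ) := by
    have h2 : √(m : ℝ) ^ m ≤ (m.factorial : ℝ) := by
      refine le_of_sq_le_sq ?_ (Nat.cast_nonneg _)
      rw [← pow_mul, mul_comm, pow_mul, Real.sq_sqrt hm0.le]
      exact_mod_cast pow_self_le_factorial_sq m
    exact h2.trans (by exact_mod_cast Nat.factorial_le (Nat.le_succ m))
  calc √(m : ℝ) = (√(m : ℝ) ^ m) ^ ((1 : ℝ) / m) := by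
        rw [← Real.rpow_natCast, ← Real.rpow_mul (Real.sqrt_nonneg _), mul_one_div_cancel hm0.ne',
          Real.rpow_one]
    _ ≤ _ := Real.rpow_le_rpow (by positivity) h1 (by positivity)

theorem log_six_div_ge {δ : ℝ} (hδ : 0 < δ) (hδ' : δ < 1) : 1.69 ≤ Real.log (6 / δ) := by
  have h1 : Real.log 6 ≤ Real.log (6 / δ) := by
    refine Real.log_le_log (by norm_num) ?_
    rw [le_div_iff₀ hδ]
    linarith
  have h2 : Real.log 6 = Real.log 2 + Real.log 3 := by
    rw [← Real.log_mul (by norm_num) (by norm_num)]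
    norm_num
  have h3 : (1 : ℝ) ≤ Real.log 3 := by
    rw [Real.le_log_iff_exp_le (by norm_num)]
    linarith [Real.exp_one_lt_d9]
  have := Real.log_two_gt_d9
  linarith

theorem le_coef {D : ℕ} {a b δ : ℝ} (hb : 0 < b) (hδ : 0 < δ) (hδ' : δ < 1) {d : ℕ} (hd : d < D) :
    2 * Real.log (6 / δ) * (b * √(Real.log (2 * D * a / δ)) * √((D - d : ℕ) : ℝ)) ≤
      coef D a b δ d := by
  have h1 := sqrt_le_factorial_rpow (m := D - d) (by omega)
  have h2 := log_six_div_ge hδ hδ'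
  rw [Nat.cast_sub hd.le] at h1 ⊢
  unfold coef
  have h3 : 0 ≤ 2 * Real.log (6 / δ) * (b * √(Real.log (2 * D * a / δ))) := by positivity
  have h4 := mul_le_mul_of_nonneg_left h1 h3
  linarith

theorem coef_nonneg {D : ℕ} {a b δ : ℝ} (hb : 0 < b) (hδ : 0 < δ) (hδ' : δ < 1) (d : ℕ) :
    0 ≤ coef D a b δ d := by
  have h2 := log_six_div_ge hδ hδ'
  unfold coef
  positivity

/-- Bound for the partial sums of a divergent `p`-series. -/
theorem sum_rpow_neg_le {s : ℝ} (hs0 : 0 < s) (hs1 : s < 1) (T : ℕ) :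
    (1 - s) * ∑ t ∈ Finset.Icc 1 T, (t : ℝ) ^ (-s) ≤ (T : ℝ) ^ (1 - s) := by
  induction T with
  | zero =>
    simp only [Nat.lt_one_iff, pos_of_gt, Finset.Icc_eq_empty_of_lt, Finset.sum_empty, mul_zero]
    positivity
  | succ T ih =>
    rw [Finset.sum_Icc_succ_top (by omega), mul_add]
    have hT0 : (0 : ℝ) < ((T + 1 : ℕ) : ℝ) := by positivity
    set N : ℝ := ((T + 1 : ℕ) : ℝ) with hN
    have hTN : (T : ℝ) = N * (1 + -(1 / N)) := by
      rw [hN]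
      push_cast
      field_simp
      ring
    have h1N : 1 / N ≤ 1 := by
      rw [div_le_one hT0, hN]
      push_cast
      linarith [(Nat.cast_nonneg T : (0 : ℝ) ≤ T)]
    have hb := rpow_one_add_le_one_add_mul_self (s := -(1 / N)) (p := 1 - s) (by linarith)
      (by linarith) (by linarith)
    have h2 : (T : ℝ) ^ (1 - s) ≤ N ^ (1 - s) - (1 - s) * N ^ (-s) := by
      rw [hTN, Real.mul_rpow hT0.le (by linarith)]
      have e : N ^ (-s) = N ^ (1 - s) * (1 / N) := by
        rw [show -s = (1 - s) - 1 by ring, Real.rpow_sub_one hT0.ne']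
        ring
      rw [e]
      have := mul_le_mul_of_nonneg_left hb (Real.rpow_nonneg hT0.le (1 - s))
      linarith
    linarith

theorem one_sub_le_measureReal {Ω : Type*} [MeasurableSpace Ω] {P : Measure Ω}
    [IsProbabilityMeasure P] {A B : Set Ω} {δ : ℝ} (hδ : 0 ≤ δ) (h : ∀ ω, ω ∉ B → ω ∈ A)
    (hB : P B ≤ ENNReal.ofReal δ) : 1 - δ ≤ P.real A := by
  have h1 : (Set.univ : Set Ω) ⊆ A ∪ B := fun ω _ => or_iff_not_imp_right.2 (h ω)
  have h2 := (measureReal_mono (μ := P) h1).trans (measureReal_union_le A B)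
  rw [probReal_univ] at h2
  have h3 : P.real B ≤ δ := ENNReal.toReal_le_of_le_ofReal hδ hB
  linarith

section Main

variable {D : ℕ} {Ω S : Type*} [mΩ : MeasurableSpace Ω] [mS : MeasurableSpace S] {P : Measure Ω}
  [IsProbabilityMeasure P] {k : Cube D → Cube D → ℝ} {ρ : Fin D → ℝ} {a b σ κ δ c₀ : ℝ} {n N₀ : ℕ}
  {f : Cube D → Ω → ℝ} {ε : ℕ → Ω → ℝ} {z : ℕ → ℕ → Ω → Cube D} {U : Ω → S}
  {pt : ℕ → Ω → Cube D} {I : ℕ → Ω → Finset (Fin D)} {inc : ℕ → Ω → ℕ}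

theorem two_le_of_two_lt_mul (hnD : 2 < (n : ℝ) * ((D : ℝ) - 1)) : 2 ≤ D := by
  by_contra hcon
  have h1 : (D : ℝ) ≤ 1 := by exact_mod_cast (by omega : D ≤ 1)
  have h2 : (0 : ℝ) ≤ n := Nat.cast_nonneg _
  nlinarith

theorem IsRun.card_lt (hr : IsRun k σ ρ a b δ n N₀ f ε z U pt I inc) {t : ℕ} (ht : 1 ≤ t) (ω : Ω) :
    (I t ω).card < D := by
  have := (Finset.card_lt_iff_ne_univ (I t ω)).2 (hr.select_proper t ht ω)
  simpa using this

theorem coef_le_constC (a b δ : ℝ) (I : ℕ → Ω → Finset (Fin D)) {T t : ℕ}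
    (ht : t ∈ Finset.Icc 1 T) (ω : Ω) : coef D a b δ (I t ω).card ≤ constC a b δ I T ω :=
  le_ciSup (f := fun t : Finset.Icc 1 T => coef D a b δ (I t ω).card)
    (Set.finite_range _).bddAbove ⟨t, ht⟩

theorem IsRun.constC_le_worstC (hr : IsRun k σ ρ a b δ n N₀ f ε z U pt I inc) {T : ℕ}
    (hT : 1 ≤ T) (ω : Ω) : constC a b δ I T ω ≤ worstC D a b δ := by
  have : Nonempty (Finset.Icc 1 T) := ⟨⟨1, by simp [hT]⟩⟩
  refine ciSup_le fun t => ?_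
  have ht := (Finset.mem_Icc.1 t.2).1
  have h1 := hr.card_lt ht ω
  have h2 := (hr.select_nonempty t ht ω).card_pos
  exact le_ciSup (f := fun d : Finset.Icc 1 (D - 1) => coef D a b δ d)
    (Set.finite_range _).bddAbove ⟨(I t ω).card, Finset.mem_Icc.2 ⟨h2, by omega⟩⟩

theorem worstC_nonneg (hb : 0 < b) (hδ : 0 < δ) (hδ' : δ < 1) : 0 ≤ worstC D a b δ :=
  Real.iSup_nonneg fun d => coef_nonneg hb hδ hδ' d

/-- The worst case of the additional term. -/
theorem IsRun.extraTerm_le (hr : IsRun k σ ρ a b δ n N₀ f ε z U pt I inc) (hb : 0 < b)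
    (hδ : 0 < δ) (hδ' : δ < 1) (hρ : ∀ i, 0 < ρ i) {T : ℕ} (hT : 1 ≤ T) (ω : Ω) :
    extraTerm ρ a b δ c₀ n I T ω ≤ worstC D a b δ * √c₀ * √(∑ i, ρ i) *
        (T : ℝ) ^ (1 - 1 / (n * ((D : ℝ) - 1))) := by
  have hT0 : (0 : ℝ) < T := by exact_mod_cast hT
  have h1 : √(∑ t ∈ Finset.Icc 1 T, ∑ i ∈ (I t ω)ᶜ, ρ i) ≤ (T : ℝ) ^ ((1 : ℝ) / 2) * √(∑ i, ρ i) := by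
    rw [← Real.sqrt_eq_rpow, ← Real.sqrt_mul hT0.le]
    refine Real.sqrt_le_sqrt ?_
    calc ∑ t ∈ Finset.Icc 1 T, ∑ i ∈ (I t ω)ᶜ, ρ i ≤ ∑ _t ∈ Finset.Icc 1 T, ∑ i, ρ i :=
          Finset.sum_le_sum fun t _ => Finset.sum_le_sum_of_subset_of_nonneg
            (Finset.subset_univ _) fun i _ _ => (hρ i).le
      _ = T * ∑ i, ρ i := by simp
  have h2 : (T : ℝ) ^ (1 - 1 / (n * ((D : ℝ) - 1))) =
      (T : ℝ) ^ ((1 : ℝ) / 2) * (T : ℝ) ^ ((1 : ℝ) / 2 - 1 / (n * ((D : ℝ) - 1))) := by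
    rw [← Real.rpow_add hT0]
    congr 1
    ring
  have h3 := hr.constC_le_worstC hT ω
  have h4 := worstC_nonneg (D := D) (a := a) hb hδ hδ'
  rw [extraTerm, h2]
  calc constC a b δ I T ω * √c₀ * √(∑ t ∈ Finset.Icc 1 T, ∑ i ∈ (I t ω)ᶜ, ρ i) *
        (T : ℝ) ^ ((1 : ℝ) / 2 - 1 / (n * ((D : ℝ) - 1)))
      ≤ worstC D a b δ * √c₀ * ((T : ℝ) ^ ((1 : ℝ) / 2) * √(∑ i, ρ i)) *
        (T : ℝ) ^ ((1 : ℝ) / 2 - 1 / (n * ((D : ℝ) - 1))) := by gcongr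
    _ = _ := by ring

/-- Approximate maximizers of the objective function. -/
def target (hf : IsGPSample P k ρ a b f) (t : ℕ) (ω : Ω) : Cube D :=
  nearArgmax (η := 1 / (8 * ((t : ℝ) + 1) ^ 2)) (by positivity) (hf.path ω)

theorem le_target (hf : IsGPSample P k ρ a b f) {t : ℕ} (ht : 1 ≤ t) (ω : Ω) (y : Cube D) :
    f y ω ≤ f (target hf t ω) ω + 1 / (8 * (t : ℝ) ^ 2) := by
  have h1 := le_nearArgmax (η := 1 / (8 * ((t : ℝ) + 1) ^ 2)) (by positivity) (hf.path ω) y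
  have ht0 : (0 : ℝ) < t := by exact_mod_cast ht
  have h2 : 1 / (8 * ((t : ℝ) + 1) ^ 2) ≤ 1 / (8 * (t : ℝ) ^ 2) := by
    gcongr
    linarith
  simp only [IsGPSample.path_apply] at h1
  unfold target
  linarith

theorem measurable_target (hf : IsGPSample P k ρ a b f) (t : ℕ) :
    Measurable[nonSampleInfo f hf ε z U t] (target hf t) :=
  (measurable_nearArgmax _).comp (measurable_path_nonSampleInfo hf t)

theorem IsRun.measurableSet_mem_nonSampleInfo (hr : IsRun k σ ρ a b δ n N₀ f ε z U pt I inc)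
    (hf : IsGPSample P k ρ a b f) {t : ℕ} (ht : 1 ≤ t) (i : Fin D) :
    MeasurableSet[nonSampleInfo f hf ε z U t] {ω | i ∈ I t ω} :=
  hr.pastInfo_le_nonSampleInfo hf ht _ (hr.select_measurable t ht i)

theorem lipConst_mono (hb : 0 < b) (ha : 0 < a) (hδ : 0 < δ) {c c' : ℝ} (hc : 0 < c) (h : c ≤ c') :
    b * √(Real.log (c * D * a / δ)) ≤ b * √(Real.log (c' * D * a / δ)) := by
  refine mul_le_mul_of_nonneg_left (Real.sqrt_le_sqrt ?_) hb.le
  rcases D.eq_zero_or_pos with rfl | hD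
  · simp
  · have hD' : (0 : ℝ) < D := by exact_mod_cast hD
    exact Real.log_le_log (by positivity) (by gcongr)

theorem IsModel.sum_sqrt_postVar_le_sqrt (h : IsModel P σ f ε z U) (hf : IsGPSample P k ρ a b f)
    (hσ : 0 < σ) (X : ℕ → Cube D) (N₀ T : ℕ) :
    ∑ t ∈ Finset.Icc 1 T, 2 * √(postVar k σ (N₀ + (t - 1)) X (X (N₀ + (t - 1)))) ≤
      √(T * (4 * ∑ s ∈ Finset.range T, postVar k σ (N₀ + s) X (X (N₀ + s)))) := by
  refine Real.le_sqrt_of_sq_le ?_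
  refine (sq_sum_le_card_mul_sum_sq).trans (le_of_eq ?_)
  have e : ∑ t ∈ Finset.Icc 1 T, (2 * √(postVar k σ (N₀ + (t - 1)) X (X (N₀ + (t - 1))))) ^ 2 =
      4 * ∑ s ∈ Finset.range T, postVar k σ (N₀ + s) X (X (N₀ + s)) := by
    rw [Finset.range_eq_Ico, Finset.mul_sum]
    have := Finset.sum_Ico_add' (fun t : ℕ => 4 * postVar k σ (N₀ + (t - 1)) X (X (N₀ + (t - 1)))) 0 T 1
    simp only [add_tsub_cancel_right, zero_add] at this
    rw [this]
    refine Finset.sum_congr rfl fun t _ => ?_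
    rw [mul_pow, Real.sq_sqrt (h.postVar_nonneg hf hσ X _ _)]
    norm_num
  rw [e, Nat.card_Icc, Nat.add_sub_cancel]

theorem IsModel.sum_sqrt_postVar_le (h : IsModel P σ f ε z U) (hf : IsGPSample P k ρ a b f)
    (hσ : 0 < σ) (hκ : 0 < κ) (hk : ∀ x, k x x ≤ κ) (X : ℕ → Cube D) (N₀ T : ℕ) :
    ∑ t ∈ Finset.Icc 1 T, 2 * √(postVar k σ (N₀ + (t - 1)) X (X (N₀ + (t - 1)))) ≤
      √(C₁ κ σ * T * maxInfoGain P f σ T) := by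
  refine (h.sum_sqrt_postVar_le_sqrt hf hσ X N₀ T).trans (Real.sqrt_le_sqrt ?_)
  have h1 := mul_le_mul_of_nonneg_left (h.sum_postVar_le hf hσ hκ hk X N₀ T)
    (Nat.cast_nonneg (α := ℝ) T)
  linarith

theorem IsRun.regret_bound (hr : IsRun k σ ρ a b δ n N₀ f ε z U pt I inc)
    (h : IsModel P σ f ε z U) (hf : IsGPSample P k ρ a b f) (hσ : 0 < σ) (hκ : 0 < κ)
    (hk : ∀ x, k x x ≤ κ) (ha : 0 < a) (hb : 0 < b) (hδ : 0 < δ) (hδ' : δ < 1)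
    (hρ : ∀ i, 0 < ρ i) (hn : 1 < n) (hnD : 2 < (n : ℝ) * ((D : ℝ) - 1))
    (hc₀ : (n : ℝ) * ((D : ℝ) - 1) / (n * ((D : ℝ) - 1) - 2) < c₀) {T : ℕ} (hT : 1 ≤ T) :
    1 - δ ≤ P.real {ω | regret f pt N₀ T ω ≤
        √(beta ρ a b δ (dMax I T ω) T * C₁ κ σ * T * maxInfoGain P f σ T) +
          Real.pi ^ 2 / 6 + extraTerm ρ a b δ c₀ n I T ω} := by
  have hD := two_le_of_two_lt_mul hnD
  have hT0 : (0 : ℝ) < T := by exact_mod_cast hT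
  set s : ℝ := 2 * ((1 : ℝ) / (n * ((D : ℝ) - 1))) with hs
  have hs0 : 0 < s := by positivity
  have hs1 : s < 1 := by
    rw [hs, mul_one_div, div_lt_one (by linarith)]
    exact hnD
  set ℓ := Real.log (6 / δ) with hℓ
  have hℓ1 := log_six_div_ge hδ hδ'
  rw [← hℓ] at hℓ1
  set L := b * √(Real.log (2 * D * a / δ)) with hL
  have hL0 : 0 ≤ L := by positivity
  set B₁ := {ω | CoordLip ρ L fun x => f x ω}ᶜ with hB₁
  set B₂ := {ω | ∃ t ≥ 1, 1 ≤ gridScale ρ a b δ (dMax I t ω) t ∧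
    ¬ GoodBounds k σ ρ a b δ n N₀ f ε z pt I t ω} with hB₂
  set B₃ := {ω | 4 * ℓ ^ 2 * ∑ t ∈ Finset.Icc 1 T, (t : ℝ) ^ (-s) <
      ∑ t ∈ Finset.Icc 1 T, cappedDist D t
        (sampleDist (I t ω) (target hf t ω) (numSub n t) fun j => z t j ω) ^ 2} with hB₃
  have hP₁ : P B₁ ≤ ENNReal.ofReal (δ / 2) :=
    hf.measure_not_coordLip_le ha hb hδ two_pos (by omega)
  have hP₂ : P B₂ ≤ ENNReal.ofReal (0.36 * δ) := hr.measure_exists_fail_le h hf hσ hδ hδ' hn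
  have hP₃ : P B₃ ≤ ENNReal.ofReal (0.12 * δ) := by
    refine (h.measure_sum_cappedDist_sq hf hD hn (fun t _ => measurable_target hf t)
      (fun t ht => hr.measurableSet_mem_nonSampleInfo hf ht) (fun t ht => hr.select_nonempty t ht)
      (by linarith) hT).trans (ENNReal.ofReal_le_ofReal ?_)
    rw [hℓ, Real.exp_neg, Real.exp_log (by positivity), ← hℓ, div_le_iff₀ (by positivity), inv_div]
    have : (1.69 : ℝ) ^ 2 ≤ ℓ ^ 2 := pow_le_pow_left₀ (by norm_num) hℓ1 2
    nlinarith
  refine one_sub_le_measureReal hδ.le (B := B₁ ∪ (B₂ ∪ B₃)) (fun ω hω => ?_) ?_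
  swap
  · refine (measure_union_le _ _).trans ((add_le_add hP₁ ((measure_union_le _ _).trans
      (add_le_add hP₂ hP₃))).trans ?_)
    rw [← ENNReal.ofReal_add (by positivity) (by positivity),
      ← ENNReal.ofReal_add (by positivity) (by positivity)]
    exact ENNReal.ofReal_le_ofReal (by linarith)
  simp only [Set.mem_union, not_or] at hω
  obtain ⟨h₁, h₂, h₃⟩ := hω
  have hlip : CoordLip ρ L fun x => f x ω := not_not.1 h₁
  have hgood : ∀ t ≥ 1, 1 ≤ gridScale ρ a b δ (dMax I t ω) t →
      GoodBounds k σ ρ a b δ n N₀ f ε z pt I t ω := by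
    intro t ht hτ
    by_contra hcon
    exact h₂ ⟨t, ht, hτ, hcon⟩
  have hreg := hr.regret_le hD hb hδ hρ hgood hL0
    (lipConst_mono hb ha hδ two_pos (by norm_num)) hlip
    (x := fun t => target hf t ω) (fun t ht y => le_target hf ht ω y) T
  have hvar := h.sum_sqrt_postVar_le hf hσ hκ hk (fun s => pt s ω) N₀ T
  have hpart1 : √(beta ρ a b δ (dMax I T ω) T) * (∑ t ∈ Finset.Icc 1 T, 2 *
      √(postVar k σ (N₀ + (t - 1)) (fun s => pt s ω) (pt (N₀ + (t - 1)) ω))) ≤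
      √(beta ρ a b δ (dMax I T ω) T * C₁ κ σ * T * maxInfoGain P f σ T) := by
    have hlog : 0 ≤ Real.log (1 + κ / σ ^ 2) := Real.log_nonneg (by
      have : 0 < κ / σ ^ 2 := by positivity
      linarith)
    have hnn : 0 ≤ C₁ κ σ * T * maxInfoGain P f σ T := by
      unfold C₁ maxInfoGain
      positivity
    rw [mul_assoc, mul_assoc, ← mul_assoc (C₁ κ σ), Real.sqrt_mul' _ hnn]
    exact mul_le_mul_of_nonneg_left hvar (Real.sqrt_nonneg _)
  have hpart2 : ∑ t ∈ Finset.Icc 1 T, 1 / (t : ℝ) ^ 2 ≤ Real.pi ^ 2 / 6 :=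
    sum_le_hasSum _ (fun t _ => by positivity) hasSum_zeta_two
  set d : ℕ → ℝ := fun t => cappedDist D t
    (sampleDist (I t ω) (target hf t ω) (numSub n t) fun j => z t j ω) with hd
  set V : ℕ → ℝ := fun t => ∑ i ∈ (I t ω)ᶜ, ρ i with hV
  have hV0 : ∀ t, 0 ≤ V t := fun t => Finset.sum_nonneg fun i _ => (hρ i).le
  have hd0 : ∀ t, 0 ≤ d t := fun t => cappedDist_nonneg (sampleDist_nonneg _ _ _ _)
  have hC0 : 0 ≤ constC a b δ I T ω :=
    (coef_nonneg hb hδ hδ' _).trans (coef_le_constC a b δ I (t := 1) (by simp [hT]) ω)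
  have hpart3 : ∑ t ∈ Finset.Icc 1 T, (L * √((I t ω)ᶜ.card) * √(V t)) * d t ≤
      extraTerm ρ a b δ c₀ n I T ω := by
    have h4 : ∀ t ∈ Finset.Icc 1 T, (L * √((I t ω)ᶜ.card) * √(V t)) * d t ≤
        constC a b δ I T ω / (2 * ℓ) * (√(V t) * d t) := by
      intro t ht
      have h5 : L * √((I t ω)ᶜ.card) ≤ constC a b δ I T ω / (2 * ℓ) := by
        rw [le_div_iff₀ (by linarith), Finset.card_compl, Fintype.card_fin]
        have h6 := le_coef (a := a) hb hδ hδ' (hr.card_lt (Finset.mem_Icc.1 ht).1 ω)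
        have h7 := coef_le_constC a b δ I ht ω
        rw [← hL, ← hℓ] at h6
        linarith
      rw [mul_assoc]
      exact mul_le_mul_of_nonneg_right h5 (mul_nonneg (Real.sqrt_nonneg _) (hd0 t))
    have h6 : ∑ t ∈ Finset.Icc 1 T, √(V t) * d t ≤
        √(∑ t ∈ Finset.Icc 1 T, V t) * √(∑ t ∈ Finset.Icc 1 T, d t ^ 2) := by
      have := Real.sum_mul_le_sqrt_mul_sqrt (Finset.Icc 1 T) (fun t => √(V t)) d
      simpa only [Real.sq_sqrt (hV0 _)] using this
    have h7 : √(∑ t ∈ Finset.Icc 1 T, d t ^ 2) ≤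
        2 * ℓ * (√c₀ * (T : ℝ) ^ ((1 : ℝ) / 2 - 1 / (n * ((D : ℝ) - 1)))) := by
      have h8 : ∑ t ∈ Finset.Icc 1 T, d t ^ 2 ≤
          4 * ℓ ^ 2 * ∑ t ∈ Finset.Icc 1 T, (t : ℝ) ^ (-s) := not_lt.1 h₃
      have h9 := sum_rpow_neg_le hs0 hs1 T
      have h10 : ∑ t ∈ Finset.Icc 1 T, (t : ℝ) ^ (-s) ≤ c₀ * (T : ℝ) ^ (1 - s) := by
        have e : (n : ℝ) * ((D : ℝ) - 1) / (n * ((D : ℝ) - 1) - 2) = 1 / (1 - s) := by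
          have : (n : ℝ) * ((D : ℝ) - 1) - 2 ≠ 0 := by linarith
          have h0 : (n : ℝ) * ((D : ℝ) - 1) ≠ 0 := by linarith
          rw [hs, mul_one_div, one_sub_div h0, one_div_div]
        rw [e] at hc₀
        have h11 : ∑ t ∈ Finset.Icc 1 T, (t : ℝ) ^ (-s) ≤ 1 / (1 - s) * (T : ℝ) ^ (1 - s) := by
          rw [div_mul_eq_mul_div, one_mul, le_div_iff₀ (by linarith)]
          linarith
        exact h11.trans (mul_le_mul_of_nonneg_right hc₀.le (by positivity))
      have hc₀0 : 0 ≤ c₀ := by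
        refine le_trans ?_ hc₀.le
        exact div_nonneg (by linarith) (by linarith)
      have e2 : (T : ℝ) ^ (1 - s) = ((T : ℝ) ^ ((1 : ℝ) / 2 - 1 / (n * ((D : ℝ) - 1)))) ^ 2 := by
        rw [← Real.rpow_natCast, ← Real.rpow_mul hT0.le, hs]
        congr 1
        push_cast
        ring
      refine Real.sqrt_le_iff.2 ⟨by positivity, ?_⟩
      rw [mul_pow, mul_pow, mul_pow, Real.sq_sqrt hc₀0, ← e2]
      calc ∑ t ∈ Finset.Icc 1 T, d t ^ 2 ≤ 4 * ℓ ^ 2 * (c₀ * (T : ℝ) ^ (1 - s)) :=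
            h8.trans (mul_le_mul_of_nonneg_left h10 (by positivity))
        _ = _ := by ring
    calc ∑ t ∈ Finset.Icc 1 T, (L * √((I t ω)ᶜ.card) * √(V t)) * d t
        ≤ constC a b δ I T ω / (2 * ℓ) * ∑ t ∈ Finset.Icc 1 T, √(V t) * d t := by
          rw [Finset.mul_sum]
          exact Finset.sum_le_sum h4
      _ ≤ constC a b δ I T ω / (2 * ℓ) * (√(∑ t ∈ Finset.Icc 1 T, V t) *
            (2 * ℓ * (√c₀ * (T : ℝ) ^ ((1 : ℝ) / 2 - 1 / (n * ((D : ℝ) - 1)))))) := by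
          refine mul_le_mul_of_nonneg_left (h6.trans ?_) (by positivity)
          exact mul_le_mul_of_nonneg_left h7 (Real.sqrt_nonneg _)
      _ = extraTerm ρ a b δ c₀ n I T ω := by
          unfold extraTerm
          field_simp
          simp only [hV]
          ring
  exact hreg.trans (add_le_add (add_le_add hpart1 hpart2) hpart3)

end Main

end

end LassoBO

namespace LassoBO

noncomputable section

open scoped ENNReal NNReal

set_option linter.unusedSectionVars false

/-! ### Decay of the posterior variance -/

/-- Anticoncentration of the normal distribution. -/
theorem gaussianReal_Icc_le (v : ℝ≥0) (hv : v ≠ 0) (A : ℝ) :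
    gaussianReal 0 v (Set.Icc (-A) A) ≤ ENNReal.ofReal (A / √v) := by
  have hv0 : (0 : ℝ) < v := by positivity
  have hpdf : ∀ x, gaussianPDF 0 v x ≤ ENNReal.ofReal (1 / (2 * √v)) := by
    intro x
    refine ENNReal.ofReal_le_ofReal ?_
    rw [gaussianPDFReal]
    have h1 : Real.exp (-(x - 0) ^ 2 / (2 * v)) ≤ 1 := by
      refine Real.exp_le_one_iff.2 ?_
      rw [neg_div]
      exact neg_nonpos.2 (by positivity)
    have h2 : 2 * √(v : ℝ) ≤ √(2 * Real.pi * v) := by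
      refine Real.le_sqrt_of_sq_le ?_
      rw [mul_pow, Real.sq_sqrt hv0.le]
      nlinarith [Real.pi_gt_three]
    calc (√(2 * Real.pi * v))⁻¹ * Real.exp (-(x - 0) ^ 2 / (2 * v)) ≤ (√(2 * Real.pi * v))⁻¹ * 1 := by
          gcongr
      _ ≤ 1 / (2 * √v) := by
          rw [mul_one, one_div]
          exact inv_anti₀ (by positivity) h2
  rw [gaussianReal_apply 0 hv]
  calc ∫⁻ x in Set.Icc (-A) A, gaussianPDF 0 v x
      ≤ ∫⁻ _x in Set.Icc (-A) A, ENNReal.ofReal (1 / (2 * √v)) := lintegral_mono hpdf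
    _ = ENNReal.ofReal (1 / (2 * √v)) * volume (Set.Icc (-A) A) := by rw [setLIntegral_const]
    _ = ENNReal.ofReal (A / √v) := by
        rw [Real.volume_Icc, ← ENNReal.ofReal_mul (by positivity)]
        congr 1
        field_simp
        ring

section Kernel

variable {D : ℕ} {Ω S : Type*} [mΩ : MeasurableSpace Ω] [mS : MeasurableSpace S] {P : Measure Ω}
  [IsProbabilityMeasure P] {k : Cube D → Cube D → ℝ} {ρ : Fin D → ℝ} {a b σ κ : ℝ}
  {f : Cube D → Ω → ℝ} {ε : ℕ → Ω → ℝ} {z : ℕ → ℕ → Ω → Cube D} {U : Ω → S}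

theorem IsGPSample.variance_sub (hf : IsGPSample P k ρ a b f) (x y : Cube D) :
    Var[fun ω => f x ω - f y ω; P] = k x x - 2 * k x y + k y y := by
  rw [variance_fun_sub (hf.memLp x) (hf.memLp y), ← covariance_self (hf.measurable x).aemeasurable,
    ← covariance_self (hf.measurable y).aemeasurable, hf.cov_eq, hf.cov_eq, hf.cov_eq]

theorem IsGPSample.map_sub (hf : IsGPSample P k ρ a b f) (x y : Cube D) :
    P.map (fun ω => f x ω - f y ω) =
      gaussianReal 0 (k x x - 2 * k x y + k y y).toNNReal := by
  rw [(hf.gaussian.hasGaussianLaw_fun_sub).map_eq_gaussianReal, hf.variance_sub,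
    integral_sub ((hf.memLp x).integrable one_le_two) ((hf.memLp y).integrable one_le_two),
    hf.mean_zero, hf.mean_zero, sub_zero]

theorem IsGPSample.two_mul_kernel_le (hf : IsGPSample P k ρ a b f) (x y : Cube D) :
    2 * k x y ≤ k x x + k y y := by
  have := variance_nonneg (fun ω => f x ω - f y ω) P
  rw [hf.variance_sub] at this
  linarith

/-- The variance of the increments of the process is at most quadratic in the distance. -/
theorem IsGPSample.exists_variance_sub_le (hf : IsGPSample P k ρ a b f) (ha : 0 < a) (hb : 0 < b)
    (hD : 0 < D) : ∃ C : ℝ, 0 ≤ C ∧ ∀ (x y : Cube D) (r : ℝ), 0 ≤ r →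
      (∀ i, |(x i : ℝ) - y i| ≤ r) → k x x - 2 * k x y + k y y ≤ C * r ^ 2 := by
  set ℓ := b * √(Real.log (2 * D * a / 1)) with hℓ
  have hℓ0 : 0 ≤ ℓ := by positivity
  set B := ℓ * ∑ i, √(ρ i) with hB
  have hB0 : 0 ≤ B := mul_nonneg hℓ0 (Finset.sum_nonneg fun i _ => Real.sqrt_nonneg _)
  refine ⟨4 * B ^ 2, by positivity, fun x y r hr hxy => ?_⟩
  by_contra! hcon
  set s := k x x - 2 * k x y + k y y with hs
  have hs0 : 0 < s := lt_of_le_of_lt (by positivity) hcon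
  have h1 : P {ω | CoordLip ρ ℓ fun x => f x ω}ᶜ ≤ ENNReal.ofReal (1 / 2) :=
    hf.measure_not_coordLip_le ha hb one_pos two_pos hD
  have hsub : {ω | CoordLip ρ ℓ fun x => f x ω} ⊆
      (fun ω => f x ω - f y ω) ⁻¹' Set.Icc (-(B * r)) (B * r) := by
    intro ω hω
    refine abs_le.1 ((hω x y).trans ?_)
    rw [hB, mul_assoc ℓ, Finset.sum_mul]
    exact mul_le_mul_of_nonneg_left (Finset.sum_le_sum fun i _ =>
      mul_le_mul_of_nonneg_left (hxy i) (Real.sqrt_nonneg _)) hℓ0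
  have hne : s.toNNReal ≠ 0 := (Real.toNNReal_pos.2 hs0).ne'
  have h2 : P {ω | CoordLip ρ ℓ fun x => f x ω} ≤ ENNReal.ofReal (B * r / √s) := by
    refine (measure_mono hsub).trans ?_
    have hm : Measurable fun ω => f x ω - f y ω := (hf.measurable x).sub (hf.measurable y)
    rw [← Measure.map_apply hm measurableSet_Icc, hf.map_sub]
    have := gaussianReal_Icc_le s.toNNReal hne (B * r)
    rwa [Real.coe_toNNReal _ hs0.le] at this
  have h3 : B * r / √s < 1 / 2 := by
    rw [div_lt_iff₀ (Real.sqrt_pos.2 hs0)]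
    have : 2 * (B * r) < √s := Real.lt_sqrt_of_sq_lt (by nlinarith)
    linarith
  have h4 : (1 : ℝ≥0∞) ≤ P {ω | CoordLip ρ ℓ fun x => f x ω} +
      P {ω | CoordLip ρ ℓ fun x => f x ω}ᶜ := by
    rw [← measure_univ (μ := P), ← Set.union_compl_self {ω | CoordLip ρ ℓ fun x => f x ω}]
    exact measure_union_le _ _
  have h5 := h4.trans (add_le_add h2 h1)
  rw [← ENNReal.ofReal_add (by positivity) (by norm_num), ← ENNReal.ofReal_one,
    ENNReal.ofReal_le_ofReal_iff (by positivity)] at h5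
  linarith

theorem IsModel.postVar_le_of_near (h : IsModel P σ f ε z U) (hf : IsGPSample P k ρ a b f)
    (hσ : 0 < σ) {X : ℕ → Cube D} {m : ℕ} {x : Cube D} {A : Finset (Fin m)} (hA : A.Nonempty)
    {B : ℝ} (hB : ∀ i ∈ A, k x x - 2 * k x (X i) + k (X i) (X i) ≤ B) :
    postVar k σ m X x ≤ B + σ ^ 2 / A.card := by
  classical
  have hc : (0 : ℝ) < A.card := by exact_mod_cast hA.card_pos
  set w : Fin m → ℝ := fun i => if i ∈ A then (A.card : ℝ)⁻¹ else 0 with hw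
  have hw0 : ∀ i, 0 ≤ w i := fun i => by
    simp only [hw]
    split_ifs <;> positivity
  have hw1 : ∑ i, w i = 1 := by
    simp only [hw, Finset.sum_ite_mem, Finset.univ_inter, Finset.sum_const, nsmul_eq_mul]
    exact mul_inv_cancel₀ hc.ne'
  have hw2 : ∑ i, w i ^ 2 = (A.card : ℝ)⁻¹ := by
    simp only [hw, ite_pow, ne_eq, OfNat.ofNat_ne_zero, not_false_eq_true, zero_pow,
      Finset.sum_ite_mem, Finset.univ_inter, Finset.sum_const, nsmul_eq_mul]
    field_simp
  refine (h.postVar_le_predError hf hσ X m w x).trans ?_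
  have h1 : ∑ i, ∑ j, w i * (w j * k (X i) (X j)) ≤ ∑ i, w i * k (X i) (X i) := by
    have h2 : ∀ i j : Fin m, w i * (w j * k (X i) (X j)) ≤
        (w i * k (X i) (X i)) * w j / 2 + w i * (w j * k (X j) (X j)) / 2 := by
      intro i j
      have := mul_le_mul_of_nonneg_left (hf.two_mul_kernel_le (X i) (X j))
        (mul_nonneg (hw0 i) (hw0 j))
      linarith
    refine (Finset.sum_le_sum fun i _ => Finset.sum_le_sum fun j _ => h2 i j).trans (le_of_eq ?_)
    simp only [Finset.sum_add_distrib, ← Finset.sum_div, ← Finset.mul_sum, ← Finset.sum_mul, hw1]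
    ring
  have h3 : ∑ i, w i * (k x x - 2 * k x (X i) + k (X i) (X i)) ≤ B := by
    calc ∑ i, w i * (k x x - 2 * k x (X i) + k (X i) (X i)) ≤ ∑ i, w i * B := by
          refine Finset.sum_le_sum fun i _ => ?_
          by_cases hi : i ∈ A
          · exact mul_le_mul_of_nonneg_left (hB i hi) (hw0 i)
          · simp [hw, hi]
      _ = B := by rw [← Finset.sum_mul, hw1, one_mul]
  have h4 : ∑ i, w i * (k x x - 2 * k x (X i) + k (X i) (X i)) =
      k x x - 2 * ∑ i, w i * k x (X i) + ∑ i, w i * k (X i) (X i) := by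
    have e : ∀ i, w i * (k x x - 2 * k x (X i) + k (X i) (X i)) =
        w i * k x x - 2 * (w i * k x (X i)) + w i * k (X i) (X i) := fun i => by ring
    simp only [e, Finset.sum_add_distrib, Finset.sum_sub_distrib, ← Finset.sum_mul, hw1, one_mul,
      ← Finset.mul_sum]
  rw [predError, hw2, ← div_eq_mul_inv]
  linarith

end Kernel

/-- Only few members of a sequence are preceded by few members of the same class. -/
theorem card_few_predecessors_le {ι : Type*} [Fintype ι] [DecidableEq ι] (c : ℕ → ι) (V T : ℕ) :
    ((Finset.range T).filter fun s => ((Finset.range s).filter fun r => c r = c s).card < V).card ≤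
      Fintype.card ι * V := by
  set rank : ℕ → ℕ := fun s => ((Finset.range s).filter fun r => c r = c s).card with hrank
  have hlt : ∀ s t, s < t → c s = c t → rank s < rank t := by
    intro s t hst hc
    refine Finset.card_lt_card ((Finset.ssubset_iff_of_subset ?_).2 ⟨s, ?_, ?_⟩)
    · intro r hr
      simp only [Finset.mem_filter, Finset.mem_range] at hr ⊢
      exact ⟨hr.1.trans hst, hr.2.trans hc⟩
    · simp [hst, hc]
    · simp
  have hcard : ((Finset.univ : Finset ι) ×ˢ Finset.range V).card = Fintype.card ι * V := by
    rw [Finset.card_product, Finset.card_range, Finset.card_univ]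
  rw [← hcard]
  refine Finset.card_le_card_of_injOn (fun s => (c s, rank s)) (fun s hs => ?_) fun s _ t _ h => ?_
  · have := (Finset.mem_filter.1 (Finset.mem_coe.1 hs)).2
    simpa using this
  · simp only [Prod.mk.injEq] at h
    by_contra hne
    rcases lt_or_gt_of_ne hne with h1 | h1
    · exact (hlt s t h1 h.1).ne h.2
    · exact (hlt t s h1 h.1.symm).ne h.2.symm

section Sum

variable {D : ℕ} {Ω S : Type*} [mΩ : MeasurableSpace Ω] [mS : MeasurableSpace S] {P : Measure Ω}
  [IsProbabilityMeasure P] {k : Cube D → Cube D → ℝ} {ρ : Fin D → ℝ} {a b σ κ : ℝ}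
  {f : Cube D → Ω → ℝ} {ε : ℕ → Ω → ℝ} {z : ℕ → ℕ → Ω → Cube D} {U : Ω → S}

theorem IsModel.sum_postVar_le_card (h : IsModel P σ f ε z U) (hf : IsGPSample P k ρ a b f)
    (hσ : 0 < σ) (hκ : 0 < κ) (hk : ∀ x, k x x ≤ κ) {C : ℝ} (hC : 0 ≤ C)
    (hvar : ∀ (x y : Cube D) (r : ℝ), 0 ≤ r →
      (∀ i, |(x i : ℝ) - y i| ≤ r) → k x x - 2 * k x y + k y y ≤ C * r ^ 2)
    (X : ℕ → Cube D) (N₀ T : ℕ) {N : ℕ} (hN : 0 < N) :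
    ∑ s ∈ Finset.range T, postVar k σ (N₀ + s) X (X (N₀ + s)) ≤
      T * ((C + σ ^ 2) / N) + κ * (N : ℝ) ^ (D + 1) := by
  classical
  have hN' : (0 : ℝ) < N := by exact_mod_cast hN
  have hN1 : (1 : ℝ) ≤ N := by exact_mod_cast hN
  choose v hv using fun s : unitInterval => exists_cellCentre hN s
  set c : ℕ → Fin D → Fin N := fun s i => v (X (N₀ + s) i) with hc
  have hnear : ∀ s r, c r = c s → ∀ i, |(X (N₀ + s) i : ℝ) - X (N₀ + r) i| ≤ 1 / N := by
    intro s r hsr i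
    have h1 := hv (X (N₀ + s) i)
    have h2 := hv (X (N₀ + r) i)
    have h3 : v (X (N₀ + r) i) = v (X (N₀ + s) i) := congrFun hsr i
    rw [h3] at h2
    have e : 1 / (N : ℝ) = 1 / (2 * N) + 1 / (2 * N) := by field_simp; ring
    rw [e]
    rw [abs_sub_comm] at h2
    exact (abs_sub_le _ _ _).trans (add_le_add h1 h2)
  set F := (Finset.range T).filter fun s =>
    ((Finset.range s).filter fun r => c r = c s).card < N with hF
  have hF1 : (F.card : ℝ) ≤ (N : ℝ) ^ (D + 1) := by
    have h1 := card_few_predecessors_le c N T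
    rw [Fintype.card_fun, Fintype.card_fin, Fintype.card_fin, ← pow_succ] at h1
    exact_mod_cast h1
  have hbound : ∀ s, postVar k σ (N₀ + s) X (X (N₀ + s)) ≤
      (C + σ ^ 2) / N + if ((Finset.range s).filter fun r => c r = c s).card < N then κ else 0 := by
    intro s
    split_ifs with hs
    · have h1 := (h.postVar_le_kernel hf hσ X (N₀ + s) (X (N₀ + s))).trans (hk _)
      have h2 : 0 ≤ (C + σ ^ 2) / N := by positivity
      linarith
    · rw [add_zero]
      refine (h.postVar_add_le hf hσ X N₀ s _).trans ?_
      set A : Finset (Fin s) := Finset.univ.filter fun r : Fin s => c r = c s with hA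
      have hcardA : A.card = ((Finset.range s).filter fun r => c r = c s).card := by
        rw [← Finset.card_map Fin.valEmbedding]
        congr 1
        ext r
        simp only [hA, Finset.mem_map, Finset.mem_filter, Finset.mem_univ, true_and,
          Fin.valEmbedding_apply, Finset.mem_range]
        exact ⟨fun ⟨i, hi, e⟩ => e ▸ ⟨i.2, hi⟩, fun ⟨h1, h2⟩ => ⟨⟨r, h1⟩, h2, rfl⟩⟩
      have hNA : (N : ℝ) ≤ A.card := by
        rw [hcardA]
        exact_mod_cast not_lt.1 hs
      have hAne : A.Nonempty := Finset.card_pos.1 (by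
        rw [hcardA]
        omega)
      have h1 := h.postVar_le_of_near hf hσ (X := fun i => X (N₀ + i)) (x := X (N₀ + s)) hAne
        (B := C * (1 / N) ^ 2) fun i hi => hvar _ _ _ (by positivity)
          (hnear s i (Finset.mem_filter.1 hi).2)
      refine h1.trans ?_
      rw [add_div]
      refine add_le_add ?_ (by gcongr)
      rw [div_eq_mul_one_div C]
      refine mul_le_mul_of_nonneg_left ?_ hC
      have : 1 / (N : ℝ) ≤ 1 := by rw [div_le_one hN']; exact hN1
      exact pow_le_of_le_one (by positivity) this two_ne_zero
  refine (Finset.sum_le_sum fun s _ => hbound s).trans ?_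
  rw [Finset.sum_add_distrib, Finset.sum_const, Finset.card_range, nsmul_eq_mul,
    ← Finset.sum_filter, Finset.sum_const, nsmul_eq_mul, mul_comm κ]
  gcongr

/-- The sum of the posterior variances at the data points grows sublinearly. -/
theorem IsModel.exists_sum_postVar_le_rpow (h : IsModel P σ f ε z U) (hf : IsGPSample P k ρ a b f)
    (hσ : 0 < σ) (hκ : 0 < κ) (hk : ∀ x, k x x ≤ κ) (ha : 0 < a) (hb : 0 < b) (hD : 0 < D) :
    ∃ K : ℝ, 0 ≤ K ∧ ∀ (X : ℕ → Cube D) (N₀ T : ℕ), 1 ≤ T →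
      ∑ s ∈ Finset.range T, postVar k σ (N₀ + s) X (X (N₀ + s)) ≤
        K * (T : ℝ) ^ (1 - (1 : ℝ) / (2 * (D + 1))) := by
  obtain ⟨C, hC, hvar⟩ := hf.exists_variance_sub_le ha hb hD
  refine ⟨C + σ ^ 2 + κ * 2 ^ (D + 1), by positivity, fun X N₀ T hT => ?_⟩
  have hT1 : (1 : ℝ) ≤ T := by exact_mod_cast hT
  have hT0 : (0 : ℝ) < T := by linarith
  set q : ℝ := 1 / (2 * (D + 1)) with hq
  have hq0 : 0 < q := by positivity
  have hq2 : q ≤ 1 / 2 := by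
    rw [hq]
    refine one_div_le_one_div_of_le two_pos ?_
    have : (0 : ℝ) ≤ D := Nat.cast_nonneg _
    linarith
  have hTq : 1 ≤ (T : ℝ) ^ q := Real.one_le_rpow hT1 hq0.le
  set N := ⌈(T : ℝ) ^ q⌉₊ with hN
  have hN0 : 0 < N := Nat.ceil_pos.2 (by linarith)
  have hN1 : (T : ℝ) ^ q ≤ N := Nat.le_ceil _
  have hN2 : (N : ℝ) ≤ 2 * (T : ℝ) ^ q := by
    have := Nat.ceil_lt_add_one (a := (T : ℝ) ^ q) (by linarith)
    rw [← hN] at this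
    linarith
  refine (h.sum_postVar_le_card hf hσ hκ hk hC hvar X N₀ T hN0).trans ?_
  have h1 : (T : ℝ) * ((C + σ ^ 2) / N) ≤ (C + σ ^ 2) * (T : ℝ) ^ (1 - q) := by
    have e : (T : ℝ) ^ (1 - q) = T / (T : ℝ) ^ q := by rw [Real.rpow_sub hT0, Real.rpow_one]
    rw [e, mul_div_assoc', mul_comm (T : ℝ), ← mul_div_assoc]
    gcongr
  have h2 : (N : ℝ) ^ (D + 1) ≤ 2 ^ (D + 1) * (T : ℝ) ^ (1 - q) := by
    calc (N : ℝ) ^ (D + 1) ≤ (2 * (T : ℝ) ^ q) ^ (D + 1) := by gcongr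
      _ = 2 ^ (D + 1) * (T : ℝ) ^ ((1 : ℝ) / 2) := by
          rw [mul_pow, ← Real.rpow_natCast ((T : ℝ) ^ q), ← Real.rpow_mul hT0.le]
          congr 2
          rw [hq]
          push_cast
          field_simp
      _ ≤ _ := by
          gcongr
          linarith
  have h3 := mul_le_mul_of_nonneg_left h2 hκ.le
  linarith

end Sum

end

end LassoBO

namespace LassoBO

noncomputable section

open scoped ENNReal NNReal

set_option linter.unusedSectionVars false

/-! ### The average regret vanishes -/

theorem summable_exp_neg_mul_rpow {c s : ℝ} (hc : 0 < c) (hs : 0 < s) :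
    Summable fun t : ℕ => Real.exp (-(c * (t : ℝ) ^ s)) := by
  have h1 := (isLittleO_exp_neg_mul_rpow_atTop hc (-(2 / s))).comp_tendsto
    ((tendsto_rpow_atTop hs).comp tendsto_natCast_atTop_atTop)
  refine summable_of_isBigO_nat (Real.summable_nat_rpow.2 (by norm_num : (-2 : ℝ) < -1)) ?_
  refine (h1.isBigO.congr' ?_ ?_)
  · exact Eventually.of_forall fun t => by simp [neg_mul]
  · refine Eventually.of_forall fun t => ?_
    simp only [Function.comp_apply]
    rw [← Real.rpow_mul (Nat.cast_nonneg _)]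
    congr 1
    field_simp

theorem tendsto_sum_Icc_div {u : ℕ → ℝ} (h : Tendsto u atTop (𝓝 0)) :
    Tendsto (fun T : ℕ => (∑ t ∈ Finset.Icc 1 T, u t) / T) atTop (𝓝 0) := by
  refine ((tendsto_add_atTop_iff_nat 1).2 h).cesaro.congr fun T => ?_
  have := Finset.sum_Ico_add' u 0 T 1
  rw [zero_add, ← Finset.range_eq_Ico] at this
  rw [this, mul_comm, div_eq_mul_inv]
  rfl

theorem exists_beta_le_rpow {D : ℕ} (ρ : Fin D → ℝ) (a : ℝ) {b δ : ℝ} (hb : 0 < b) (hδ : 0 < δ)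
    {p : ℝ} (hp : 0 < p) : ∃ K : ℝ, 0 ≤ K ∧ ∀ d ≤ D, ∀ T : ℕ,
      beta ρ a b δ d T ≤ K * (T : ℝ) ^ p := by
  set e := p / 2 with he
  have he0 : 0 < e := by positivity
  have hlog : ∀ A x : ℝ, 0 ≤ A → 0 ≤ x → Real.log (A * x ^ 2) ≤ A ^ e / e * x ^ p := by
    intro A x hA hx
    refine (Real.log_le_rpow_div (by positivity) he0).trans (le_of_eq ?_)
    rw [Real.mul_rpow hA (by positivity), ← Real.rpow_natCast, ← Real.rpow_mul hx]
    have : ((2 : ℕ) : ℝ) * e = p := by push_cast; rw [he]; ring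
    rw [this]
    ring
  set G := 4 * √(⨆ i, ρ i) * b * D * √(Real.log (12 * D * a / δ)) with hG
  have hG0 : 0 ≤ G := by positivity
  refine ⟨2 * ((Real.pi ^ 2 / δ) ^ e / e) + 2 * D * (G ^ e / e), by positivity, fun d hd T => ?_⟩
  have hd' : (d : ℝ) ≤ D := by exact_mod_cast hd
  have h1 := hlog (Real.pi ^ 2 / δ) T (by positivity) (Nat.cast_nonneg _)
  have h2 : Real.log (gridScale ρ a b δ d T) ≤ G ^ e / e * (T : ℝ) ^ p := by
    have h3 : 0 ≤ gridScale ρ a b δ d T := by unfold gridScale; positivity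
    have h4 : gridScale ρ a b δ d T ≤ G * (T : ℝ) ^ 2 := by unfold gridScale; rw [hG]; gcongr
    rcases h3.eq_or_lt with h5 | h5
    · rw [← h5, Real.log_zero]
      positivity
    · exact (Real.log_le_log h5 h4).trans (hlog G T hG0 (Nat.cast_nonneg _))
  have h6 : (d : ℝ) * Real.log (gridScale ρ a b δ d T) ≤ D * (G ^ e / e * (T : ℝ) ^ p) :=
    (mul_le_mul_of_nonneg_left h2 (Nat.cast_nonneg _)).trans
      (mul_le_mul_of_nonneg_right hd' (by positivity))
  rw [beta_eq, mul_div_right_comm]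
  linarith

section Average

variable {D : ℕ} {Ω S : Type*} [mΩ : MeasurableSpace Ω] [mS : MeasurableSpace S] {P : Measure Ω}
  [IsProbabilityMeasure P] {k : Cube D → Cube D → ℝ} {ρ : Fin D → ℝ} {a b σ κ δ : ℝ} {n N₀ : ℕ}
  {f : Cube D → Ω → ℝ} {ε : ℕ → Ω → ℝ} {z : ℕ → ℕ → Ω → Cube D} {U : Ω → S}
  {pt : ℕ → Ω → Cube D} {I : ℕ → Ω → Finset (Fin D)} {inc : ℕ → Ω → ℕ}

/-- The distance of the samples to the target points tends to zero. -/
theorem IsModel.ae_tendsto_sampleDist (h : IsModel P σ f ε z U) (hf : IsGPSample P k ρ a b f)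
    (hn : 1 < n) {x : ℕ → Ω → Cube D} {J : ℕ → Ω → Finset (Fin D)}
    (hx : ∀ t ≥ 1, Measurable[nonSampleInfo f hf ε z U t] (x t))
    (hJ : ∀ t ≥ 1, ∀ i, MeasurableSet[nonSampleInfo f hf ε z U t] {ω | i ∈ J t ω})
    (hJne : ∀ t ≥ 1, ∀ ω, (J t ω).Nonempty) :
    ∀ᵐ ω ∂P, Tendsto (fun t => sampleDist (J t ω) (x t ω) (numSub n t) fun j => z t j ω)
      atTop (𝓝 0) := by
  have hn0 : (0 : ℝ) < n := by exact_mod_cast (by omega : 0 < n)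
  have hev : ∀ j : ℕ, ∀ᵐ ω ∂P, ∀ᶠ t in atTop, ω ∉ {ω | 1 / ((j : ℝ) + 1) <
      sampleDist (J (t + 1) ω) (x (t + 1) ω) (numSub n (t + 1)) fun i => z (t + 1) i ω} := by
    intro j
    refine ae_eventually_notMem ?_
    have hr0 : (0 : ℝ) < 1 / ((j : ℝ) + 1) := by positivity
    have hr1 : 1 / ((j : ℝ) + 1) ≤ 1 := by
      rw [div_le_one (by positivity)]
      linarith [Nat.cast_nonneg (α := ℝ) j]
    have hsum := (summable_nat_add_iff 1).2
      (summable_exp_neg_mul_rpow (pow_pos hr0 (D - 1)) (one_div_pos.2 hn0))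
    refine ne_top_of_le_ne_top hsum.tsum_ofReal_ne_top (ENNReal.tsum_le_tsum fun t => ?_)
    refine (h.measure_lt_sampleDist_le hf (t + 1) _ (hx _ (by omega)) (hJ _ (by omega))
      (hJne _ (by omega)) hr0.le hr1).trans
      (ENNReal.ofReal_le_ofReal (Real.exp_le_exp.2 (neg_le_neg ?_)))
    rw [mul_comm]
    exact mul_le_mul_of_nonneg_right (Nat.le_ceil _) (by positivity)
  filter_upwards [ae_all_iff.2 hev] with ω hω
  rw [← tendsto_add_atTop_iff_nat 1]
  refine tendsto_order.2 ⟨fun c hc => Eventually.of_forall fun t =>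
    hc.trans_le (sampleDist_nonneg _ _ _ _), fun c hc => ?_⟩
  obtain ⟨j, hj⟩ := exists_nat_one_div_lt hc
  filter_upwards [hω j] with t ht
  exact (not_lt.1 ht).trans_lt hj

theorem IsGPSample.regret_nonneg (hf : IsGPSample P k ρ a b f) (pt : ℕ → Ω → Cube D) (N₀ T : ℕ)
    (ω : Ω) : 0 ≤ regret f pt N₀ T ω :=
  Finset.sum_nonneg fun _ _ => sub_nonneg.2
    (le_ciSup (isCompact_range (hf.continuous ω)).bddAbove _)

/-- The average regret vanishes on each path with the properties that hold with high probability. -/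
theorem IsRun.tendsto_regret_div (hr : IsRun k σ ρ a b δ n N₀ f ε z U pt I inc)
    (h : IsModel P σ f ε z U) (hf : IsGPSample P k ρ a b f) (hσ : 0 < σ) (hκ : 0 < κ)
    (hk : ∀ x, k x x ≤ κ) (ha : 0 < a) (hb : 0 < b) (hδ : 0 < δ) (hρ : ∀ i, 0 < ρ i)
    (hD : 2 ≤ D) {ω : Ω}
    (hgood : ∀ t ≥ 1, 1 ≤ gridScale ρ a b δ (dMax I t ω) t →
      GoodBounds k σ ρ a b δ n N₀ f ε z pt I t ω)
    (hlip : CoordLip ρ (b * √(Real.log (12 * D * a / δ))) fun x => f x ω) {x : ℕ → Cube D}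
    (hx : ∀ t ≥ 1, ∀ y, f y ω ≤ f (x t) ω + 1 / (8 * (t : ℝ) ^ 2))
    (hdist : Tendsto (fun t => sampleDist (I t ω) (x t) (numSub n t) fun j => z t j ω)
      atTop (𝓝 0)) :
    Tendsto (fun T : ℕ => regret f pt N₀ T ω / T) atTop (𝓝 0) := by
  set L := b * √(Real.log (12 * D * a / δ)) with hL
  have hL0 : 0 ≤ L := by positivity
  set q : ℝ := 1 / (2 * (D + 1)) with hq
  have hq0 : 0 < q := by positivity
  obtain ⟨K₁, hK₁, hβ⟩ := exists_beta_le_rpow ρ a hb hδ (p := q / 2) (by positivity)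
  obtain ⟨K₂, hK₂, hv⟩ := h.exists_sum_postVar_le_rpow hf hσ hκ hk ha hb (by omega)
  set d : ℕ → ℝ := fun t =>
    cappedDist D t (sampleDist (I t ω) (x t) (numSub n t) fun j => z t j ω) with hd
  have hd0 : ∀ t, 0 ≤ d t := fun t => cappedDist_nonneg (sampleDist_nonneg _ _ _ _)
  have hdt : Tendsto d atTop (𝓝 0) := by
    refine hdist.congr' ?_
    filter_upwards [eventually_gt_atTop (2 ^ (D - 1))] with t ht
    simp [hd, cappedDist, not_le.2 ht]
  set c := L * √D * √(∑ i, ρ i) with hc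
  have hlim : Tendsto (fun T : ℕ => √(4 * K₁ * K₂) * (T : ℝ) ^ (-(q / 4)) +
      (∑ t ∈ Finset.Icc 1 T, 1 / (t : ℝ) ^ 2) / T + c * ((∑ t ∈ Finset.Icc 1 T, d t) / T))
      atTop (𝓝 0) := by
    have h1 : Tendsto (fun T : ℕ => (T : ℝ) ^ (-(q / 4))) atTop (𝓝 0) :=
      (tendsto_rpow_neg_atTop (by positivity)).comp tendsto_natCast_atTop_atTop
    have h2 : Tendsto (fun t : ℕ => 1 / (t : ℝ) ^ 2) atTop (𝓝 0) :=
      (tendsto_const_nhds.div_atTop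
        ((tendsto_pow_atTop two_ne_zero).comp tendsto_natCast_atTop_atTop))
    simpa using ((h1.const_mul (√(4 * K₁ * K₂))).add (tendsto_sum_Icc_div h2)).add
      ((tendsto_sum_Icc_div hdt).const_mul c)
  refine squeeze_zero' (Eventually.of_forall fun T =>
    div_nonneg (hf.regret_nonneg pt N₀ T ω) (Nat.cast_nonneg _)) ?_ hlim
  filter_upwards [eventually_ge_atTop 1] with T hT
  have hT0 : (0 : ℝ) < T := by exact_mod_cast hT
  have hreg := hr.regret_le hD hb hδ hρ hgood hL0 le_rfl hlip hx T
  have hA : √(beta ρ a b δ (dMax I T ω) T) * (∑ t ∈ Finset.Icc 1 T, 2 *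
      √(postVar k σ (N₀ + (t - 1)) (fun s => pt s ω) (pt (N₀ + (t - 1)) ω))) ≤
      √(4 * K₁ * K₂) * (T : ℝ) ^ (-(q / 4)) * T := by
    have h1 := h.sum_sqrt_postVar_le_sqrt hf hσ (fun s => pt s ω) N₀ T
    have h2 := hβ (dMax I T ω) (dMax_le I T ω) T
    have h3 := hv (fun s => pt s ω) N₀ T hT
    have e : K₁ * (T : ℝ) ^ (q / 2) * (T * (4 * (K₂ * (T : ℝ) ^ (1 - q)))) =
        4 * K₁ * K₂ * ((T : ℝ) ^ (-(q / 4)) * T) ^ 2 := by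
      have e1 : ((T : ℝ) ^ (-(q / 4)) * T) ^ 2 = (T : ℝ) ^ (q / 2) * (T * (T : ℝ) ^ (1 - q)) := by
        have e2 : ((T : ℝ) ^ (-(q / 4)) * T) = (T : ℝ) ^ (-(q / 4) + 1) := by
          rw [Real.rpow_add hT0, Real.rpow_one]
        have e3 : (T : ℝ) * (T : ℝ) ^ (1 - q) = (T : ℝ) ^ (1 + (1 - q)) := by
          rw [Real.rpow_add hT0, Real.rpow_one]
        rw [e2, e3, ← Real.rpow_add hT0, ← Real.rpow_natCast, ← Real.rpow_mul hT0.le]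
        congr 1
        push_cast
        ring
      rw [e1]
      ring
    calc _ ≤ √(K₁ * (T : ℝ) ^ (q / 2)) * √(T * (4 * (K₂ * (T : ℝ) ^ (1 - q)))) := by
          refine mul_le_mul (Real.sqrt_le_sqrt h2) (h1.trans (Real.sqrt_le_sqrt (by gcongr)))
            (Finset.sum_nonneg fun _ _ => by positivity) (Real.sqrt_nonneg _)
      _ = √(4 * K₁ * K₂) * ((T : ℝ) ^ (-(q / 4)) * T) := by
          rw [← Real.sqrt_mul (by positivity), e, Real.sqrt_mul (by positivity),
            Real.sqrt_sq (by positivity)]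
      _ = _ := by ring
  have hC : ∑ t ∈ Finset.Icc 1 T, (L * √((I t ω)ᶜ.card) * √(∑ i ∈ (I t ω)ᶜ, ρ i)) * d t ≤
      c * ∑ t ∈ Finset.Icc 1 T, d t := by
    rw [Finset.mul_sum]
    refine Finset.sum_le_sum fun t _ => mul_le_mul_of_nonneg_right ?_ (hd0 t)
    have h1 : ((I t ω)ᶜ.card : ℝ) ≤ D := by
      exact_mod_cast (Finset.card_le_univ _).trans_eq (Fintype.card_fin D)
    have h2 : ∑ i ∈ (I t ω)ᶜ, ρ i ≤ ∑ i, ρ i :=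
      Finset.sum_le_sum_of_subset_of_nonneg (Finset.subset_univ _) fun i _ _ => (hρ i).le
    rw [hc]
    gcongr
  rw [div_le_iff₀ hT0, add_mul, add_mul, div_mul_cancel₀ _ hT0.ne', mul_assoc c,
    div_mul_cancel₀ _ hT0.ne']
  exact hreg.trans (add_le_add (add_le_add hA le_rfl) hC)

theorem IsRun.tendsto_regret_bound (hr : IsRun k σ ρ a b δ n N₀ f ε z U pt I inc)
    (h : IsModel P σ f ε z U) (hf : IsGPSample P k ρ a b f) (hσ : 0 < σ) (hκ : 0 < κ)
    (hk : ∀ x, k x x ≤ κ) (ha : 0 < a) (hb : 0 < b) (hδ : 0 < δ) (hδ' : δ < 1)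
    (hρ : ∀ i, 0 < ρ i) (hn : 1 < n) (hnD : 2 < (n : ℝ) * ((D : ℝ) - 1)) :
    1 - δ ≤ P.real {ω | Tendsto (fun T : ℕ => regret f pt N₀ T ω / T) atTop (𝓝 0)} := by
  have hD := two_le_of_two_lt_mul hnD
  set B₁ := {ω | CoordLip ρ (b * √(Real.log (12 * D * a / δ))) fun x => f x ω}ᶜ with hB₁
  set B₂ := {ω | ∃ t ≥ 1, 1 ≤ gridScale ρ a b δ (dMax I t ω) t ∧
    ¬ GoodBounds k σ ρ a b δ n N₀ f ε z pt I t ω} with hB₂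
  set B₃ := {ω | ¬ Tendsto (fun t => sampleDist (I t ω) (target hf t ω) (numSub n t)
    fun j => z t j ω) atTop (𝓝 0)} with hB₃
  have hP₁ : P B₁ ≤ ENNReal.ofReal (δ / 12) :=
    hf.measure_not_coordLip_le ha hb hδ (by norm_num) (by omega)
  have hP₂ : P B₂ ≤ ENNReal.ofReal (0.36 * δ) := hr.measure_exists_fail_le h hf hσ hδ hδ' hn
  have hP₃ : P B₃ = 0 := h.ae_tendsto_sampleDist hf hn (fun t _ => measurable_target hf t)
    (fun t ht => hr.measurableSet_mem_nonSampleInfo hf ht) fun t ht => hr.select_nonempty t ht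
  refine one_sub_le_measureReal hδ.le (B := B₁ ∪ (B₂ ∪ B₃)) (fun ω hω => ?_) ?_
  · simp only [Set.mem_union, not_or] at hω
    obtain ⟨h₁, h₂, h₃⟩ := hω
    refine hr.tendsto_regret_div h hf hσ hκ hk ha hb hδ hρ hD (fun t ht hτ => ?_) (not_not.1 h₁)
      (x := fun t => target hf t ω) (fun t ht y => le_target hf ht ω y) (not_not.1 h₃)
    by_contra hcon
    exact h₂ ⟨t, ht, hτ, hcon⟩
  · refine (measure_union_le _ _).trans ((add_le_add hP₁ ((measure_union_le _ _).trans
      (add_le_add hP₂ hP₃.le))).trans ?_)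
    rw [add_zero, ← ENNReal.ofReal_add (by positivity) (by positivity)]
    exact ENNReal.ofReal_le_ofReal (by linarith)

end Average

end

end LassoBO

theorem corollary1 {D : ℕ} {Ω S : Type*} [MeasurableSpace Ω] [MeasurableSpace S]
    (P : Measure Ω) [IsProbabilityMeasure P]
    (k : LassoBO.Cube D → LassoBO.Cube D → ℝ) (κ σ : ℝ) (hκ : 0 < κ) (hσ : 0 < σ)
    (hk : ∀ x, k x x ≤ κ)
    (ρ : Fin D → ℝ) (hρ : ∀ i, 0 < ρ i) (a b : ℝ) (ha : 0 < a) (hb : 0 < b)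
    (f : LassoBO.Cube D → Ω → ℝ) (hf : LassoBO.IsGPSample P k ρ a b f)
    (ε : ℕ → Ω → ℝ) (z : ℕ → ℕ → Ω → LassoBO.Cube D) (U : Ω → S)
    (hmodel : LassoBO.IsModel P σ f ε z U)
    (δ : ℝ) (hδ : 0 < δ) (hδ' : δ < 1)
    (n : ℕ) (hn : 1 < n) (hnD : 2 < (n : ℝ) * ((D : ℝ) - 1))
    (N₀ : ℕ) (hN₀ : 1 ≤ N₀)
    (pt : ℕ → Ω → LassoBO.Cube D) (I : ℕ → Ω → Finset (Fin D)) (inc : ℕ → Ω → ℕ)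
    (hrun : LassoBO.IsRun k σ ρ a b δ n N₀ f ε z U pt I inc)
    (c₀ : ℝ) (hc₀ : (n : ℝ) * ((D : ℝ) - 1) / (n * ((D : ℝ) - 1) - 2) < c₀) :
    (∀ T : ℕ, 1 ≤ T →
      1 - δ ≤ P.real {ω | LassoBO.regret f pt N₀ T ω ≤
        √(LassoBO.beta ρ a b δ (LassoBO.dMax I T ω) T * LassoBO.C₁ κ σ * T *
            LassoBO.maxInfoGain P f σ T) +
          Real.pi ^ 2 / 6 + LassoBO.extraTerm ρ a b δ c₀ n I T ω}) ∧
    (∀ T : ℕ, 1 ≤ T → ∀ ω, LassoBO.extraTerm ρ a b δ c₀ n I T ω ≤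
      LassoBO.worstC D a b δ * √c₀ * √(∑ i, ρ i) *
        (T : ℝ) ^ (1 - 1 / (n * ((D : ℝ) - 1)))) ∧
    1 - δ ≤ P.real {ω |
      Tendsto (fun T : ℕ => LassoBO.regret f pt N₀ T ω / T) atTop (𝓝 0)} := by
  exact ⟨fun T hT => hrun.regret_bound hmodel hf hσ hκ hk ha hb hδ hδ' hρ hn hnD hc₀ hT,
    fun T hT ω => hrun.extraTerm_le hb hδ hδ' hρ hT ω,
    hrun.tendsto_regret_bound hmodel hf hσ hκ hk ha hb hδ hδ' hρ hn hnD⟩
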